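/- Let $\mathbb B^3\subset\mathbb R^3$ be the open unit ball and $\mathbb S^2$ its boundary sphere, and for $\mathbf w\in\mathbb B^3$ let $$g_{\mathbf w}(\mathbf x)=\frac{\mathbf x(1-|\mathbf w|^2)+\mathbf w(1+|\mathbf x|^2+2\langle\mathbf w,\mathbf x\rangle)}{1+|\mathbf w|^2|\mathbf x|^2+2\langle \mathbf w,\mathbf x\rangle}.$$ Let $\eta_{\mathbf 0}$ be the normalized Lebesgue probability measure on $\mathbb S^2$ and $\eta_{\mathbf z}=(g_{\mathbf z})_*\eta_{\mathbf 0}$ for $\mathbf z\in\mathbb B^3$. The conformal barycenter $B(\mu)\in\mathbb B^3$ of a probability measure $\mu$ on $\mathbb S^2$ without atoms of mass $\ge 1/2$ is the unique zero in $\mathbb B^3$ of the vector field $V_\mu(\mathbf w)=\frac{1-|\mathbf w|^2}{2}\int_{\mathbb S^2}g_{-\mathbf w}(\zeta)\,d\mu(\zeta)$. The Douady--Earle extension $E(\phi)$ of $\phi:\mathbb S^2\to\mathbb S^2$ (measurable, with $\phi_*\eta_{\mathbf 0}$ without atoms) is the self map of the closed unit ball given by $\phi$ on $\mathbb S^2$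 and by $E(\phi)(\mathbf z)=B(\phi_*\eta_{\mathbf z})$ for $\mathbf z\in\mathbb B^3$. Let $S:\overline{\mathbb C}\to\mathbb S^2$ be the stereographic projection $S(x+iy)=\frac{1}{1+|z|^2}(2x,2y,1-|z|^2)$, where $z=x+iy$, with $S(\infty)=-\mathbf e_3$, and write $\widehat f=S\circ f\circ S^{-1}$ for $f:\overline{\mathbb C}\to\overline{\mathbb C}$. For $t>0$ let $M_t(z)=tz$, and let $\mathbb D_t\subset\mathbb B^3$ be the totally geodesic disc, for the hyperbolic metric of the ball, whose boundary circle is $\widehat M_t(\{\mathbf x\in\mathbb S^2: x_3=0\})$. Let $d\ge 1$ and $f(z)=z^d$ on $\overline{\mathbb C}$. Then: 1. For every $t>0$, $E(\widehat f)$ maps $\mathbb D_t$ onto $\mathbb D_{t^d}$, and the restriction $\mathbb D_t\to\mathbb D_{t^d}$ is a ramified covering of degree $d$. That is, it is continuous and each point $y$ of $\mathbb D_{t^d}$ has an open neighbourhood $U$ with a homeomorphism $\psi:U\to\{|z|<1\}$, $\psi(y)=0$, such that the preimage of $U$ is a finite disjoint union of open sets $V_i$ with homeomorphisms $\varphi_i:V_i\to\{|z|<1\}$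 satisfying $\psi\circ E(\widehat f)=\varphi_i^{k_i}$ on $V_i$, where $k_i\ge1$ and $\sum_i k_i=d$. 2. $E(\widehat f)$ maps the segment $[\mathbf 0,\mathbf e_3[\,=\{s\,\mathbf e_3: 0\le s<1\}$ onto itself by an increasing diffeomorphism: there is a strictly increasing bijection $\tau:[0,1)\to[0,1)$, of class $C^\infty$ together with its inverse, such that $E(\widehat f)(s\,\mathbf e_3)=\tau(s)\,\mathbf e_3$ for all $s\in[0,1)$. -/

import Mathlib

open MeasureTheory Set Metric
open scoped ContDiff

noncomputable section

/-- Euclidean three-space. -/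
abbrev E3 : Type := EuclideanSpace ℝ (Fin 3)

/-- The unit sphere of Euclidean three-space. -/
abbrev S2 : Type := sphere (0 : E3) 1

/-- The third standard basis vector. -/
def e3 : E3 := EuclideanSpace.single 2 1

/-! ### The Möbius transformations and the harmonic measures -/

/-- The Möbius transformation `g_w` of the closed unit ball that sends `0` to `w`, `‖w‖ < 1`. -/
def moebius (w x : E3) : E3 :=
  (1 + ‖w‖ ^ 2 * ‖x‖ ^ 2 + 2 * inner ℝ w x)⁻¹ •
    ((1 - ‖w‖ ^ 2) • x + (1 + ‖x‖ ^ 2 + 2 * inner ℝ w x) • w)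

theorem norm_moebius_eq_one (w x : E3) (hw : ‖w‖ < 1) (hx : ‖x‖ = 1) : ‖moebius w x‖ = 1 := by
  have hin : -(‖w‖ * ‖x‖) ≤ inner ℝ w x := neg_le_of_abs_le (abs_real_inner_le_norm w x)
  rw [hx, mul_one] at hin
  have hpos : 0 < 1 + ‖w‖ ^ 2 * ‖x‖ ^ 2 + 2 * inner ℝ w x := by
    rw [hx]; nlinarith [sq_nonneg (1 - ‖w‖)]
  have hnum : ‖(1 - ‖w‖ ^ 2) • x + (1 + ‖x‖ ^ 2 + 2 * inner ℝ w x) • w‖ ^ 2 =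
      (1 + ‖w‖ ^ 2 * ‖x‖ ^ 2 + 2 * inner ℝ w x) ^ 2 := by
    rw [norm_add_sq_real, norm_smul, norm_smul, real_inner_smul_left, real_inner_smul_right,
      mul_pow, mul_pow, Real.norm_eq_abs, Real.norm_eq_abs, sq_abs, sq_abs, hx,
      real_inner_comm w x]
    ring
  have h2 : ‖(1 - ‖w‖ ^ 2) • x + (1 + ‖x‖ ^ 2 + 2 * inner ℝ w x) • w‖ =
      1 + ‖w‖ ^ 2 * ‖x‖ ^ 2 + 2 * inner ℝ w x :=
    (sq_eq_sq₀ (norm_nonneg _) hpos.le).1 hnum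
  rw [moebius, norm_smul, h2, norm_inv, Real.norm_of_nonneg hpos.le, inv_mul_cancel₀ hpos.ne']

/-- The restriction of `g_w` to the unit sphere. -/
def moebiusSphere (w : E3) (hw : ‖w‖ < 1) (x : S2) : S2 :=
  ⟨moebius w x, mem_sphere_zero_iff_norm.2
    (norm_moebius_eq_one w x hw (mem_sphere_zero_iff_norm.1 x.2))⟩

/-- The normalized Lebesgue (area) probability measure on the unit sphere. -/
def eta0 : Measure S2 :=
  ((volume : Measure E3).toSphere univ)⁻¹ • (volume : Measure E3).toSphere

/-- The harmonic measure with center `w`: the push-forward of `eta0` by `g_w`. -/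
def eta (w : E3) (hw : ‖w‖ < 1) : Measure S2 := eta0.map (moebiusSphere w hw)

/-! ### The conformal barycenter and the Douady-Earle extension -/

/-- The conformally natural vector field of a measure on the sphere. -/
def vectorField (μ : Measure S2) (w : E3) : E3 :=
  ((1 - ‖w‖ ^ 2) / 2) • ∫ ζ : S2, moebius (-w) ζ ∂μ

open scoped Classical in
/-- The conformal barycenter: the unique zero of the vector field in the open unit ball
(with the default value `0` if there is no unique zero). -/
def barycenter (μ : Measure S2) : E3 :=
  if h : ∃! w : E3, ‖w‖ < 1 ∧ vectorField μ w = 0 then h.choose else 0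

open scoped Classical in
/-- The Douady-Earle extension of a self map `φ` of the sphere to the closed ball
(with the default value `0` outside the closed ball). -/
def douadyEarle (φ : S2 → S2) (z : E3) : E3 :=
  if h : ‖z‖ < 1 then barycenter ((eta z h).map φ)
  else if h' : ‖z‖ = 1 then φ ⟨z, mem_sphere_zero_iff_norm.2 h'⟩
  else 0

/-! ### Stereographic projection -/

/-- `S(z) = (2x, 2y, 1 - |z|²) / (1 + |z|²)` for `z = x + iy`. -/
def stereoFun (z : ℂ) : E3 :=
  (1 + ‖z‖ ^ 2)⁻¹ • !₂[2 * z.re, 2 * z.im, 1 - ‖z‖ ^ 2]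

theorem norm_stereoFun (z : ℂ) : ‖stereoFun z‖ = 1 := by
  have hpos : 0 < 1 + ‖z‖ ^ 2 := by positivity
  have hz : ‖z‖ ^ 2 = z.re ^ 2 + z.im ^ 2 := by
    rw [← Complex.normSq_eq_norm_sq, Complex.normSq_apply]; ring
  have h : ‖(!₂[2 * z.re, 2 * z.im, 1 - ‖z‖ ^ 2] : E3)‖ = 1 + ‖z‖ ^ 2 := by
    rw [← sq_eq_sq₀ (norm_nonneg _) hpos.le, EuclideanSpace.norm_sq_eq]
    simp [Fin.sum_univ_three, hz]
    ring
  rw [stereoFun, norm_smul, h, norm_inv, Real.norm_of_nonneg hpos.le, inv_mul_cancel₀ hpos.ne']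

theorem norm_neg_e3 : ‖-e3‖ = 1 := by simp [e3]

/-- The map `S` from the Riemann sphere to the unit sphere, with `S(∞) = -e₃`. -/
def stereoTo : OnePoint ℂ → S2
  | none => ⟨-e3, mem_sphere_zero_iff_norm.2 norm_neg_e3⟩
  | some z => ⟨stereoFun z, mem_sphere_zero_iff_norm.2 (norm_stereoFun z)⟩

open scoped Classical in
/-- The inverse of `S`. -/
def stereoInv (x : S2) : OnePoint ℂ :=
  if x.1 2 = -1 then OnePoint.infty
  else OnePoint.some (⟨x.1 0 / (1 + x.1 2), x.1 1 / (1 + x.1 2)⟩ : ℂ)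

theorem S2_sum_sq (x : S2) : x.1 0 ^ 2 + x.1 1 ^ 2 + x.1 2 ^ 2 = 1 := by
  have h := mem_sphere_zero_iff_norm.1 x.2
  have h2 := EuclideanSpace.norm_sq_eq x.1
  rw [h] at h2
  simp [Fin.sum_univ_three] at h2
  linarith

theorem stereoInv_stereoTo (z : OnePoint ℂ) : stereoInv (stereoTo z) = z := by
  match z with
  | none => simp [stereoInv, stereoTo, e3]; rfl
  | some z =>
    have hpos : 0 < 1 + ‖z‖ ^ 2 := by positivity
    have h2 : (stereoFun z) 2 = (1 + ‖z‖ ^ 2)⁻¹ * (1 - ‖z‖ ^ 2) := by simp [stereoFun]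
    have h3 : 1 + (stereoFun z) 2 = 2 * (1 + ‖z‖ ^ 2)⁻¹ := by
      rw [h2]; field_simp; ring
    have h4 : (stereoFun z) 2 ≠ -1 := by
      intro h
      rw [h] at h3
      have : 0 < (1 + ‖z‖ ^ 2)⁻¹ := by positivity
      linarith
    simp only [stereoInv, stereoTo, h4, if_false, h3]
    refine congrArg some (Complex.ext ?_ ?_)
    · simp [stereoFun]; field_simp
    · simp [stereoFun]; field_simp

theorem stereoTo_stereoInv (x : S2) : stereoTo (stereoInv x) = x := by
  have hx := S2_sum_sq x
  by_cases h : x.1 2 = -1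
  · have h0 : x.1 0 = 0 := by nlinarith [sq_nonneg (x.1 0), sq_nonneg (x.1 1)]
    have h1 : x.1 1 = 0 := by nlinarith [sq_nonneg (x.1 0), sq_nonneg (x.1 1)]
    simp only [stereoInv, h, if_true]
    apply Subtype.ext
    change -e3 = x.1
    ext i
    fin_cases i
    · simp [e3, h0]
    · simp [e3, h1]
    · simp [e3, h]
  · have h' : 1 + x.1 2 ≠ 0 := fun hh => h (by linarith)
    simp only [stereoInv, h, if_false]
    apply Subtype.ext
    change stereoFun _ = x.1
    have hn : ‖(⟨x.1 0 / (1 + x.1 2), x.1 1 / (1 + x.1 2)⟩ : ℂ)‖ ^ 2 =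
        (1 - x.1 2) / (1 + x.1 2) := by
      rw [← Complex.normSq_eq_norm_sq, Complex.normSq_apply]
      field_simp
      linarith
    have hn' : 1 + (1 - x.1 2) / (1 + x.1 2) = 2 / (1 + x.1 2) := by
      field_simp; ring
    ext i
    rw [stereoFun, hn, hn']
    fin_cases i
    · simp; field_simp
    · simp; field_simp
    · simp; field_simp; ring

/-- Stereographic projection as a bijection of the Riemann sphere onto the unit sphere. -/
def stereo : OnePoint ℂ ≃ S2 :=
  ⟨stereoTo, stereoInv, stereoInv_stereoTo, stereoTo_stereoInv⟩

/-- The conjugate by stereographic projection of a self map of the Riemann sphere. -/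
def hat (f : OnePoint ℂ → OnePoint ℂ) (x : S2) : S2 := stereo (f (stereo.symm x))

/-- The map `z ↦ z ^ d` of the Riemann sphere, fixing `∞`. -/
def powMap (d : ℕ) : OnePoint ℂ → OnePoint ℂ := OnePoint.map (fun z : ℂ => z ^ d)

/-- The homothety `z ↦ t z` of the Riemann sphere, fixing `∞`. -/
def homothety (t : ℝ) : OnePoint ℂ → OnePoint ℂ := OnePoint.map (fun z : ℂ => (t : ℂ) * z)

/-! ### Geodesic discs -/

/-- The unit circle in the plane `x₃ = 0`, as a subset of the unit sphere. -/
def unitCircle : Set S2 := {x | x.1 2 = 0}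

/-- The (totally) geodesic disc of the ball model of hyperbolic space bounded by the circle `C`
of the unit sphere. If `C` is cut out by the plane `⟪n, y⟫ = c`, this is the intersection of the
open ball with the sphere with center `c⁻¹ • n` orthogonal to the unit sphere
(with the plane `⟪n, x⟫ = 0` if `c = 0`). -/
def geodesicDisc (C : Set S2) : Set E3 :=
  {x | ‖x‖ < 1 ∧ ∃ (n : E3) (c : ℝ), ‖n‖ = 1 ∧ |c| < 1 ∧ C = {y : S2 | inner ℝ n y.1 = c} ∧
    2 * inner ℝ n x = c * (1 + ‖x‖ ^ 2)}

/-- The geodesic disc `D_t` bounded by the image of the unit circle under the homothety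
`z ↦ t z`. -/
def discD (t : ℝ) : Set E3 := geodesicDisc (hat (homothety t) '' unitCircle)

/-! ### Ramified coverings and diffeomorphisms of intervals -/

/-- `p` is a (finite) ramified covering of degree `d` between surfaces: each point `y` of the
target is the center of an open disc over which `p` is a finite disjoint union of
discs, on the `i`-th of which `p` reads `z ↦ z ^ k i` in suitable topological coordinates, with
`∑ i, k i = d`. -/
def IsRamifiedCovering {X Y : Type*} [TopologicalSpace X] [TopologicalSpace Y]
    (p : X → Y) (d : ℕ) : Prop :=
  Continuous p ∧ ∀ y : Y, ∃ (ψ : OpenPartialHomeomorph Y ℂ) (m : ℕ) (k : Fin m → ℕ)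
    (φ : Fin m → OpenPartialHomeomorph X ℂ),
    y ∈ ψ.source ∧ ψ y = 0 ∧ ψ.target = ball 0 1 ∧
    (∀ i, (φ i).target = ball 0 1) ∧
    Pairwise (fun i j => Disjoint (φ i).source (φ j).source) ∧
    p ⁻¹' ψ.source = ⋃ i, (φ i).source ∧
    (∀ i, 1 ≤ k i) ∧ ∑ i, k i = d ∧
    ∀ i, ∀ x ∈ (φ i).source, ψ (p x) = φ i x ^ k i

/-- `τ` restricts to an increasing smooth diffeomorphism of the interval `I` onto `J`. -/
def IsIncreasingDiffeo (τ : ℝ → ℝ) (I J : Set ℝ) : Prop :=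
  BijOn τ I J ∧ StrictMonoOn τ I ∧ ContDiffOn ℝ ∞ τ I ∧
    ContDiffOn ℝ ∞ (Function.invFunOn τ I) J

end

/-!
The theorem is proved in the hyperboloid model. A point `w` of the ball corresponds to the point
`(lift P, P)` of the hyperboloid `p₀² - ‖P‖² = 1`, with `w = ballPoint P`, and a point `ζ` of the
sphere to the null vector `(1, ζ)`; their Lorentz product is `pairing P ζ`. In these terms `w` is a
zero of the vector field of `μ` if and only if the integral of the null vectors `(1, ζ)`, divided by
`pairing P ζ`, is `(lift P, P)` itself (`IsMoment`). If two points satisfy this equation, then a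
nonnegative function on the sphere with at most two zeros has integral zero, so the solution is
unique for a measure without atoms (`IsMoment.barycenter_eq`). It therefore suffices to exhibit
a solution of the moment equation for each of the measures in question.

In the coordinates `v + iθ` of the cylinder, where the sphere minus its poles is the image of the
exponential map, the power map is the multiplication by `d`, and the harmonic measure has density
`1 / (4π (cosh v · pairing P)²)` (`eta_eq_map_cyl`). Translations of the cylinder come from the
isometries of hyperbolic space that rotate about the third axis or translate along it. They reduce
the moment equation to centers `S • e1` on the first axis (`isMoment_polar`), where the components
along the other two axes vanish by symmetry. What is left is equivalent to a single scalar equation: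
the function `profile τ u = (u - τ) / (1 - τ u)` of the first coordinate of the image has mean zero
(`axisMean`).

This mean is strictly decreasing in `τ`, and it is strictly increasing in `S`
(`axisMean_strictMono`). For the latter, parametrize the circles of latitude by the hyperbolic
distance `x` of the center to the geodesic disc that they bound. For fixed `x` the mean over the
circle is a trigonometric integral that can be evaluated by Cauchy's formula, and each ingredient of
the value is monotone in `S`. By the intermediate value theorem the pairs of a center and an image
form the graph of an increasing bijection `σ` of the half-line (`exists_radial`).

Consequently the extension maps the geodesic disc at height `-L`, parametrized by the complex plane
through `discPoint L`, to the one at height `-d L`, and reads `S exp (iθ) ↦ σ S exp (i d θ)`. This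
is `z ↦ z ^ d` preceded by a radial homeomorphism, whence the ramified covering. The centers of the
discs form the third axis, on which the extension is `L ↦ d L`; in the Euclidean coordinate this is
the explicit diffeomorphism `axisPow d`.
-/

/-! ### The hyperboloid model -/

/-- The time coordinate of the point of the hyperboloid `p₀² - ‖P‖² = 1` above `P`. -/
noncomputable def lift (P : E3) : ℝ := √(1 + ‖P‖ ^ 2)

/-- The point of the ball model that corresponds to the point `(lift P, P)` of the hyperboloid. -/
noncomputable def ballPoint (P : E3) : E3 := (1 + lift P)⁻¹ • P

/-- The Lorentz product of the point `(lift P, P)` of the hyperboloid and the null vector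
`(1, ζ)`. -/
noncomputable def pairing (P ζ : E3) : ℝ := lift P - inner ℝ P ζ

theorem lift_sq (P : E3) : lift P ^ 2 = 1 + ‖P‖ ^ 2 := Real.sq_sqrt (by positivity)

theorem one_le_lift (P : E3) : 1 ≤ lift P := Real.one_le_sqrt.2 (by nlinarith [sq_nonneg ‖P‖])

theorem lift_pos (P : E3) : 0 < lift P := one_pos.trans_le (one_le_lift P)

theorem norm_lt_lift (P : E3) : ‖P‖ < lift P := by
  refine lt_of_pow_lt_pow_left₀ 2 (lift_pos P).le ?_
  rw [lift_sq]; linarith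

theorem continuous_lift : Continuous lift := by unfold lift; fun_prop

theorem lift_sub_norm_le_pairing (P : E3) (ζ : S2) : lift P - ‖P‖ ≤ pairing P ζ := by
  have h := real_inner_le_norm P (ζ : E3)
  rw [mem_sphere_zero_iff_norm.1 ζ.2, mul_one] at h
  unfold pairing; linarith

theorem pairing_pos (P : E3) (ζ : S2) : 0 < pairing P ζ :=
  (sub_pos.2 (norm_lt_lift P)).trans_le (lift_sub_norm_le_pairing P ζ)

theorem continuous_pairing (P : E3) : Continuous fun ζ : S2 => pairing P ζ := by
  unfold pairing; fun_prop

theorem continuous_pairing_inv (P : E3) : Continuous fun ζ : S2 => (pairing P ζ)⁻¹ :=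
  (continuous_pairing P).inv₀ fun ζ => (pairing_pos P ζ).ne'

theorem norm_sq_ballPoint (P : E3) : ‖ballPoint P‖ ^ 2 = (lift P - 1) / (1 + lift P) := by
  have h := lift_pos P
  have h2 := lift_sq P
  rw [ballPoint, norm_smul, norm_inv, Real.norm_of_nonneg (by positivity), mul_pow]
  field_simp
  linarith

theorem norm_ballPoint_lt (P : E3) : ‖ballPoint P‖ < 1 := by
  have h := lift_pos P
  refine lt_of_pow_lt_pow_left₀ 2 zero_le_one ?_
  rw [norm_sq_ballPoint, one_pow, div_lt_one (by positivity)]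
  linarith

theorem continuous_ballPoint : Continuous ballPoint := by
  unfold ballPoint
  refine Continuous.smul (Continuous.inv₀ (continuous_const.add continuous_lift) ?_) continuous_id
  exact fun P => (add_pos one_pos (lift_pos P)).ne'

/-- The inverse of `ballPoint`. -/
noncomputable def hypPoint (w : E3) : E3 := (2 / (1 - ‖w‖ ^ 2)) • w

theorem lift_hypPoint {w : E3} (hw : ‖w‖ < 1) :
    lift (hypPoint w) = (1 + ‖w‖ ^ 2) / (1 - ‖w‖ ^ 2) := by
  have h : 0 < 1 - ‖w‖ ^ 2 := by nlinarith [norm_nonneg w]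
  rw [lift, Real.sqrt_eq_iff_mul_self_eq_of_pos (by positivity), hypPoint, norm_smul,
    Real.norm_of_nonneg (by positivity)]
  field_simp
  ring

theorem ballPoint_hypPoint {w : E3} (hw : ‖w‖ < 1) : ballPoint (hypPoint w) = w := by
  have h : 0 < 1 - ‖w‖ ^ 2 := by nlinarith [norm_nonneg w]
  rw [ballPoint, lift_hypPoint hw, hypPoint, smul_smul]
  convert one_smul ℝ w using 2
  field_simp
  ring

theorem hypPoint_ballPoint (P : E3) : hypPoint (ballPoint P) = P := by
  have h := lift_pos P
  rw [hypPoint, norm_sq_ballPoint, ballPoint, smul_smul]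
  convert one_smul ℝ P using 2
  have : 1 - (lift P - 1) / (1 + lift P) = 2 / (1 + lift P) := by field_simp; ring
  rw [this]
  field_simp

theorem moebius_neg_ballPoint (P : E3) (ζ : S2) :
    moebius (-ballPoint P) ζ =
      (pairing P ζ)⁻¹ • (ζ : E3) - (1 + (pairing P ζ)⁻¹) • ballPoint P := by
  have h := lift_pos P
  have hl := pairing_pos P ζ
  have hin : inner ℝ (ballPoint P) (ζ : E3) = (lift P - pairing P ζ) / (1 + lift P) := by
    rw [ballPoint, real_inner_smul_left, pairing]; field_simp; ring
  rw [moebius, norm_neg, norm_sq_ballPoint, mem_sphere_zero_iff_norm.1 ζ.2, inner_neg_left, hin,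
    smul_add, smul_smul, smul_smul, smul_neg, ← sub_eq_add_neg]
  have hd : 1 + (lift P - 1) / (1 + lift P) * 1 ^ 2
      + 2 * -((lift P - pairing P ζ) / (1 + lift P)) = 2 * pairing P ζ / (1 + lift P) := by
    field_simp; ring
  rw [hd]
  congr 2
  · field_simp; ring
  · field_simp; ring

/-! ### The conformal barycenter -/

/-- The barycenter equation, read in the hyperboloid model: the integral of the null vectors
`(1, ζ)`, scaled to have Lorentz product `1` with `(lift P, P)`, is `(lift P, P)`. -/
def IsMoment (μ : Measure S2) (P : E3) : Prop :=
  ∫ ζ : S2, (pairing P ζ)⁻¹ • (ζ : E3) ∂μ = P ∧ ∫ ζ : S2, (pairing P ζ)⁻¹ ∂μ = lift P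

theorem integrable_of_continuous_sphere {F : Type*} [NormedAddCommGroup F]
    [SecondCountableTopologyEither S2 F] {μ : Measure S2} [IsFiniteMeasure μ] {f : S2 → F}
    (hf : Continuous f) : Integrable f μ := by
  obtain ⟨C, hC⟩ := isCompact_univ.exists_bound_of_continuousOn hf.continuousOn
  exact Integrable.of_bound hf.aestronglyMeasurable C (ae_of_all _ fun x => hC x (mem_univ x))

theorem lift_mul_sub_inner {μ : Measure S2} [IsProbabilityMeasure μ] (P : E3) :
    lift P * ∫ ζ : S2, (pairing P ζ)⁻¹ ∂μ
      - inner ℝ P (∫ ζ : S2, (pairing P ζ)⁻¹ • (ζ : E3) ∂μ) = 1 := by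
  have h1 : Integrable (fun ζ : S2 => (pairing P ζ)⁻¹) μ :=
    integrable_of_continuous_sphere (continuous_pairing_inv P)
  have h2 : Integrable (fun ζ : S2 => (pairing P ζ)⁻¹ • (ζ : E3)) μ :=
    integrable_of_continuous_sphere ((continuous_pairing_inv P).smul continuous_subtype_val)
  rw [← integral_inner h2, ← integral_const_mul, ← integral_sub (h1.const_mul _)
    (h2.const_inner P)]
  have : ∀ ζ : S2, lift P * (pairing P ζ)⁻¹ - inner ℝ P ((pairing P ζ)⁻¹ • (ζ : E3)) = 1 := by
    intro ζ
    rw [real_inner_smul_right]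
    have := (pairing_pos P ζ).ne'
    rw [mul_comm (lift P), ← mul_sub, ← pairing, inv_mul_cancel₀ this]
  simp [this]

theorem inner_ballPoint_self (P : E3) : inner ℝ P (ballPoint P) = lift P - 1 := by
  have h := lift_pos P
  rw [ballPoint, real_inner_smul_right, real_inner_self_eq_norm_sq]
  field_simp
  linarith [lift_sq P]

theorem vectorField_ballPoint_eq_zero_iff {μ : Measure S2} [IsProbabilityMeasure μ] (P : E3) :
    vectorField μ (ballPoint P) = 0 ↔ IsMoment μ P := by
  have h := lift_pos P
  have h1 : Integrable (fun ζ : S2 => (pairing P ζ)⁻¹) μ :=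
    integrable_of_continuous_sphere (continuous_pairing_inv P)
  have h2 : Integrable (fun ζ : S2 => (pairing P ζ)⁻¹ • (ζ : E3)) μ :=
    integrable_of_continuous_sphere ((continuous_pairing_inv P).smul continuous_subtype_val)
  have h3 : ∫ ζ : S2, moebius (-ballPoint P) ζ ∂μ = ∫ ζ : S2, (pairing P ζ)⁻¹ • (ζ : E3) ∂μ
      - (1 + ∫ ζ : S2, (pairing P ζ)⁻¹ ∂μ) • ballPoint P := by
    simp_rw [moebius_neg_ballPoint]
    have h4 : Integrable (fun ζ : S2 => 1 + (pairing P ζ)⁻¹) μ := (integrable_const 1).add h1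
    rw [integral_sub h2 (h4.smul_const _), integral_smul_const]
    congr 2
    rw [integral_add (integrable_const 1) h1]; simp
  have hne : (1 - ‖ballPoint P‖ ^ 2) / 2 ≠ 0 := by
    have := norm_ballPoint_lt P
    have : 0 < 1 - ‖ballPoint P‖ ^ 2 := by nlinarith [norm_nonneg (ballPoint P)]
    positivity
  have hw : (1 + lift P) • ballPoint P = P := by
    rw [ballPoint, smul_smul, mul_inv_cancel₀ (by positivity), one_smul]
  rw [vectorField, smul_eq_zero, or_iff_right hne, h3, sub_eq_zero, IsMoment]
  have key := lift_mul_sub_inner (μ := μ) P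
  constructor
  · intro hA
    rw [hA, real_inner_smul_right, inner_ballPoint_self] at key
    have hB : ∫ ζ : S2, (pairing P ζ)⁻¹ ∂μ = lift P := by linarith
    exact ⟨by rw [hA, hB, hw], hB⟩
  · rintro ⟨hA, hB⟩
    rw [hA, hB, hw]

theorem IsMoment.integral_pairing_div {μ : Measure S2} [IsProbabilityMeasure μ] {P : E3}
    (hP : IsMoment μ P) (Q : E3) :
    ∫ ζ : S2, pairing Q ζ / pairing P ζ ∂μ = lift P * lift Q - inner ℝ P Q := by
  have h1 : Integrable (fun ζ : S2 => (pairing P ζ)⁻¹) μ :=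
    integrable_of_continuous_sphere (continuous_pairing_inv P)
  have h2 : Integrable (fun ζ : S2 => (pairing P ζ)⁻¹ • (ζ : E3)) μ :=
    integrable_of_continuous_sphere ((continuous_pairing_inv P).smul continuous_subtype_val)
  have : ∀ ζ : S2, pairing Q ζ / pairing P ζ =
      lift Q * (pairing P ζ)⁻¹ - inner ℝ Q ((pairing P ζ)⁻¹ • (ζ : E3)) := by
    intro ζ
    rw [real_inner_smul_right, div_eq_mul_inv, mul_comm (lift Q), ← mul_sub, mul_comm]
    simp only [pairing]
  simp_rw [this]
  rw [integral_sub (h1.const_mul _) (h2.const_inner Q), integral_const_mul, integral_inner h2,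
    hP.1, hP.2, real_inner_comm, mul_comm]

/-- The difference of two points of the hyperboloid, scaled to have Lorentz product `1` with the
null vector `(1, ζ)`, is Lorentz orthogonal to that vector; hence it is space-like or proportional
to `(1, ζ)`. This identity expresses minus its Lorentz square as a square. -/
theorem pairing_div_add_div (P Q : E3) (ζ : S2) :
    pairing Q ζ / pairing P ζ + pairing P ζ / pairing Q ζ =
      2 * (lift P * lift Q - inner ℝ P Q) - pairing P ζ * pairing Q ζ *
        ‖((pairing P ζ)⁻¹ • P - (pairing Q ζ)⁻¹ • Q)
          - (lift P / pairing P ζ - lift Q / pairing Q ζ) • (ζ : E3)‖ ^ 2 := by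
  have hP := (pairing_pos P ζ).ne'
  have hQ := (pairing_pos Q ζ).ne'
  have hz : inner ℝ P (ζ : E3) = lift P - pairing P ζ := by simp [pairing]
  have hz' : inner ℝ Q (ζ : E3) = lift Q - pairing Q ζ := by simp [pairing]
  have e1 : ‖P‖ ^ 2 = lift P ^ 2 - 1 := by rw [lift_sq]; ring
  have e2 : ‖Q‖ ^ 2 = lift Q ^ 2 - 1 := by rw [lift_sq]; ring
  rw [norm_sub_sq_real, norm_sub_sq_real, norm_smul, norm_smul, norm_smul, inner_sub_left,
    real_inner_smul_left, real_inner_smul_left, real_inner_smul_left, real_inner_smul_right,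
    real_inner_smul_right, real_inner_smul_right, mem_sphere_zero_iff_norm.1 ζ.2, hz, hz', mul_pow,
    mul_pow, mul_pow, Real.norm_eq_abs, Real.norm_eq_abs, Real.norm_eq_abs, sq_abs, sq_abs, sq_abs,
    e1, e2]
  field_simp
  ring

theorem IsMoment.unique {μ : Measure S2} [IsProbabilityMeasure μ] [NullSingletonClass μ] {P Q : E3}
    (hP : IsMoment μ P) (hQ : IsMoment μ Q) : P = Q := by
  by_contra hne
  set c := lift P * lift Q - inner ℝ P Q with hc
  set D : S2 → ℝ := fun ζ => pairing P ζ * pairing Q ζ *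
        ‖((pairing P ζ)⁻¹ • P - (pairing Q ζ)⁻¹ • Q)
          - (lift P / pairing P ζ - lift Q / pairing Q ζ) • (ζ : E3)‖ ^ 2 with hD
  have hcP := continuous_pairing P
  have hcQ := continuous_pairing Q
  have hiP := continuous_pairing_inv P
  have hiQ := continuous_pairing_inv Q
  have hDc : Continuous D := by
    simp only [hD, div_eq_mul_inv]
    fun_prop
  have h1 : Integrable (fun ζ : S2 => pairing Q ζ / pairing P ζ) μ :=
    integrable_of_continuous_sphere (by simp only [div_eq_mul_inv]; fun_prop)
  have h2 : Integrable (fun ζ : S2 => pairing P ζ / pairing Q ζ) μ :=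
    integrable_of_continuous_sphere (by simp only [div_eq_mul_inv]; fun_prop)
  have hD0 : ∫ ζ, D ζ ∂μ = 0 := by
    have e : ∫ ζ : S2, (pairing Q ζ / pairing P ζ + pairing P ζ / pairing Q ζ) ∂μ =
        ∫ ζ : S2, (2 * c - D ζ) ∂μ := integral_congr_ae (ae_of_all _ (pairing_div_add_div P Q))
    rw [integral_add h1 h2, hP.integral_pairing_div Q, hQ.integral_pairing_div P,
      integral_sub (integrable_const _) (integrable_of_continuous_sphere hDc),
      real_inner_comm P Q, mul_comm (lift Q)] at e
    simp only [integral_const, probReal_univ, one_smul] at e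
    linarith
  have hDnn : ∀ ζ, 0 ≤ D ζ := fun ζ =>
    mul_nonneg (mul_nonneg (pairing_pos P ζ).le (pairing_pos Q ζ).le) (sq_nonneg _)
  have hae : ∀ᵐ ζ ∂μ, D ζ = 0 :=
    (integral_eq_zero_iff_of_nonneg hDnn (integrable_of_continuous_sphere hDc)).1 hD0
  -- On the zero set of `D` the ratio of the two pairings solves a quadratic equation, and it
  -- determines the point.
  have hfin : {ζ | D ζ = 0}.Finite := by
    have hroots : ({c + √(c ^ 2 - 1), c - √(c ^ 2 - 1)} : Set ℝ).Finite := by simp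
    refine Set.Finite.of_injOn (f := fun ζ : S2 => pairing P ζ / pairing Q ζ) ?_ ?_ hroots
    · intro ζ hζ
      have hp := pairing_pos P ζ
      have hq := pairing_pos Q ζ
      have h := pairing_div_add_div P Q ζ
      change _ = 2 * c - D ζ at h
      rw [show D ζ = 0 from hζ, sub_zero, ← inv_div] at h
      set Y := pairing P ζ / pairing Q ζ
      have hY : Y ≠ 0 := (div_pos hp hq).ne'
      have h3 : (Y - c) ^ 2 = c ^ 2 - 1 := by
        field_simp at h
        linarith
      have h4 : |Y - c| = √(c ^ 2 - 1) := by rw [← h3, Real.sqrt_sq_eq_abs]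
      rcases abs_choice (Y - c) with h5 | h5 <;> rw [h5] at h4
      · left; change Y = _; linarith
      · right; change Y = _; linarith
    · have key : ∀ ζ : S2, D ζ = 0 → P - (pairing P ζ / pairing Q ζ) • Q =
          (lift P - pairing P ζ / pairing Q ζ * lift Q) • (ζ : E3) := by
        intro ζ hζ
        have hp := pairing_pos P ζ
        have hq := pairing_pos Q ζ
        have h : ((pairing P ζ)⁻¹ • P - (pairing Q ζ)⁻¹ • Q)
          - (lift P / pairing P ζ - lift Q / pairing Q ζ) • (ζ : E3) = 0 := by
          have := (mul_eq_zero.1 hζ).resolve_left (mul_pos hp hq).ne'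
          exact norm_eq_zero.1 (pow_eq_zero_iff two_ne_zero |>.1 this)
        have h' := congrArg (fun x => pairing P ζ • x) (sub_eq_zero.1 h)
        simp only [smul_sub, smul_smul] at h'
        rw [mul_inv_cancel₀ hp.ne', one_smul, ← div_eq_mul_inv] at h'
        rw [h']
        congr 1
        field_simp
      intro ζ hζ ζ' hζ' heq
      have k1 := key ζ hζ
      have k2 := key ζ' hζ'
      simp only at heq
      rw [← heq, k1] at k2
      set Y := pairing P ζ / pairing Q ζ
      have hY : 0 < Y := div_pos (pairing_pos P ζ) (pairing_pos Q ζ)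
      rcases eq_or_ne (lift P - Y * lift Q) 0 with h0 | h0
      · exfalso
        rw [h0, zero_smul, sub_eq_zero] at k1
        have e1 := lift_sq P
        have e2 := lift_sq Q
        rw [k1, norm_smul, Real.norm_of_nonneg hY.le, ← k1, sub_eq_zero.1 h0] at e1
        have hY2 : Y ^ 2 = 1 := by linear_combination e1 - Y ^ 2 * e2
        have : Y = 1 := by nlinarith
        rw [this, one_smul] at k1
        exact hne k1
      · exact Subtype.ext (smul_right_injective E3 h0 k2)
  have h0 : μ {ζ | D ζ = 0} = 0 := hfin.measure_zero μ
  have h1 : μ {ζ | D ζ = 0} = 1 := by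
    rw [measure_eq_measure_of_null_sdiff (subset_univ _), measure_univ]
    rw [← compl_eq_univ_sdiff]; exact hae
  rw [h0] at h1
  exact zero_ne_one h1

theorem IsMoment.barycenter_eq {μ : Measure S2} [IsProbabilityMeasure μ] [NullSingletonClass μ]
    {P : E3} (hP : IsMoment μ P) : barycenter μ = ballPoint P := by
  have huniq : ∀ w : E3, ‖w‖ < 1 ∧ vectorField μ w = 0 → w = ballPoint P := by
    rintro w ⟨hw, hV⟩
    rw [← ballPoint_hypPoint hw] at hV ⊢
    rw [((vectorField_ballPoint_eq_zero_iff _).1 hV).unique hP]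
  have hex : ∃! w : E3, ‖w‖ < 1 ∧ vectorField μ w = 0 :=
    ⟨ballPoint P, ⟨norm_ballPoint_lt P, (vectorField_ballPoint_eq_zero_iff P).2 hP⟩, huniq⟩
  rw [barycenter, dif_pos hex]
  exact huniq _ hex.choose_spec.1

/-! ### Cylindrical coordinates on the sphere -/

theorem norm_cyl (v θ : ℝ) :
    ‖(!₂[Real.cos θ / Real.cosh v, Real.sin θ / Real.cosh v, -Real.tanh v] : E3)‖ = 1 := by
  have h := Real.cosh_pos v
  rw [← sq_eq_sq₀ (norm_nonneg _) zero_le_one, EuclideanSpace.norm_sq_eq]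
  simp only [Fin.sum_univ_three, Real.norm_eq_abs, sq_abs]
  simp only [Matrix.cons_val, Real.tanh_eq_sinh_div_cosh]
  field_simp
  linarith [Real.sin_sq_add_cos_sq θ, Real.cosh_sq v]

/-- The conformal parametrization of the sphere minus its poles by a cylinder: the image of
`exp (v + iθ)` under stereographic projection. -/
noncomputable def cyl (p : ℝ × ℝ) : S2 :=
  ⟨!₂[Real.cos p.2 / Real.cosh p.1, Real.sin p.2 / Real.cosh p.1, -Real.tanh p.1],
    mem_sphere_zero_iff_norm.2 (norm_cyl p.1 p.2)⟩

@[simp] theorem cyl_zero (p : ℝ × ℝ) : (cyl p : E3) 0 = Real.cos p.2 / Real.cosh p.1 := rfl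
@[simp] theorem cyl_one (p : ℝ × ℝ) : (cyl p : E3) 1 = Real.sin p.2 / Real.cosh p.1 := rfl
@[simp] theorem cyl_two (p : ℝ × ℝ) : (cyl p : E3) 2 = -Real.tanh p.1 := rfl

theorem continuous_cyl : Continuous cyl := by
  refine Continuous.subtype_mk ?_ _
  refine (PiLp.continuous_toLp 2 _).comp (continuous_pi fun i => ?_)
  have h : ∀ p : ℝ × ℝ, Real.cosh p.1 ≠ 0 := fun p => (Real.cosh_pos p.1).ne'
  have h1 : Continuous fun p : ℝ × ℝ => Real.cosh p.1 := by fun_prop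
  fin_cases i
  · exact (Real.continuous_cos.comp continuous_snd).div h1 h
  · exact (Real.continuous_sin.comp continuous_snd).div h1 h
  · simp only [Real.tanh_eq_sinh_div_cosh]
    exact ((Real.continuous_sinh.comp continuous_fst).div h1 h).neg

/-- Lebesgue measure on the fundamental domain `-π < θ < π` of the cylinder. -/
noncomputable def cylMeasure : Measure (ℝ × ℝ) :=
  (volume : Measure ℝ).prod ((volume : Measure ℝ).restrict (Ioo (-Real.pi) Real.pi))

theorem volume_eq_lintegral_coords {T : Set E3} (hT : MeasurableSet T) :
    volume T = ∫⁻ h : ℝ, ∫⁻ q : ℝ × ℝ, T.indicator 1 (!₂[q.1, q.2, h] : E3) := by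
  have e1 := (PiLp.volume_preserving_toLp (Fin 3))
  have e2 := (volume_preserving_piFinSuccAbove (fun _ : Fin 3 => ℝ) 2).symm
  have e3 := (volume_preserving_finTwoArrow ℝ).symm
  have e4 := e1.comp (e2.comp ((MeasurePreserving.id (volume : Measure ℝ)).prod e3))
  have hm : Measurable (T.indicator 1 : E3 → ENNReal) := measurable_one.indicator hT
  rw [← lintegral_indicator_one hT, ← e4.lintegral_comp hm]
  refine (lintegral_prod _ (hm.comp e4.measurable).aemeasurable).trans ?_
  refine lintegral_congr fun h => lintegral_congr fun q =>
    congrArg (T.indicator (1 : E3 → ENNReal)) (?_ : WithLp.toLp 2 _ = _)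
  ext i
  fin_cases i <;> rfl

open scoped Pointwise in
theorem mem_Ioo_smul_sphere_iff (s : Set S2) {r : ℝ} (hr : 0 < r) (x : S2) :
    r • (x : E3) ∈ Ioo (0 : ℝ) 1 • ((↑) '' s : Set E3) ↔ r < 1 ∧ x ∈ s := by
  constructor
  · rintro ⟨t, ht, _, ⟨y, hy, rfl⟩, h⟩
    have hn := congrArg norm h
    simp only [norm_smul, mem_sphere_zero_iff_norm.1 x.2, mem_sphere_zero_iff_norm.1 y.2, mul_one,
      Real.norm_of_nonneg hr.le, Real.norm_of_nonneg ht.1.le] at hn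
    subst hn
    have : y = x := Subtype.ext (smul_right_injective E3 hr.ne' h)
    exact ⟨ht.2, this ▸ hy⟩
  · rintro ⟨h1, h2⟩
    exact ⟨r, ⟨hr, h1⟩, x, ⟨x, h2, rfl⟩, rfl⟩

theorem lintegral_comp_neg_mul_sinh {ρ : ℝ} (hρ : 0 < ρ) (f : ℝ → ENNReal) :
    ∫⁻ h, f h = ∫⁻ v, ENNReal.ofReal (ρ * Real.cosh v) * f (-(ρ * Real.sinh v)) := by
  have hsurj : (fun v => -(ρ * Real.sinh v)) '' univ = univ := by
    rw [image_univ, range_eq_univ]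
    intro h
    refine ⟨Real.arsinh (-h / ρ), ?_⟩
    simp only [Real.sinh_arsinh]
    field_simp
  have h := lintegral_image_eq_lintegral_abs_deriv_mul (s := univ)
    (f := fun v => -(ρ * Real.sinh v)) (f' := fun v => -(ρ * Real.cosh v)) MeasurableSet.univ
    (fun v _ => ((Real.hasDerivAt_sinh v).const_mul ρ).neg.hasDerivWithinAt)
    (fun a _ b _ hab => by
      have : ρ * Real.sinh a = ρ * Real.sinh b := neg_injective hab
      exact Real.sinh_injective (mul_left_cancel₀ hρ.ne' this)) f
  rw [hsurj] at h
  simp only [Measure.restrict_univ, abs_neg] at h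
  rw [h]
  refine lintegral_congr fun v => ?_
  rw [abs_of_pos (mul_pos hρ (Real.cosh_pos v))]

theorem lintegral_sq_mul_cosh (v : ℝ) :
    ∫⁻ ρ in Ioi (0 : ℝ), (if ρ * Real.cosh v < 1 then
      ENNReal.ofReal (ρ * (ρ * Real.cosh v)) else 0) =
      ENNReal.ofReal (1 / (3 * Real.cosh v ^ 2)) := by
  have hc := Real.cosh_pos v
  have h1 : ∀ ρ : ℝ, (if ρ * Real.cosh v < 1 then
      ENNReal.ofReal (ρ * (ρ * Real.cosh v)) else 0) =
      (Iio (1 / Real.cosh v)).indicator (fun ρ => ENNReal.ofReal (ρ * (ρ * Real.cosh v))) ρ := by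
    intro ρ
    simp only [indicator, mem_Iio, lt_div_iff₀ hc]
  simp_rw [h1]
  rw [lintegral_indicator measurableSet_Iio, Measure.restrict_restrict measurableSet_Iio,
    Iio_inter_Ioi, Measure.restrict_congr_set Ioo_ae_eq_Ioc, ← ofReal_integral_eq_lintegral_ofReal,
    ← intervalIntegral.integral_of_le (by positivity)]
  · congr 1
    have : ∀ ρ : ℝ, ρ * (ρ * Real.cosh v) = ρ ^ 2 * Real.cosh v := fun ρ => by ring
    simp_rw [this]
    rw [intervalIntegral.integral_mul_const, integral_pow, div_pow, one_pow]
    norm_num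
    field_simp
  · exact (by fun_prop : Continuous fun ρ : ℝ => ρ * (ρ * Real.cosh v)).integrableOn_Ioc
  · exact ae_of_all _ fun ρ => by
      change 0 ≤ ρ * (ρ * Real.cosh v)
      rw [← mul_assoc]; exact mul_nonneg (mul_self_nonneg ρ) hc.le

open scoped Pointwise in
theorem measurableSet_Ioo_smul_sphere {s : Set S2} (hs : MeasurableSet s) :
    MeasurableSet (Ioo (0 : ℝ) 1 • ((↑) '' s : Set E3)) := by
  have : Ioo (0 : ℝ) 1 • ((↑) '' s : Set E3) =
      (↑) '' (homeomorphUnitSphereProd E3 ⁻¹' s ×ˢ Iio (⟨1, mem_Ioi.2 one_pos⟩ : Ioi (0 : ℝ))) := by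
    have hI : Ioo (0 : ℝ) 1 = (↑) '' Iio (⟨1, mem_Ioi.2 one_pos⟩ : Ioi (0 : ℝ)) :=
      (image_subtype_val_Ioi_Iio (⟨1, mem_Ioi.2 one_pos⟩ : Ioi (0 : ℝ))).symm
    rw [← image2_smul, image2_image_right, ← Homeomorph.image_symm, image_image, hI,
      image2_image_left, image2_swap, ← image_prod]
    rfl
  rw [this]
  exact (MeasurableEmbedding.subtype_coe (measurableSet_singleton _).compl).measurableSet_image'
    ((homeomorphUnitSphereProd E3).measurable (hs.prod measurableSet_Iio))

open scoped Pointwise in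
/-- Surface measure in cylindrical coordinates: the parametrization is conformal with factor
`1 / cosh v`. The proof computes the volume of the cone over a set, by which the surface measure is
defined, in polar coordinates in the horizontal planes. -/
theorem toSphere_eq_map_cyl : (volume : Measure E3).toSphere =
    (cylMeasure.withDensity fun p => ENNReal.ofReal (1 / Real.cosh p.1 ^ 2)).map cyl := by
  ext s hs
  have hmT := measurableSet_Ioo_smul_sphere hs
  have hpt : ∀ (ρ v θ : ℝ), (!₂[ρ * Real.cos θ, ρ * Real.sin θ, -(ρ * Real.sinh v)] : E3) =
      (ρ * Real.cosh v) • (cyl (v, θ) : E3) := by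
    intro ρ v θ
    have h := (Real.cosh_pos v).ne'
    ext i
    fin_cases i
    · simp; field_simp
    · simp; field_simp
    · simp [Real.tanh_eq_sinh_div_cosh]; field_simp
  set T := Ioo (0 : ℝ) 1 • ((↑) '' s : Set E3) with hT
  set g : ℝ × ℝ → ENNReal := fun p => s.indicator 1 (cyl p) with hg
  have hgm : Measurable g := (measurable_one.indicator hs).comp continuous_cyl.measurable
  have hmI : Measurable (T.indicator 1 : E3 → ENNReal) := measurable_one.indicator hmT
  have hpm : Measurable fun x : ℝ × ℝ × ℝ => (!₂[x.2.1, x.2.2, x.1] : E3) := by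
    refine ((PiLp.continuous_toLp 2 _).comp (continuous_pi fun i => ?_)).measurable
    fin_cases i <;> simp <;> fun_prop
  -- polar coordinates in the horizontal plane
  have s1 : ∀ h : ℝ, ∫⁻ q : ℝ × ℝ, T.indicator 1 (!₂[q.1, q.2, h] : E3) =
      ∫⁻ p in polarCoord.target, ENNReal.ofReal p.1 *
        T.indicator 1 (!₂[p.1 * Real.cos p.2, p.1 * Real.sin p.2, h] : E3) := by
    intro h
    rw [← lintegral_comp_polarCoord_symm]
    rfl
  -- the substitution `h = -ρ sinh v` in the vertical direction
  have s2 : ∀ p ∈ polarCoord.target, ∫⁻ h : ℝ, ENNReal.ofReal p.1 *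
        T.indicator 1 (!₂[p.1 * Real.cos p.2, p.1 * Real.sin p.2, h] : E3) =
      ∫⁻ v : ℝ, (if p.1 * Real.cosh v < 1 then
        ENNReal.ofReal (p.1 * (p.1 * Real.cosh v)) else 0) * g (v, p.2) := by
    rintro p ⟨hp, -⟩
    rw [lintegral_comp_neg_mul_sinh hp]
    refine lintegral_congr fun v => ?_
    have hr : 0 < p.1 * Real.cosh v := mul_pos hp (Real.cosh_pos v)
    have hmem := mem_Ioo_smul_sphere_iff s hr (cyl (v, p.2))
    rw [← hT, ← hpt] at hmem
    rw [← mul_assoc, mul_comm (ENNReal.ofReal _), ← ENNReal.ofReal_mul (le_of_lt hp), hg]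
    simp only [indicator, hmem, Pi.one_apply]
    split_ifs <;> simp_all
  have s3 : ∫⁻ h : ℝ, ∫⁻ q : ℝ × ℝ, T.indicator 1 (!₂[q.1, q.2, h] : E3) =
      ∫⁻ p : ℝ × ℝ, ENNReal.ofReal (1 / (3 * Real.cosh p.1 ^ 2)) * g p ∂cylMeasure := by
    simp_rw [s1]
    have m1 : Measurable fun x : ℝ × ℝ × ℝ => ENNReal.ofReal x.2.1 *
        T.indicator 1 (!₂[x.2.1 * Real.cos x.2.2, x.2.1 * Real.sin x.2.2, x.1] : E3) := by
      refine Measurable.mul (by fun_prop) (hmI.comp (hpm.comp (g := fun x : ℝ × ℝ × ℝ =>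
        (!₂[x.2.1, x.2.2, x.1] : E3)) (f := fun x : ℝ × ℝ × ℝ =>
          (x.1, x.2.1 * Real.cos x.2.2, x.2.1 * Real.sin x.2.2)) (by fun_prop)))
    have m2 : Measurable fun x : (ℝ × ℝ) × ℝ => (if x.1.1 * Real.cosh x.2 < 1 then
        ENNReal.ofReal (x.1.1 * (x.1.1 * Real.cosh x.2)) else 0) * g (x.2, x.1.2) := by
      refine Measurable.mul (Measurable.ite (measurableSet_lt (by fun_prop) (by fun_prop))
        (by fun_prop) measurable_const) (hgm.comp (by fun_prop))
    rw [lintegral_lintegral_swap m1.aemeasurable,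
      setLIntegral_congr_fun polarCoord.open_target.measurableSet s2,
      lintegral_lintegral_swap m2.aemeasurable, cylMeasure,
      lintegral_prod _ (Measurable.aemeasurable (by fun_prop))]
    refine lintegral_congr fun v => ?_
    rw [polarCoord_target, Measure.volume_eq_prod, ← Measure.prod_restrict]
    refine (lintegral_prod_symm _ (m2.comp (f := fun p : ℝ × ℝ => (p, v))
      (by fun_prop)).aemeasurable).trans ?_
    refine lintegral_congr fun θ => ?_
    rw [← lintegral_sq_mul_cosh, ← lintegral_mul_const _ (Measurable.ite (measurableSet_lt
      (by fun_prop) (by fun_prop)) (by fun_prop) measurable_const)]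
    rfl
  rw [Measure.toSphere_apply' _ hs, Measure.map_apply continuous_cyl.measurable hs,
    volume_eq_lintegral_coords hmT, s3, ← lintegral_indicator_one (continuous_cyl.measurable hs),
    lintegral_withDensity_eq_lintegral_mul _ (by fun_prop)
      (measurable_one.indicator (continuous_cyl.measurable hs)),
    ← lintegral_const_mul _ (by fun_prop)]
  refine lintegral_congr fun p => ?_
  have hc := Real.cosh_pos p.1
  rw [← mul_assoc, finrank_euclideanSpace_fin, ← ENNReal.ofReal_natCast,
    ← ENNReal.ofReal_mul (by positivity)]
  simp only [Pi.mul_apply]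
  congr 1
  congr 1
  push_cast
  field_simp

theorem eta0_eq_map_cyl : eta0 = (cylMeasure.withDensity fun p =>
    ENNReal.ofReal (1 / (4 * Real.pi * Real.cosh p.1 ^ 2))).map cyl := by
  have hpi := Real.pi_pos
  have hu : (volume : Measure E3).toSphere univ = ENNReal.ofReal (4 * Real.pi) := by
    rw [Measure.toSphere_apply_univ, EuclideanSpace.volume_ball_fin_three,
      finrank_euclideanSpace_fin, ENNReal.ofReal_one, one_pow, one_mul, ← ENNReal.ofReal_natCast,
      ← ENNReal.ofReal_mul (by positivity)]
    congr 1; push_cast; ring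
  rw [eta0, hu, toSphere_eq_map_cyl, ← Measure.map_smul, ← withDensity_smul _ (by fun_prop),
    ← ENNReal.ofReal_inv_of_pos (by positivity)]
  congr 2
  ext p
  have := Real.cosh_pos p.1
  simp only [Pi.smul_apply, smul_eq_mul]
  rw [← ENNReal.ofReal_mul (by positivity)]
  congr 1
  field_simp

instance : IsProbabilityMeasure eta0 := by
  constructor
  rw [eta0, Measure.smul_apply, smul_eq_mul, ENNReal.inv_mul_cancel]
  · simp [Real.pi_pos]
  · exact measure_ne_top _ _

/-- The restriction of a linear isometry to the unit sphere. -/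
noncomputable def sphereMap (U : E3 ≃ₗᵢ[ℝ] E3) (x : S2) : S2 :=
  ⟨U x, by rw [mem_sphere_zero_iff_norm, U.norm_map, mem_sphere_zero_iff_norm.1 x.2]⟩

theorem continuous_sphereMap (U : E3 ≃ₗᵢ[ℝ] E3) : Continuous (sphereMap U) :=
  (U.continuous.comp continuous_subtype_val).subtype_mk _

open scoped Pointwise in
theorem map_sphereMap_eta0 (U : E3 ≃ₗᵢ[ℝ] E3) : eta0.map (sphereMap U) = eta0 := by
  rw [eta0, Measure.map_smul]
  congr 1
  ext s hs
  have hm := (continuous_sphereMap U).measurable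
  rw [Measure.map_apply hm hs, Measure.toSphere_apply' _ hs, Measure.toSphere_apply' _ (hm hs)]
  congr 1
  have : Ioo (0 : ℝ) 1 • ((↑) '' (sphereMap U ⁻¹' s) : Set E3) =
      U ⁻¹' (Ioo (0 : ℝ) 1 • ((↑) '' s : Set E3)) := by
    ext x
    constructor
    · rintro ⟨t, ht, _, ⟨y, hy, rfl⟩, rfl⟩
      exact ⟨t, ht, _, ⟨_, hy, rfl⟩, (U.map_smul t _).symm⟩
    · rintro ⟨t, ht, _, ⟨y, hy, rfl⟩, h⟩
      refine ⟨t, ht, _, ⟨sphereMap U.symm y, ?_, rfl⟩, ?_⟩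
      · have : sphereMap U (sphereMap U.symm y) = y := Subtype.ext (U.apply_symm_apply _)
        rwa [mem_preimage, this]
      · apply U.injective
        have e : U (t • (sphereMap U.symm y : E3)) = t • U (sphereMap U.symm y : E3) :=
          U.map_smul t _
        simp only
        rw [e, ← h]
        exact congrArg _ (U.apply_symm_apply _)
  rw [this, U.measurePreserving.measure_preimage
    (measurableSet_Ioo_smul_sphere hs).nullMeasurableSet]

theorem withDensity_map {α β : Type*} [MeasurableSpace α] [MeasurableSpace β] {μ : Measure α}
    {f : α → β} (hf : Measurable f) {g : β → ENNReal} (hg : Measurable g) :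
    (μ.map f).withDensity g = (μ.withDensity (g ∘ f)).map f := by
  ext s hs
  rw [withDensity_apply _ hs, Measure.map_apply hf hs, withDensity_apply _ (hf hs),
    setLIntegral_map hs hg hf]
  rfl

/-- The square of the Poisson kernel of the ball. -/
noncomputable def poissonSq (P : E3) (ζ : S2) : ENNReal := ENNReal.ofReal (1 / pairing P ζ ^ 2)

theorem measurable_poissonSq (P : E3) : Measurable (poissonSq P) := by
  have := (continuous_pairing P).measurable
  unfold poissonSq
  fun_prop

theorem continuous_moebiusSphere (w : E3) (hw : ‖w‖ < 1) : Continuous (moebiusSphere w hw) := by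
  refine Continuous.subtype_mk ?_ _
  have hd : ∀ x : S2, 1 + ‖w‖ ^ 2 * ‖(x : E3)‖ ^ 2 + 2 * inner ℝ w (x : E3) ≠ 0 := by
    intro x
    have hx := mem_sphere_zero_iff_norm.1 x.2
    have hin : -(‖w‖ * ‖(x : E3)‖) ≤ inner ℝ w (x : E3) :=
      neg_le_of_abs_le (abs_real_inner_le_norm w x)
    rw [hx, mul_one] at hin
    rw [hx]
    nlinarith [sq_nonneg (1 - ‖w‖)]
  unfold moebius
  exact (Continuous.inv₀ (by fun_prop) hd).smul (by fun_prop)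

theorem lift_sinh_smul_e3 (l : ℝ) : lift (Real.sinh l • e3) = Real.cosh l := by
  have h : ‖e3‖ = 1 := by simp [e3]
  rw [lift, norm_smul, h, mul_one, Real.norm_eq_abs, sq_abs, ← Real.cosh_sq',
    Real.sqrt_sq (Real.cosh_pos l).le]

theorem inner_e3 (x : E3) : inner ℝ e3 x = x 2 := by
  simp [e3, EuclideanSpace.inner_single_left]

theorem pairing_sinh_smul_e3 (l : ℝ) (p : ℝ × ℝ) :
    pairing (Real.sinh l • e3) (cyl p) = Real.cosh (p.1 + l) / Real.cosh p.1 := by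
  have h := (Real.cosh_pos p.1).ne'
  rw [pairing, lift_sinh_smul_e3, real_inner_smul_left, inner_e3, cyl_two,
    Real.tanh_eq_sinh_div_cosh, Real.cosh_add]
  field_simp
  ring

theorem moebiusSphere_e3_cyl (l : ℝ) (p : ℝ × ℝ) :
    moebiusSphere (ballPoint (Real.sinh l • e3)) (norm_ballPoint_lt _) (cyl p) =
      cyl (p.1 - l, p.2) := by
  have h := (Real.cosh_pos p.1).ne'
  have h1 := (Real.cosh_pos (p.1 - l)).ne'
  have hl := Real.cosh_pos l
  have h2 : 1 + Real.cosh l ≠ 0 := by positivity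
  have hneg : ballPoint (Real.sinh l • e3) = -ballPoint (Real.sinh (-l) • e3) := by
    rw [ballPoint, ballPoint, lift_sinh_smul_e3, lift_sinh_smul_e3, Real.cosh_neg, Real.sinh_neg,
      neg_smul, smul_neg, neg_neg]
  apply Subtype.ext
  change moebius _ (cyl p : E3) = _
  rw [hneg, moebius_neg_ballPoint, pairing_sinh_smul_e3, ballPoint, lift_sinh_smul_e3,
    Real.cosh_neg, ← sub_eq_add_neg]
  ext i
  fin_cases i
  · simp [e3]; field_simp
  · simp [e3]; field_simp
  · simp [e3, Real.tanh_eq_sinh_div_cosh]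
    field_simp
    rw [Real.sinh_sub, Real.cosh_sub]
    have := Real.cosh_sq l
    have h3 : Real.sinh l ^ 2 = Real.cosh l ^ 2 - 1 := by linarith
    ring_nf
    rw [h3]
    ring

/-- The Möbius transformations along the third axis are translations of the cylinder, so the density
of the harmonic measure is a translate of that of the surface measure. -/
theorem eta_e3 (l : ℝ) : eta (ballPoint (Real.sinh l • e3)) (norm_ballPoint_lt _) =
    eta0.withDensity (poissonSq (Real.sinh l • e3)) := by
  have hs : MeasurePreserving (fun p : ℝ × ℝ => (p.1 - l, p.2)) cylMeasure cylMeasure :=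
    (measurePreserving_sub_right volume l).prod (MeasurePreserving.id _)
  have hpi := Real.pi_pos
  rw [eta, eta0_eq_map_cyl, Measure.map_map (continuous_moebiusSphere _ _).measurable
    continuous_cyl.measurable, withDensity_map continuous_cyl.measurable (measurable_poissonSq _),
    ← withDensity_mul _ (by fun_prop)
      ((measurable_poissonSq _).comp continuous_cyl.measurable)]
  have e1 : moebiusSphere (ballPoint (Real.sinh l • e3)) (norm_ballPoint_lt _) ∘ cyl =
      cyl ∘ fun p : ℝ × ℝ => (p.1 - l, p.2) := funext fun p => moebiusSphere_e3_cyl l p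
  rw [e1, ← Measure.map_map continuous_cyl.measurable hs.measurable]
  congr 1
  conv_rhs => rw [← hs.map_eq]
  rw [withDensity_map hs.measurable
    (by
      have := ((measurable_poissonSq (Real.sinh l • e3)).comp continuous_cyl.measurable)
      fun_prop)]
  congr 2
  ext p
  simp only [Function.comp, Pi.mul_apply, poissonSq, pairing_sinh_smul_e3]
  have h1 := Real.cosh_pos p.1
  have h2 := Real.cosh_pos (p.1 - l)
  rw [← ENNReal.ofReal_mul (by positivity), sub_add_cancel]
  congr 1
  field_simp

theorem lift_map (U : E3 ≃ₗᵢ[ℝ] E3) (P : E3) : lift (U P) = lift P := by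
  rw [lift, U.norm_map, lift]

/-- The harmonic measures are given by the squared Poisson kernel. By rotation invariance it is
enough to treat centers on the axis of the cylindrical coordinates, where the Möbius transformation
is a translation of the cylinder. -/
theorem eta_ballPoint (P : E3) : eta (ballPoint P) (norm_ballPoint_lt P) =
    eta0.withDensity (poissonSq P) := by
  have he3 : ‖e3‖ = 1 := by simp [e3]
  obtain ⟨l, U, hU⟩ : ∃ (l : ℝ) (U : E3 ≃ₗᵢ[ℝ] E3), U (Real.sinh l • e3) = P := by
    refine ⟨Real.arsinh ‖P‖, _, Submodule.reflection_sub ?_⟩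
    rw [Real.sinh_arsinh, norm_smul, he3, mul_one, norm_norm]
  have hP : ∀ ζ : S2, pairing P (sphereMap U ζ) = pairing (Real.sinh l • e3) ζ := by
    intro ζ
    rw [← hU, pairing, lift_map, sphereMap, U.inner_map_map, pairing]
  have hw : ballPoint P = U (ballPoint (Real.sinh l • e3)) := by
    rw [← hU, ballPoint, lift_map, ballPoint, ← U.map_smul]
  have hcomp : moebiusSphere (ballPoint P) (norm_ballPoint_lt P) ∘ sphereMap U =
      sphereMap U ∘ moebiusSphere (ballPoint (Real.sinh l • e3)) (norm_ballPoint_lt _) := by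
    ext1 ζ
    apply Subtype.ext
    simp only [Function.comp, moebiusSphere, sphereMap, moebius, hw, U.norm_map, U.inner_map_map,
      map_smul, map_add]
  have hmU := (continuous_sphereMap U).measurable
  rw [eta, ← map_sphereMap_eta0 U, Measure.map_map (continuous_moebiusSphere _ _).measurable hmU,
    hcomp, ← Measure.map_map hmU (continuous_moebiusSphere _ _).measurable, ← eta, eta_e3,
    withDensity_map hmU (measurable_poissonSq P)]
  congr 2
  ext1 ζ
  simp only [Function.comp, poissonSq, hP]

/-- The density of the harmonic measures in cylindrical coordinates. -/
theorem eta_eq_map_cyl (P : E3) : eta (ballPoint P) (norm_ballPoint_lt P) =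
    (cylMeasure.withDensity fun p => ENNReal.ofReal
      (1 / (4 * Real.pi * (Real.cosh p.1 * pairing P (cyl p)) ^ 2))).map cyl := by
  have hm := (measurable_poissonSq P).comp continuous_cyl.measurable
  have hpi := Real.pi_pos
  rw [eta_ballPoint, eta0_eq_map_cyl, withDensity_map continuous_cyl.measurable
    (measurable_poissonSq P), ← withDensity_mul _ (by fun_prop) hm]
  congr 2
  ext p
  have h1 := Real.cosh_pos p.1
  have h2 := pairing_pos P (cyl p)
  simp only [Function.comp, Pi.mul_apply, poissonSq]
  rw [← ENNReal.ofReal_mul (by positivity)]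
  congr 1
  field_simp

instance (P : E3) : IsProbabilityMeasure (eta (ballPoint P) (norm_ballPoint_lt P)) :=
  Measure.isProbabilityMeasure_map (continuous_moebiusSphere _ _).measurable.aemeasurable

/-! ### The power map and the homotheties in cylindrical coordinates -/

theorem stereo_exp (v θ : ℝ) :
    stereo (OnePoint.some (Complex.exp (v + θ * Complex.I))) = cyl (v, θ) := by
  apply Subtype.ext
  change stereoFun _ = _
  have hn : ‖Complex.exp (v + θ * Complex.I)‖ = Real.exp v := by
    rw [Complex.norm_exp]; simp
  have hre : (Complex.exp (v + θ * Complex.I)).re = Real.exp v * Real.cos θ := by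
    rw [Complex.exp_re]; simp
  have him : (Complex.exp (v + θ * Complex.I)).im = Real.exp v * Real.sin θ := by
    rw [Complex.exp_im]; simp
  have hc : Real.cosh v = (Real.exp v ^ 2 + 1) / (2 * Real.exp v) := by
    rw [Real.cosh_eq, Real.exp_neg]; field_simp
  have hs : Real.sinh v = (Real.exp v ^ 2 - 1) / (2 * Real.exp v) := by
    rw [Real.sinh_eq, Real.exp_neg]; field_simp
  have he := Real.exp_pos v
  rw [stereoFun, hn, hre, him]
  ext i
  fin_cases i
  · simp [hc]; field_simp; ring
  · simp [hc]; field_simp; ring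
  · simp [hc, hs, Real.tanh_eq_sinh_div_cosh]; field_simp; ring

theorem norm_e3 : ‖e3‖ = 1 := by simp [e3]

/-- The north pole of the sphere. -/
noncomputable def northPole : S2 := ⟨e3, mem_sphere_zero_iff_norm.2 norm_e3⟩

/-- The south pole of the sphere. -/
noncomputable def southPole : S2 := ⟨-e3, mem_sphere_zero_iff_norm.2 norm_neg_e3⟩

theorem stereo_zero : stereo (OnePoint.some 0) = northPole := by
  apply Subtype.ext
  change stereoFun 0 = e3
  ext i
  fin_cases i <;> simp [stereoFun, e3]

theorem stereo_infty : stereo OnePoint.infty = southPole := rfl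

theorem sphere_cases (x : S2) : x = southPole ∨ x = northPole ∨ ∃ p, x = cyl p := by
  obtain ⟨z, rfl⟩ := stereo.surjective x
  induction z using OnePoint.rec with
  | infty => exact Or.inl stereo_infty
  | coe z =>
    right
    rcases eq_or_ne z 0 with rfl | hz
    · exact Or.inl stereo_zero
    · refine Or.inr ⟨((Complex.log z).re, (Complex.log z).im), ?_⟩
      rw [← stereo_exp, Complex.re_add_im, Complex.exp_log hz]

theorem hat_powMap_cyl (d : ℕ) (p : ℝ × ℝ) : hat (powMap d) (cyl p) = cyl (d * p.1, d * p.2) := by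
  rw [hat, ← stereo_exp p.1 p.2, Equiv.symm_apply_apply, ← stereo_exp]
  change stereo (OnePoint.some (_ ^ d)) = _
  rw [← Complex.exp_nat_mul]
  congr 3
  push_cast
  ring

theorem hat_homothety_cyl {t : ℝ} (ht : 0 < t) (p : ℝ × ℝ) :
    hat (homothety t) (cyl p) = cyl (p.1 + Real.log t, p.2) := by
  rw [hat, ← stereo_exp p.1 p.2, Equiv.symm_apply_apply, ← stereo_exp]
  change stereo (OnePoint.some (t * _)) = _
  congr 2
  rw [show (((p.1 + Real.log t : ℝ) : ℂ) + p.2 * Complex.I) =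
    ((Real.log t : ℝ) : ℂ) + (p.1 + p.2 * Complex.I) by push_cast; ring,
    Complex.exp_add (Real.log t : ℂ),
    ← Complex.ofReal_exp, Real.exp_log ht]

theorem hat_powMap_southPole (d : ℕ) : hat (powMap d) southPole = southPole := by
  rw [hat, ← stereo_infty, Equiv.symm_apply_apply]
  rfl

theorem hat_powMap_northPole {d : ℕ} (hd : 1 ≤ d) : hat (powMap d) northPole = northPole := by
  rw [hat, ← stereo_zero, Equiv.symm_apply_apply]
  change stereo (OnePoint.some (0 ^ d)) = _
  rw [zero_pow (by omega)]

/-- The expression of the power map in Euclidean coordinates; it is regular at both poles. -/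
noncomputable def powFun (d : ℕ) (x : E3) : E3 :=
  ((1 + x 2) ^ d + (1 - x 2) ^ d)⁻¹ • !₂[2 * ((⟨x 0, x 1⟩ : ℂ) ^ d).re,
    2 * ((⟨x 0, x 1⟩ : ℂ) ^ d).im, (1 + x 2) ^ d - (1 - x 2) ^ d]

theorem abs_two_le (x : S2) : |(x : E3) 2| ≤ 1 := by
  have h := S2_sum_sq x
  rw [← sq_le_one_iff_abs_le_one]
  nlinarith [sq_nonneg ((x : E3) 0), sq_nonneg ((x : E3) 1)]

theorem powFun_denom_pos (d : ℕ) {s : ℝ} (hs : |s| ≤ 1) : 0 < (1 + s) ^ d + (1 - s) ^ d := by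
  obtain ⟨h1, h2⟩ := abs_le.1 hs
  rcases le_total 0 s with h | h
  · have : 0 < (1 + s) ^ d := by positivity
    have : 0 ≤ (1 - s) ^ d := pow_nonneg (by linarith) d
    linarith
  · have : 0 < (1 - s) ^ d := pow_pos (by linarith) d
    have : 0 ≤ (1 + s) ^ d := pow_nonneg (by linarith) d
    linarith

theorem powFun_cyl (d : ℕ) (p : ℝ × ℝ) : powFun d (cyl p) = (cyl (d * p.1, d * p.2) : E3) := by
  have hc := Real.cosh_pos p.1
  have hcd := Real.cosh_pos (d * p.1)
  have hp : 1 + (cyl p : E3) 2 = Real.exp (-p.1) / Real.cosh p.1 := by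
    rw [cyl_two, Real.tanh_eq_sinh_div_cosh, ← Real.cosh_sub_sinh]; field_simp; ring
  have hm : 1 - (cyl p : E3) 2 = Real.exp p.1 / Real.cosh p.1 := by
    rw [cyl_two, Real.tanh_eq_sinh_div_cosh, ← Real.cosh_add_sinh]; field_simp; ring
  have hz : (⟨(cyl p : E3) 0, (cyl p : E3) 1⟩ : ℂ) ^ d =
      ((Real.cosh p.1 ^ d)⁻¹ : ℝ) * Complex.exp ((d * p.2 : ℝ) * Complex.I) := by
    have : (⟨(cyl p : E3) 0, (cyl p : E3) 1⟩ : ℂ) =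
        ((Real.cosh p.1)⁻¹ : ℝ) * Complex.exp (p.2 * Complex.I) := by
      apply Complex.ext
      · rw [Complex.re_ofReal_mul, Complex.exp_ofReal_mul_I_re]; simp; field_simp
      · rw [Complex.im_ofReal_mul, Complex.exp_ofReal_mul_I_im]; simp; field_simp
    rw [this, mul_pow, ← Complex.exp_nat_mul]
    push_cast
    congr 2
    · exact inv_pow _ _
    · ring
  have h1 : (1 + (cyl p : E3) 2) ^ d = Real.exp (-(d * p.1)) / Real.cosh p.1 ^ d := by
    rw [hp, div_pow, ← Real.exp_nat_mul]; congr 2; ring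
  have h2 : (1 - (cyl p : E3) 2) ^ d = Real.exp (d * p.1) / Real.cosh p.1 ^ d := by
    rw [hm, div_pow, ← Real.exp_nat_mul]
  have hD : (1 + (cyl p : E3) 2) ^ d + (1 - (cyl p : E3) 2) ^ d =
      2 * Real.cosh (d * p.1) / Real.cosh p.1 ^ d := by
    rw [h1, h2, Real.cosh_eq (d * p.1)]; ring
  have hD' : (1 + (cyl p : E3) 2) ^ d - (1 - (cyl p : E3) 2) ^ d =
      -(2 * Real.sinh (d * p.1)) / Real.cosh p.1 ^ d := by
    rw [h1, h2, Real.sinh_eq (d * p.1)]; ring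
  rw [powFun, hD, hD', hz]
  ext i
  fin_cases i
  · simp [Complex.exp_ofReal_mul_I_re, -Complex.ofReal_mul, -Complex.ofReal_inv,
      -Complex.ofReal_pow]
    field_simp
  · simp [Complex.exp_ofReal_mul_I_im, -Complex.ofReal_mul, -Complex.ofReal_inv,
      -Complex.ofReal_pow]
    field_simp
  · simp [Real.tanh_eq_sinh_div_cosh]
    field_simp

theorem hat_powMap_eq_powFun {d : ℕ} (hd : 1 ≤ d) (x : S2) :
    (hat (powMap d) x : E3) = powFun d x := by
  have h0 : (0 : ℂ) ^ d = 0 := zero_pow (by omega)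
  have h1 : (0 : ℝ) ^ d = 0 := zero_pow (by omega)
  have h2 : (⟨0, 0⟩ : ℂ) = 0 := rfl
  rcases sphere_cases x with rfl | rfl | ⟨p, rfl⟩
  · rw [hat_powMap_southPole, powFun]
    ext i
    fin_cases i <;> simp [southPole, e3, h0, h1, h2]
  · rw [hat_powMap_northPole hd, powFun]
    ext i
    fin_cases i <;> simp [northPole, e3, h0, h1, h2]
  · rw [hat_powMap_cyl, powFun_cyl]

theorem continuous_hat_powMap {d : ℕ} (hd : 1 ≤ d) : Continuous (hat (powMap d)) := by
  rw [continuous_induced_rng]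
  have : (Subtype.val ∘ hat (powMap d)) = fun x : S2 => powFun d x :=
    funext fun x => hat_powMap_eq_powFun hd x
  rw [this]
  unfold powFun
  have hz : Continuous fun x : S2 => (⟨(x : E3) 0, (x : E3) 1⟩ : ℂ) ^ d := by
    refine Continuous.pow ?_ d
    have : (fun x : S2 => (⟨(x : E3) 0, (x : E3) 1⟩ : ℂ)) =
        fun x : S2 => ((x : E3) 0 : ℂ) + ((x : E3) 1 : ℂ) * Complex.I := by
      ext1 x; apply Complex.ext <;> simp
    rw [this]; fun_prop
  refine Continuous.smul (Continuous.inv₀ (by fun_prop) fun x =>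
    (powFun_denom_pos d (abs_two_le x)).ne') ?_
  refine (PiLp.continuous_toLp 2 _).comp (continuous_pi fun i => ?_)
  fin_cases i
  · exact continuous_const.mul (Complex.continuous_re.comp hz)
  · exact continuous_const.mul (Complex.continuous_im.comp hz)
  · simp; fun_prop

/-! ### The image measures -/

/-- The push-forward by the power map of the harmonic measure with center `ballPoint P`. -/
noncomputable def pushEta (d : ℕ) (P : E3) : Measure S2 :=
  (eta (ballPoint P) (norm_ballPoint_lt P)).map (hat (powMap d))

theorem isProbabilityMeasure_pushEta {d : ℕ} (hd : 1 ≤ d) (P : E3) :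
    IsProbabilityMeasure (pushEta d P) :=
  Measure.isProbabilityMeasure_map (continuous_hat_powMap hd).measurable.aemeasurable

theorem cylMeasure_fst_eq (c : ℝ) : cylMeasure {p | p.1 = c} = 0 := by
  have : {p : ℝ × ℝ | p.1 = c} = {c} ×ˢ univ := by ext p; simp
  rw [this, cylMeasure, Measure.prod_prod]; simp

theorem eta_two_eq (P : E3) (c : ℝ) :
    eta (ballPoint P) (norm_ballPoint_lt P) {x | (x : E3) 2 = c} = 0 := by
  have hm : MeasurableSet {x : S2 | (x : E3) 2 = c} :=
    (isClosed_eq (by fun_prop) continuous_const).measurableSet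
  rw [eta_eq_map_cyl, Measure.map_apply continuous_cyl.measurable hm]
  refine withDensity_absolutelyContinuous _ _ (measure_mono_null ?_ (cylMeasure_fst_eq
    (-Real.artanh c)))
  intro p hp
  have hp' : -Real.tanh p.1 = c := hp
  change p.1 = _
  rw [← hp', ← Real.tanh_neg, Real.artanh_tanh, neg_neg]

theorem pushEta_two_eq {d : ℕ} (hd : 1 ≤ d) (P : E3) (c : ℝ) :
    pushEta d P {x | (x : E3) 2 = c} = 0 := by
  have hm : MeasurableSet {x : S2 | (x : E3) 2 = c} :=
    (isClosed_eq (by fun_prop) continuous_const).measurableSet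
  have hd' : (d : ℝ) ≠ 0 := by positivity
  rw [pushEta, eta_eq_map_cyl, Measure.map_map (continuous_hat_powMap hd).measurable
    continuous_cyl.measurable, Measure.map_apply ((continuous_hat_powMap hd).measurable.comp
    continuous_cyl.measurable) hm]
  refine withDensity_absolutelyContinuous _ _ (measure_mono_null ?_ (cylMeasure_fst_eq
    (-Real.artanh c / d)))
  intro p hp
  have hp' : (hat (powMap d) (cyl p) : E3) 2 = c := hp
  rw [hat_powMap_cyl, cyl_two] at hp'
  change p.1 = _
  rw [← hp', ← Real.tanh_neg, Real.artanh_tanh]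
  field_simp

theorem nullSingletonClass_pushEta {d : ℕ} (hd : 1 ≤ d) (P : E3) :
    NullSingletonClass (pushEta d P) :=
  ⟨fun _ => measure_mono_null (fun _ hy => congrArg (fun z : S2 => (z : E3) 2) hy)
    (pushEta_two_eq hd P _)⟩

/-! ### A circular mean against the square of the Poisson kernel -/

/-- Cauchy's formula for the derivative at `a` of `z ↦ F z * z / (1 - a z) ^ 2`. -/
theorem integral_circle_mul_inv_sq {F : ℂ → ℂ} {U : Set ℂ} (hU : IsOpen U)
    (hsub : closedBall 0 1 ⊆ U) (hF : DifferentiableOn ℂ F U) {a : ℝ} (ha0 : 0 ≤ a) (ha1 : a < 1) :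
    ∫ θ in -Real.pi..Real.pi, F (Complex.exp (θ * Complex.I)) *
        (((1 - 2 * a * Real.cos θ + a ^ 2) ^ 2)⁻¹ : ℝ) =
      2 * Real.pi * ((F a * (1 + a ^ 2) + a * deriv F a * (1 - a ^ 2)) / (1 - a ^ 2) ^ 3) := by
  set V : Set ℂ := U ∩ {z | 1 - a * z ≠ 0} with hV
  have hVo : IsOpen V := hU.inter (isOpen_ne_fun (by fun_prop) continuous_const)
  have hnorm : ∀ z ∈ closedBall (0 : ℂ) 1, 1 - a * z ≠ 0 := by
    intro z hz h
    have h1 : (a : ℂ) * z = 1 := (sub_eq_zero.1 h).symm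
    have h2 := congrArg norm h1
    rw [norm_mul, Complex.norm_real, Real.norm_of_nonneg ha0, norm_one] at h2
    have h3 : ‖z‖ ≤ 1 := by simpa using hz
    nlinarith [norm_nonneg z]
  have hVsub : closedBall 0 1 ⊆ V := fun z hz => ⟨hsub hz, hnorm z hz⟩
  set f : ℂ → ℂ := fun z => F z * (z / (1 - a * z) ^ 2) with hf
  have hfd : DifferentiableOn ℂ f V := by
    refine (hF.mono inter_subset_left).mul ?_
    refine DifferentiableOn.div (by fun_prop) (by fun_prop) fun z hz => pow_ne_zero _ hz.2
  have haball : (a : ℂ) ∈ ball (0 : ℂ) 1 := by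
    rw [mem_ball_zero_iff, Complex.norm_real, Real.norm_of_nonneg ha0]; exact ha1
  have key := Complex.two_pi_I_inv_smul_circleIntegral_sub_sq_inv_smul_of_differentiable hVo
    hVsub hfd haball
  have hne : (1 : ℂ) - a ^ 2 ≠ 0 := by
    have := hnorm a (ball_subset_closedBall haball)
    rwa [← sq] at this
  have hderiv : deriv f a =
      (F a * (1 + a ^ 2) + a * deriv F a * (1 - a ^ 2)) / (1 - a ^ 2) ^ 3 := by
    have hFa : HasDerivAt F (deriv F a) a :=
      (hF.differentiableAt (hU.mem_nhds (hsub (ball_subset_closedBall haball)))).hasDerivAt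
    have h1 : HasDerivAt (fun z : ℂ => 1 - a * z) (-a) a := by
      simpa using ((hasDerivAt_id (a : ℂ)).const_mul (a : ℂ)).const_sub 1
    have h2 := hFa.mul ((hasDerivAt_id (a : ℂ)).div (h1.pow 2)
      (pow_ne_zero 2 (hnorm a (ball_subset_closedBall haball))))
    have h3 : deriv f a = _ := h2.deriv
    rw [h3]
    have hne' : (1 : ℂ) - a * a ≠ 0 := by rwa [← sq]
    simp only [id, Pi.pow_apply, Pi.div_apply]
    rw [← sq] at *
    field_simp
    ring
  rw [hderiv, circleIntegral] at key
  rw [inv_smul_eq_iff₀ Complex.two_pi_I_ne_zero] at key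
  have hint : ∀ θ : ℝ, deriv (circleMap 0 1) θ • ((circleMap 0 1 θ - a) ^ 2)⁻¹ •
      f (circleMap 0 1 θ) = Complex.I * (F (Complex.exp (θ * Complex.I)) *
        (((1 - 2 * a * Real.cos θ + a ^ 2) ^ 2)⁻¹ : ℝ)) := by
    intro θ
    have hz : circleMap 0 1 θ = Complex.exp (θ * Complex.I) := by simp [circleMap]
    rw [deriv_circleMap, hz, hf]
    set z := Complex.exp (θ * Complex.I) with hzdef
    have hz0 : z ≠ 0 := Complex.exp_ne_zero _
    have hzb : z ∈ closedBall (0 : ℂ) 1 := by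
      rw [mem_closedBall_zero_iff, hzdef, Complex.norm_exp_ofReal_mul_I]
    have e1 : (1 : ℂ) - a * z ≠ 0 := hnorm z hzb
    have hcos : 2 * (Real.cos θ : ℂ) = z + z⁻¹ := by
      rw [hzdef, ← Complex.exp_neg, Complex.ofReal_cos, Complex.cos]
      rw [neg_mul]; ring
    have e2 : z - a ≠ 0 := by
      intro h
      have h2 := congrArg norm (sub_eq_zero.1 h)
      rw [hzdef, Complex.norm_exp_ofReal_mul_I, Complex.norm_real, Real.norm_of_nonneg ha0] at h2
      linarith
    have e3 : ((1 - 2 * a * Real.cos θ + a ^ 2 : ℝ) : ℂ) = (1 - a * z) * (z - a) / z := by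
      push_cast
      have : (2 : ℂ) * a * Complex.cos θ = a * (z + z⁻¹) := by
        rw [← hcos]; push_cast; ring
      rw [this]
      field_simp
      ring
    rw [Complex.ofReal_inv, Complex.ofReal_pow, e3]
    simp only [smul_eq_mul]
    field_simp
  simp_rw [hint] at key
  rw [intervalIntegral.integral_const_mul] at key
  have hper : Function.Periodic (fun θ : ℝ => F (Complex.exp (θ * Complex.I)) *
        (((1 - 2 * a * Real.cos θ + a ^ 2) ^ 2)⁻¹ : ℝ)) (2 * Real.pi) := by
    intro θ
    have : Complex.exp (((θ + 2 * Real.pi : ℝ) : ℂ) * Complex.I) = Complex.exp (θ * Complex.I) := by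
      push_cast
      rw [add_mul, Complex.exp_add, Complex.exp_two_pi_mul_I, mul_one]
    simp only [this, Real.cos_add_two_pi]
  have h4 := hper.intervalIntegral_add_eq (-Real.pi) 0
  rw [zero_add, show -Real.pi + 2 * Real.pi = Real.pi by ring] at h4
  rw [h4]
  apply mul_left_cancel₀ Complex.I_ne_zero
  rw [key, smul_eq_mul]
  ring

/-- The circular mean of `Re (z ^ d / (1 - b z ^ d))` against the probability density proportional
to the square of the Poisson kernel at `a`. -/
noncomputable def sqPoissonMean (d : ℕ) (b a : ℝ) : ℝ :=
  a ^ d / (1 - b * a ^ d) + (1 - a ^ 2) / (1 + a ^ 2) * (d * a ^ d / (1 - b * a ^ d) ^ 2)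

/-- The function `(cos φ - b) / |1 - b exp (iφ)| ^ 2` is the real part of `z / (1 - b z)` at
`z = exp (iφ)`, so that the integral is an instance of Cauchy's formula. -/
theorem integral_circle_real {d : ℕ} (hd : 1 ≤ d) {a b : ℝ} (ha0 : 0 ≤ a) (ha1 : a < 1)
    (hb0 : 0 ≤ b) (hb1 : b < 1) (A B : ℝ) :
    ∫ θ in -Real.pi..Real.pi,
      (A + B * ((Real.cos (d * θ) - b) / (1 - 2 * b * Real.cos (d * θ) + b ^ 2))) *
        ((1 - 2 * a * Real.cos θ + a ^ 2) ^ 2)⁻¹ =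
      2 * Real.pi * ((1 + a ^ 2) / (1 - a ^ 2) ^ 3 * (A + B * sqPoissonMean d b a)) := by
  set F : ℂ → ℂ := fun z => A + B * (z ^ d / (1 - b * z ^ d)) with hFdef
  set U : Set ℂ := {z | 1 - b * z ^ d ≠ 0} with hU
  have hUo : IsOpen U := isOpen_ne_fun (by fun_prop) continuous_const
  have hsub : closedBall 0 1 ⊆ U := by
    intro z hz h
    have h1 : (b : ℂ) * z ^ d = 1 := (sub_eq_zero.1 h).symm
    have h2 := congrArg norm h1
    rw [norm_mul, Complex.norm_real, Real.norm_of_nonneg hb0, norm_one, norm_pow] at h2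
    have h3 : ‖z‖ ≤ 1 := by simpa using hz
    have h4 : ‖z‖ ^ d ≤ 1 := pow_le_one₀ (norm_nonneg z) h3
    nlinarith [pow_nonneg (norm_nonneg z) d]
  have hF : DifferentiableOn ℂ F U :=
    ((DifferentiableOn.div (by fun_prop) (by fun_prop) fun z hz => hz).const_mul _).const_add _
  have key := integral_circle_mul_inv_sq hUo hsub hF ha0 ha1
  have hCd : a ^ d ≤ 1 := pow_le_one₀ ha0 ha1.le
  have hC0 : 0 ≤ a ^ d := pow_nonneg ha0 d
  have hbC : 1 - b * a ^ d ≠ 0 := by nlinarith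
  have hbC' : (1 : ℂ) - b * (a : ℂ) ^ d ≠ 0 := by exact_mod_cast hbC
  have hder : (a : ℂ) * deriv F a = ((B * (d * a ^ d / (1 - b * a ^ d) ^ 2) : ℝ) : ℂ) := by
    have h1 : HasDerivAt (fun z : ℂ => z ^ d) (d * (a : ℂ) ^ (d - 1)) a := hasDerivAt_pow d _
    have h2 : HasDerivAt F _ (a : ℂ) :=
      ((h1.div ((h1.const_mul (b : ℂ)).const_sub 1) hbC').const_mul (B : ℂ)).const_add (A : ℂ)
    rw [h2.deriv]
    obtain ⟨k, rfl⟩ : ∃ k, d = k + 1 := ⟨d - 1, by omega⟩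
    push_cast
    field_simp
    ring
  have hFa : F a = ((A + B * (a ^ d / (1 - b * a ^ d)) : ℝ) : ℂ) := by
    rw [hFdef]; push_cast; rfl
  rw [hder, hFa] at key
  have hone : (1 : ℝ) - a ^ 2 ≠ 0 := by nlinarith
  have hre : ∀ θ : ℝ, (F (Complex.exp (θ * Complex.I)) *
        (((1 - 2 * a * Real.cos θ + a ^ 2) ^ 2)⁻¹ : ℝ)).re =
      (A + B * ((Real.cos (d * θ) - b) / (1 - 2 * b * Real.cos (d * θ) + b ^ 2))) *
        ((1 - 2 * a * Real.cos θ + a ^ 2) ^ 2)⁻¹ := by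
    intro θ
    rw [Complex.re_mul_ofReal, hFdef]
    congr 1
    simp only
    rw [← Complex.exp_nat_mul, show (d : ℂ) * (θ * Complex.I) = (d * θ : ℝ) * Complex.I by
      push_cast; ring, Complex.add_re, Complex.ofReal_re, Complex.re_ofReal_mul]
    congr 2
    set φ : ℝ := d * θ
    rw [Complex.div_re]
    have h1 : Complex.normSq (1 - b * Complex.exp (φ * Complex.I)) =
        1 - 2 * b * Real.cos φ + b ^ 2 := by
      rw [Complex.normSq_apply]
      simp only [Complex.sub_re, Complex.one_re, Complex.re_ofReal_mul, Complex.sub_im,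
        Complex.one_im, Complex.im_ofReal_mul, Complex.exp_ofReal_mul_I_re,
        Complex.exp_ofReal_mul_I_im]
      linear_combination b ^ 2 * Real.sin_sq_add_cos_sq φ
    rw [h1]
    simp only [Complex.sub_re, Complex.one_re, Complex.re_ofReal_mul, Complex.sub_im,
        Complex.one_im, Complex.im_ofReal_mul, Complex.exp_ofReal_mul_I_re,
        Complex.exp_ofReal_mul_I_im]
    rw [← add_div]
    congr 1
    linear_combination (-b) * Real.sin_sq_add_cos_sq φ
  have hcont : Continuous fun θ : ℝ => F (Complex.exp (θ * Complex.I)) *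
        (((1 - 2 * a * Real.cos θ + a ^ 2) ^ 2)⁻¹ : ℝ) := by
    have hexp : Continuous fun θ : ℝ => Complex.exp (θ * Complex.I) := by fun_prop
    refine Continuous.mul (hF.continuousOn.comp_continuous hexp fun θ => hsub ?_) ?_
    · rw [mem_closedBall_zero_iff, Complex.norm_exp_ofReal_mul_I]
    · refine Complex.continuous_ofReal.comp (Continuous.inv₀ (by fun_prop) fun θ => ?_)
      have : 0 < 1 - 2 * a * Real.cos θ + a ^ 2 := by
        nlinarith [Real.cos_le_one θ, sq_nonneg (1 - a), Real.neg_one_le_cos θ]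
      positivity
  have hreint := Complex.reCLM.intervalIntegral_comp_comm (μ := volume)
    (hcont.intervalIntegrable (-Real.pi) Real.pi)
  simp only [Complex.reCLM_apply, hre] at hreint
  rw [hreint, key]
  rw [show (2 * (Real.pi : ℂ) *
      ((((A + B * (a ^ d / (1 - b * a ^ d)) : ℝ) : ℂ) * (1 + (a : ℂ) ^ 2) +
        ((B * (d * a ^ d / (1 - b * a ^ d) ^ 2) : ℝ) : ℂ) * (1 - (a : ℂ) ^ 2)) /
          (1 - (a : ℂ) ^ 2) ^ 3)) =
    ((2 * Real.pi * (((A + B * (a ^ d / (1 - b * a ^ d))) * (1 + a ^ 2) +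
      (B * (d * a ^ d / (1 - b * a ^ d) ^ 2)) * (1 - a ^ 2)) / (1 - a ^ 2) ^ 3) : ℝ) : ℂ) by
        push_cast; rfl, Complex.ofReal_re, sqPoissonMean]
  have h2 : (1 : ℝ) + a ^ 2 ≠ 0 := by positivity
  clear hreint hre key hcont hder hFa hbC'
  generalize a ^ d = C at *
  have hbC2 : 1 - C * b ≠ 0 := by rwa [mul_comm]
  field_simp
  ring

theorem sqPoissonMean_nonneg {d : ℕ} {a b : ℝ} (ha0 : 0 ≤ a) (ha1 : a ≤ 1) (hb0 : 0 ≤ b)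
    (hb1 : b < 1) : 0 ≤ sqPoissonMean d b a := by
  have hC0 : 0 ≤ a ^ d := pow_nonneg ha0 d
  have hC1 : a ^ d ≤ 1 := pow_le_one₀ ha0 ha1
  have h1 : 0 < 1 - b * a ^ d := by nlinarith
  have h2 : 0 ≤ 1 - a ^ 2 := by nlinarith
  unfold sqPoissonMean
  positivity

theorem sqPoissonMean_mono_left {d : ℕ} {a b b' : ℝ} (ha0 : 0 ≤ a) (ha1 : a ≤ 1) (hb0 : 0 ≤ b)
    (hbb : b ≤ b') (hb1 : b' < 1) : sqPoissonMean d b a ≤ sqPoissonMean d b' a := by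
  have hC0 : 0 ≤ a ^ d := pow_nonneg ha0 d
  have hC1 : a ^ d ≤ 1 := pow_le_one₀ ha0 ha1
  have h1 : 0 < 1 - b' * a ^ d := by nlinarith
  have h2 : 0 ≤ 1 - a ^ 2 := by nlinarith
  have h3 : 0 ≤ (1 - a ^ 2) / (1 + a ^ 2) := by positivity
  unfold sqPoissonMean
  gcongr

theorem sqPoissonMean_strictMonoOn {d : ℕ} (hd : 1 ≤ d) {b : ℝ} (hb0 : 0 ≤ b) (hb1 : b < 1) :
    StrictMonoOn (sqPoissonMean d b) (Icc 0 1) := by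
  have hden : ∀ a ∈ Icc (0 : ℝ) 1, 0 < 1 - b * a ^ d := by
    intro a ha
    have hC0 : 0 ≤ a ^ d := pow_nonneg ha.1 d
    have hC1 : a ^ d ≤ 1 := pow_le_one₀ ha.1 ha.2
    nlinarith
  refine strictMonoOn_of_deriv_pos (convex_Icc 0 1) ?_ ?_
  · unfold sqPoissonMean
    refine ContinuousOn.add ?_ (ContinuousOn.mul ?_ ?_)
    · exact ContinuousOn.div (by fun_prop) (by fun_prop) fun a ha => (hden a ha).ne'
    · exact ContinuousOn.div (by fun_prop) (by fun_prop) fun a _ => by positivity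
    · exact ContinuousOn.div (by fun_prop) (by fun_prop) fun a ha =>
        pow_ne_zero 2 (hden a ha).ne'
  · intro a ha
    rw [interior_Icc] at ha
    have hD := hden a (Ioo_subset_Icc_self ha)
    have ha0 := ha.1
    have h1 : HasDerivAt (fun x : ℝ => x ^ d) (d * a ^ d / a) a := by
      have e : d * a ^ d / a = d * a ^ (d - 1) := by
        obtain ⟨k, rfl⟩ : ∃ k, d = k + 1 := ⟨d - 1, by omega⟩
        rw [pow_succ, Nat.add_sub_cancel]
        field_simp
      rw [e]
      exact hasDerivAt_pow d a
    have h2 : HasDerivAt (fun x : ℝ => 1 - b * x ^ d) (-(b * (d * a ^ d / a))) a :=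
      (h1.const_mul b).const_sub 1
    have h3 := h1.div h2 hD.ne'
    have h4 := (h1.const_mul (d : ℝ)).div (h2.pow 2) (pow_ne_zero 2 hD.ne')
    have h5 : HasDerivAt (fun x : ℝ => x ^ 2) (2 * a) a := by simpa using hasDerivAt_pow 2 a
    have h6 := (h5.const_sub 1).div (h5.const_add 1) (by positivity)
    have h7 : HasDerivAt (sqPoissonMean d b) _ a := h3.add (h6.mul h4)
    rw [h7.deriv]
    -- With `F a = a ^ d / (1 - b a ^ d)` and `κ = (1 - a²) / (1 + a²)` the function is
    -- `F + κ a F'`, with derivative `κ² F' + κ (a F')'`.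
    have hpos : 0 < ((1 - a ^ 2) / (1 + a ^ 2)) ^ 2 * (d * a ^ d / (a * (1 - b * a ^ d) ^ 2)) +
        (1 - a ^ 2) / (1 + a ^ 2) *
          (d ^ 2 * a ^ d * (1 + b * a ^ d) / (a * (1 - b * a ^ d) ^ 3)) := by
      have : 0 < 1 - a ^ 2 := by nlinarith [ha.2]
      positivity
    convert hpos using 1
    simp only [Pi.pow_apply, Pi.div_apply]
    clear h1 h2 h3 h4 h5 h6 h7 hpos hden
    generalize a ^ d = C at *
    have hD2 : 1 - C * b ≠ 0 := by rw [mul_comm]; exact hD.ne'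
    field_simp
    ring

/-! ### The mean over the circles of latitude -/

/-- The first coordinate of a hyperbolic translation of the sphere along the first axis, as a
function of the first coordinate. -/
noncomputable def profile (τ u : ℝ) : ℝ := (u - τ) / (1 - τ * u)

/-- The radius `b` for which `y - τ cos φ` is proportional to `|1 - b exp (iφ)| ^ 2`. -/
noncomputable def profileRadius (τ y : ℝ) : ℝ := τ / (y + √(y ^ 2 - τ ^ 2))

/-- The constant term in the partial fraction expansion of `profile τ (cos φ / y)`. -/
noncomputable def profileConst (τ y : ℝ) : ℝ :=
  τ * (1 / (y + √(y ^ 2 - τ ^ 2)) - y) / √(y ^ 2 - τ ^ 2)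

/-- The coefficient of the pole in the partial fraction expansion of `profile τ (cos φ / y)`. -/
noncomputable def profileCoeff (τ y : ℝ) : ℝ :=
  2 * y * (1 - τ ^ 2) / ((y + √(y ^ 2 - τ ^ 2)) * √(y ^ 2 - τ ^ 2))

section Profile

variable {τ y : ℝ}

theorem sqrt_sq_sub_sq_pos (hτ0 : 0 ≤ τ) (hτ1 : τ < 1) (hy : 1 ≤ y) : 0 < √(y ^ 2 - τ ^ 2) :=
  Real.sqrt_pos.2 (by nlinarith)

theorem profileRadius_nonneg (hτ0 : 0 ≤ τ) (hy : 1 ≤ y) : 0 ≤ profileRadius τ y := by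
  unfold profileRadius
  have := Real.sqrt_nonneg (y ^ 2 - τ ^ 2)
  positivity

theorem profileRadius_lt_one (hτ0 : 0 ≤ τ) (hτ1 : τ < 1) (hy : 1 ≤ y) : profileRadius τ y < 1 := by
  have := sqrt_sq_sub_sq_pos hτ0 hτ1 hy
  rw [profileRadius, div_lt_one (by positivity)]
  linarith

theorem profileCoeff_pos (hτ0 : 0 ≤ τ) (hτ1 : τ < 1) (hy : 1 ≤ y) : 0 < profileCoeff τ y := by
  have := sqrt_sq_sub_sq_pos hτ0 hτ1 hy
  have h2 : 0 < 1 - τ ^ 2 := by nlinarith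
  unfold profileCoeff
  positivity

/-- As a function of `c`, the profile has a single pole; this isolates it in a form adapted to the
circular mean. -/
theorem profile_expansion (hτ0 : 0 ≤ τ) (hτ1 : τ < 1) (hy : 1 ≤ y) {c : ℝ} (hc : |c| ≤ 1) :
    profile τ (c / y) = profileConst τ y + profileCoeff τ y *
      ((c - profileRadius τ y) / (1 - 2 * profileRadius τ y * c + profileRadius τ y ^ 2)) := by
  have he := sqrt_sq_sub_sq_pos hτ0 hτ1 hy
  have he2 : √(y ^ 2 - τ ^ 2) ^ 2 = y ^ 2 - τ ^ 2 := Real.sq_sqrt (by nlinarith)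
  unfold profileConst profileCoeff profileRadius profile
  set e := √(y ^ 2 - τ ^ 2)
  have hy0 : 0 < y := by linarith
  have hye : 0 < y + e := by positivity
  have hc1 := (abs_le.1 hc).2
  have hd : 0 < y - τ * c := by nlinarith [(abs_le.1 hc).1]
  have h1 : 1 - 2 * (τ / (y + e)) * c + (τ / (y + e)) ^ 2 = 2 * (y - τ * c) / (y + e) := by
    field_simp
    linear_combination he2
  have h2 : (c / y - τ) / (1 - τ * (c / y)) = (c - τ * y) / (y - τ * c) := by
    have : 1 - τ * (c / y) ≠ 0 := by
      have : 1 - τ * (c / y) = (y - τ * c) / y := by field_simp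
      rw [this]; positivity
    field_simp
  rw [h1, h2]
  have hd2 : 0 < y - c * τ := by rwa [mul_comm c]
  field_simp
  linear_combination (c - τ * y) * he2

theorem div_sqrt_antitone (hτ0 : 0 ≤ τ) (hτ1 : τ < 1) {y' : ℝ} (hy : 1 ≤ y) (hyy : y ≤ y') :
    y' / √(y' ^ 2 - τ ^ 2) ≤ y / √(y ^ 2 - τ ^ 2) := by
  have he := sqrt_sq_sub_sq_pos hτ0 hτ1 hy
  have he' := sqrt_sq_sub_sq_pos hτ0 hτ1 (hy.trans hyy)
  have hy0 : 0 < y := by linarith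
  have hy1 : 0 < y' := by linarith
  rw [div_le_div_iff₀ he' he]
  refine (sq_le_sq₀ (by positivity) (by positivity)).1 ?_
  rw [mul_pow, mul_pow, Real.sq_sqrt (by nlinarith), Real.sq_sqrt (by nlinarith)]
  nlinarith [mul_le_mul_of_nonneg_left (pow_le_pow_left₀ (by linarith) hyy 2) (sq_nonneg τ)]

theorem profileRadius_antitone (hτ0 : 0 ≤ τ) {y' : ℝ} (hy : 1 ≤ y)
    (hyy : y ≤ y') : profileRadius τ y' ≤ profileRadius τ y := by
  have : √(y ^ 2 - τ ^ 2) ≤ √(y' ^ 2 - τ ^ 2) := Real.sqrt_le_sqrt (by nlinarith)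
  have := Real.sqrt_nonneg (y ^ 2 - τ ^ 2)
  unfold profileRadius
  gcongr

theorem profileCoeff_antitone (hτ0 : 0 ≤ τ) (hτ1 : τ < 1) {y' : ℝ} (hy : 1 ≤ y)
    (hyy : y ≤ y') : profileCoeff τ y' ≤ profileCoeff τ y := by
  have h1 : √(y ^ 2 - τ ^ 2) ≤ √(y' ^ 2 - τ ^ 2) := Real.sqrt_le_sqrt (by nlinarith)
  have h2 := div_sqrt_antitone hτ0 hτ1 hy hyy
  have h3 := sqrt_sq_sub_sq_pos hτ0 hτ1 hy
  have h4 : 0 ≤ 1 - τ ^ 2 := by nlinarith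
  have e : ∀ z : ℝ, profileCoeff τ z =
      2 * (1 - τ ^ 2) * (z / √(z ^ 2 - τ ^ 2)) / (z + √(z ^ 2 - τ ^ 2)) := by
    intro z
    rw [profileCoeff, ← div_div, div_right_comm]
    ring
  rw [e, e]
  gcongr

theorem profileConst_antitone (hτ0 : 0 ≤ τ) (hτ1 : τ < 1) {y' : ℝ} (hy : 1 ≤ y)
    (hyy : y ≤ y') : profileConst τ y' ≤ profileConst τ y := by
  rcases hτ0.eq_or_lt with rfl | hτ
  · simp [profileConst]
  have h4 : 0 ≤ 1 - τ ^ 2 := by nlinarith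
  have e : ∀ z : ℝ, 1 ≤ z →
      profileConst τ z = ((1 - τ ^ 2) * (z / √(z ^ 2 - τ ^ 2)) - 1) / τ := by
    intro z hz
    have h3 := sqrt_sq_sub_sq_pos hτ0 hτ1 hz
    have he2 : √(z ^ 2 - τ ^ 2) ^ 2 = z ^ 2 - τ ^ 2 := Real.sq_sqrt (by nlinarith)
    rw [profileConst]
    set e := √(z ^ 2 - τ ^ 2)
    field_simp
    linear_combination he2
  rw [e _ hy, e _ (hy.trans hyy)]
  have h2 := div_sqrt_antitone hτ0 hτ1 hy hyy
  gcongr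

end Profile

/-- The radius `a` for which `√(S² + c²) - S cos θ` is proportional to `|1 - a exp (iθ)| ^ 2`. -/
noncomputable def kernelRadius (S c : ℝ) : ℝ := S / (√(S ^ 2 + c ^ 2) + c)

theorem kernelRadius_nonneg {S c : ℝ} (hS : 0 ≤ S) (hc : 0 < c) : 0 ≤ kernelRadius S c := by
  unfold kernelRadius; positivity

theorem kernelRadius_lt_one {S c : ℝ} (hc : 0 < c) : kernelRadius S c < 1 := by
  have h : S ≤ √(S ^ 2 + c ^ 2) := Real.le_sqrt_of_sq_le (by nlinarith)
  rw [kernelRadius, div_lt_one (by positivity)]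
  linarith

theorem kernelRadius_strictMono {S S' c : ℝ} (hS : 0 ≤ S) (hSS : S < S') (hc : 0 < c) :
    kernelRadius S c < kernelRadius S' c := by
  have hS' : 0 ≤ S' := hS.trans hSS.le
  have h : S * √(S' ^ 2 + c ^ 2) ≤ S' * √(S ^ 2 + c ^ 2) := by
    refine (sq_le_sq₀ (by positivity) (by positivity)).1 ?_
    rw [mul_pow, mul_pow, Real.sq_sqrt (by positivity), Real.sq_sqrt (by positivity)]
    nlinarith [mul_le_mul_of_nonneg_left (pow_le_pow_left₀ hS hSS.le 2) (sq_nonneg c)]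
  rw [kernelRadius, kernelRadius, div_lt_div_iff₀ (by positivity) (by positivity)]
  nlinarith

/-- The mean of `profile τ` of the first coordinate of the image circle, over the circle of
latitude on which that coordinate has amplitude `1 / y`, with respect to the squared Poisson kernel
of the circle at `kernelRadius S c`. -/
noncomputable def latitudeMean (d : ℕ) (τ S c y : ℝ) : ℝ :=
  profileConst τ y + profileCoeff τ y * sqPoissonMean d (profileRadius τ y) (kernelRadius S c)

theorem integral_latitude {d : ℕ} (hd : 1 ≤ d) {τ y S c : ℝ} (hτ0 : 0 ≤ τ) (hτ1 : τ < 1)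
    (hy : 1 ≤ y) (hS : 0 ≤ S) (hc : 0 < c) :
    ∫ θ in -Real.pi..Real.pi, profile τ (Real.cos (d * θ) / y) *
        ((√(S ^ 2 + c ^ 2) - S * Real.cos θ) ^ 2)⁻¹ =
      2 * Real.pi * (√(S ^ 2 + c ^ 2) / c ^ 3 * latitudeMean d τ S c y) := by
  have key := integral_circle_real hd (kernelRadius_nonneg hS hc) (kernelRadius_lt_one (S := S) hc)
    (profileRadius_nonneg hτ0 hy) (profileRadius_lt_one hτ0 hτ1 hy) (profileConst τ y)
    (profileCoeff τ y)
  rw [← latitudeMean] at key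
  have hm : 0 < √(S ^ 2 + c ^ 2) := Real.sqrt_pos.2 (by positivity)
  have hm2 : √(S ^ 2 + c ^ 2) ^ 2 = S ^ 2 + c ^ 2 := Real.sq_sqrt (by positivity)
  set m := √(S ^ 2 + c ^ 2) with hmdef
  have ha : kernelRadius S c = S / (m + c) := rfl
  have h1 : 1 - kernelRadius S c ^ 2 = 2 * c / (m + c) := by
    rw [ha]; field_simp; linear_combination hm2
  have h2 : 1 + kernelRadius S c ^ 2 = 2 * m / (m + c) := by
    rw [ha]; field_simp; linear_combination (-1 : ℝ) * hm2
  have h3 : ∀ θ : ℝ, profile τ (Real.cos (d * θ) / y) * ((m - S * Real.cos θ) ^ 2)⁻¹ =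
      4 / (m + c) ^ 2 * ((profileConst τ y + profileCoeff τ y * ((Real.cos (d * θ) -
        profileRadius τ y) / (1 - 2 * profileRadius τ y * Real.cos (d * θ) +
          profileRadius τ y ^ 2))) *
        ((1 - 2 * kernelRadius S c * Real.cos θ + kernelRadius S c ^ 2) ^ 2)⁻¹) := by
    intro θ
    rw [← profile_expansion hτ0 hτ1 hy (Real.abs_cos_le_one _)]
    have h4 : 1 - 2 * kernelRadius S c * Real.cos θ + kernelRadius S c ^ 2 =
        2 * (m - S * Real.cos θ) / (m + c) := by
      have : 1 - 2 * kernelRadius S c * Real.cos θ + kernelRadius S c ^ 2 =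
        2 * m / (m + c) - 2 * kernelRadius S c * Real.cos θ := by rw [← h2]; ring
      rw [this, ha]; field_simp
    rw [h4, div_pow, mul_pow, inv_div]
    have : m + c ≠ 0 := by positivity
    rw [div_eq_mul_inv ((m + c) ^ 2), mul_inv]
    field_simp
    norm_num
  simp_rw [h3]
  rw [intervalIntegral.integral_const_mul, key, h1, h2]
  field_simp
  norm_num

/-! ### The first coordinate of the mean on the axis -/

/-- The first standard basis vector. -/
noncomputable def e1 : E3 := EuclideanSpace.single 0 1

theorem norm_e1 : ‖e1‖ = 1 := by simp [e1]

theorem inner_e1 (x : E3) : inner ℝ e1 x = x 0 := by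
  simp [e1, EuclideanSpace.inner_single_left]

theorem lift_smul_e1 (S : ℝ) : lift (S • e1) = √(1 + S ^ 2) := by
  rw [lift, norm_smul, norm_e1, mul_one, Real.norm_eq_abs, sq_abs]

theorem cosh_mul_pairing_e1 (S : ℝ) (p : ℝ × ℝ) :
    Real.cosh p.1 * pairing (S • e1) (cyl p) = √(1 + S ^ 2) * Real.cosh p.1 - S * Real.cos p.2 := by
  have := Real.cosh_pos p.1
  rw [pairing, lift_smul_e1, real_inner_smul_left, inner_e1, cyl_zero]
  field_simp

theorem integrable_cyl {P : E3} {F : S2 → ℝ}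
    (hF : Integrable F (eta (ballPoint P) (norm_ballPoint_lt P))) :
    Integrable (fun p => F (cyl p) * (1 / (4 * Real.pi * (Real.cosh p.1 * pairing P (cyl p)) ^ 2)))
      cylMeasure := by
  have hm : Measurable fun p : ℝ × ℝ =>
      1 / (4 * Real.pi * (Real.cosh p.1 * pairing P (cyl p)) ^ 2) := by
    have := (continuous_pairing P).measurable.comp continuous_cyl.measurable
    fun_prop
  have hpi := Real.pi_pos
  rw [eta_eq_map_cyl] at hF
  have h1 := hF.comp_measurable continuous_cyl.measurable
  rw [integrable_withDensity_iff hm.ennreal_ofReal (ae_of_all _ fun _ => ENNReal.ofReal_lt_top)]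
    at h1
  refine h1.congr (ae_of_all _ fun p => ?_)
  simp only [Function.comp]
  rw [ENNReal.toReal_ofReal (by positivity)]

theorem integral_eta_eq {P : E3} {F : S2 → ℝ}
    (hF : Integrable F (eta (ballPoint P) (norm_ballPoint_lt P))) :
    ∫ ζ, F ζ ∂(eta (ballPoint P) (norm_ballPoint_lt P)) = ∫ v : ℝ, ∫ θ in -Real.pi..Real.pi,
      F (cyl (v, θ)) * (1 / (4 * Real.pi * (Real.cosh v * pairing P (cyl (v, θ))) ^ 2)) := by
  have hm : Measurable fun p : ℝ × ℝ =>
      1 / (4 * Real.pi * (Real.cosh p.1 * pairing P (cyl p)) ^ 2) := by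
    have := (continuous_pairing P).measurable.comp continuous_cyl.measurable
    fun_prop
  have hpi := Real.pi_pos
  have h0 := integrable_cyl hF
  have hF' := hF.aestronglyMeasurable
  rw [eta_eq_map_cyl] at hF' ⊢
  rw [integral_map continuous_cyl.measurable.aemeasurable hF',
    integral_withDensity_eq_integral_toReal_smul hm.ennreal_ofReal
      (ae_of_all _ fun _ => ENNReal.ofReal_lt_top)]
  have : ∀ p : ℝ × ℝ, (ENNReal.ofReal
      (1 / (4 * Real.pi * (Real.cosh p.1 * pairing P (cyl p)) ^ 2))).toReal • F (cyl p) =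
      F (cyl p) * (1 / (4 * Real.pi * (Real.cosh p.1 * pairing P (cyl p)) ^ 2)) := by
    intro p
    rw [ENNReal.toReal_ofReal (by positivity), smul_eq_mul, mul_comm]
  simp_rw [this]
  rw [cylMeasure, integral_prod _ h0]
  refine integral_congr_ae (ae_of_all _ fun v => ?_)
  simp only
  rw [intervalIntegral.integral_of_le (by linarith), integral_Ioc_eq_integral_Ioo]

theorem integrable_integral_cyl {P : E3} {F : S2 → ℝ}
    (hF : Integrable F (eta (ballPoint P) (norm_ballPoint_lt P))) :
    Integrable fun v : ℝ => ∫ θ in -Real.pi..Real.pi,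
      F (cyl (v, θ)) * (1 / (4 * Real.pi * (Real.cosh v * pairing P (cyl (v, θ))) ^ 2)) := by
  have hpi := Real.pi_pos
  refine (integrable_cyl hF).integral_prod_left.congr (ae_of_all _ fun v => ?_)
  simp only
  rw [intervalIntegral.integral_of_le (by linarith), integral_Ioc_eq_integral_Ioo]

/-- The substitution `sinh v = sinh x / √(1 + S²)`, where `x` is the hyperbolic distance from the
point `S` of the axis to the geodesic disc at height `v`. -/
noncomputable def heightParam (S x : ℝ) : ℝ := Real.arsinh (Real.sinh x / √(1 + S ^ 2))

theorem sqrt_mul_cosh_heightParam (S x : ℝ) :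
    √(1 + S ^ 2) * Real.cosh (heightParam S x) = √(S ^ 2 + Real.cosh x ^ 2) := by
  have h : 0 < 1 + S ^ 2 := by positivity
  rw [heightParam, Real.cosh_arsinh, ← Real.sqrt_mul h.le, div_pow, Real.sq_sqrt h.le,
    Real.cosh_sq]
  congr 1
  field_simp
  ring

theorem hasDerivAt_heightParam (S x : ℝ) :
    HasDerivAt (heightParam S) (Real.cosh x / √(S ^ 2 + Real.cosh x ^ 2)) x := by
  have h : 0 < √(1 + S ^ 2) := by positivity
  have h1 := (Real.hasDerivAt_arsinh (Real.sinh x / √(1 + S ^ 2))).comp x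
    ((Real.hasDerivAt_sinh x).div_const (√(1 + S ^ 2)))
  have e : Real.cosh x / √(S ^ 2 + Real.cosh x ^ 2) =
      (√(1 + (Real.sinh x / √(1 + S ^ 2)) ^ 2))⁻¹ * (Real.cosh x / √(1 + S ^ 2)) := by
    rw [← sqrt_mul_cosh_heightParam, heightParam, Real.cosh_arsinh]
    field_simp
  rw [e]
  exact h1

theorem heightParam_injective (S : ℝ) : Function.Injective (heightParam S) := by
  intro x y h
  have h0 : √(1 + S ^ 2) ≠ 0 := by positivity
  have := Real.arsinh_injective h
  exact Real.sinh_injective ((div_left_inj' h0).1 this)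

theorem heightParam_surjective (S : ℝ) : Function.Surjective (heightParam S) := by
  intro v
  have h0 : √(1 + S ^ 2) ≠ 0 := by positivity
  refine ⟨Real.arsinh (√(1 + S ^ 2) * Real.sinh v), ?_⟩
  rw [heightParam, Real.sinh_arsinh, mul_div_cancel_left₀ _ h0, Real.arsinh_sinh]

theorem integral_comp_heightParam (S : ℝ) (g : ℝ → ℝ) :
    ∫ v, g v = ∫ x, Real.cosh x / √(S ^ 2 + Real.cosh x ^ 2) * g (heightParam S x) := by
  have h := integral_image_eq_integral_abs_deriv_smul MeasurableSet.univ
    (fun x _ => (hasDerivAt_heightParam S x).hasDerivWithinAt) (heightParam_injective S).injOn g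
  rw [image_univ, (heightParam_surjective S).range_eq, setIntegral_univ, setIntegral_univ] at h
  rw [h]
  refine integral_congr_ae (ae_of_all _ fun x => ?_)
  simp only [smul_eq_mul]
  rw [abs_of_pos]
  have := Real.cosh_pos x
  positivity

theorem Integrable.comp_heightParam (S : ℝ) {g : ℝ → ℝ} (hg : Integrable g) :
    Integrable fun x => Real.cosh x / √(S ^ 2 + Real.cosh x ^ 2) * g (heightParam S x) := by
  have h := integrableOn_image_iff_integrableOn_abs_deriv_smul MeasurableSet.univ
    (fun x _ => (hasDerivAt_heightParam S x).hasDerivWithinAt) (heightParam_injective S).injOn g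
  rw [image_univ, (heightParam_surjective S).range_eq, integrableOn_univ, integrableOn_univ] at h
  refine (h.1 hg).congr (ae_of_all _ fun x => ?_)
  simp only [smul_eq_mul]
  rw [abs_of_pos]
  have := Real.cosh_pos x
  positivity

theorem abs_arsinh_le_abs_arsinh {s t : ℝ} (h : |s| ≤ |t|) :
    |Real.arsinh s| ≤ |Real.arsinh t| := by
  rw [← Real.sinh_le_sinh, ← Real.abs_sinh, ← Real.abs_sinh, Real.sinh_arsinh, Real.sinh_arsinh]
  exact h

theorem cosh_heightParam_antitone (d : ℕ) {S S' : ℝ} (hS : 0 ≤ S) (hSS : S ≤ S') (x : ℝ) :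
    Real.cosh (d * heightParam S' x) ≤ Real.cosh (d * heightParam S x) := by
  rw [Real.cosh_le_cosh, abs_mul, abs_mul]
  refine mul_le_mul_of_nonneg_left (abs_arsinh_le_abs_arsinh ?_) (abs_nonneg _)
  rw [abs_div, abs_div, abs_of_nonneg (Real.sqrt_nonneg _), abs_of_nonneg (Real.sqrt_nonneg _)]
  gcongr

/-- The mean over the circle of latitude at height `heightParam S x`. -/
noncomputable def heightMean (d : ℕ) (τ S x : ℝ) : ℝ :=
  latitudeMean d τ S (Real.cosh x) (Real.cosh (d * heightParam S x))

/-- All ingredients of the mean over a circle increase with `S`: the circle itself moves closer to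
the equator, and the harmonic measure on the circle becomes more concentrated. -/
theorem heightMean_strictMono {d : ℕ} (hd : 1 ≤ d) {τ : ℝ} (hτ0 : 0 ≤ τ) (hτ1 : τ < 1) {S S' : ℝ}
    (hS : 0 ≤ S) (hSS : S < S') (x : ℝ) : heightMean d τ S x < heightMean d τ S' x := by
  have hy := cosh_heightParam_antitone d hS hSS.le x
  have hy1 := Real.one_le_cosh (d * heightParam S' x)
  have hc := Real.cosh_pos x
  have ha := kernelRadius_strictMono hS hSS hc
  have ha0 := kernelRadius_nonneg hS hc
  have ha1 := (kernelRadius_lt_one (S := S) hc).le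
  have ha1' := (kernelRadius_lt_one (S := S') hc).le
  unfold heightMean latitudeMean
  set y := Real.cosh (d * heightParam S x)
  set y' := Real.cosh (d * heightParam S' x)
  have hb0 := profileRadius_nonneg hτ0 (hy1.trans hy)
  have hb0' := profileRadius_nonneg hτ0 hy1
  have hb1' := profileRadius_lt_one hτ0 hτ1 hy1
  have hb := profileRadius_antitone hτ0 hy1 hy
  have hA := profileConst_antitone hτ0 hτ1 hy1 hy
  have hB := profileCoeff_antitone hτ0 hτ1 hy1 hy
  have hB' := profileCoeff_pos hτ0 hτ1 hy1
  have h1 := sqPoissonMean_mono_left (d := d) ha0 ha1 hb0 hb hb1'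
  have h2 := sqPoissonMean_strictMonoOn hd hb0' hb1' ⟨ha0, ha1⟩ ⟨ha0.trans ha.le, ha1'⟩ ha
  have h3 := sqPoissonMean_nonneg (d := d) ha0 ha1 hb0 (hb.trans_lt hb1')
  refine add_lt_add_of_le_of_lt hA ?_
  calc _ ≤ profileCoeff τ y' * sqPoissonMean d (profileRadius τ y) (kernelRadius S (Real.cosh x)) :=
        mul_le_mul_of_nonneg_right hB h3
    _ < _ := mul_lt_mul_of_pos_left (h1.trans_lt h2) hB'

theorem abs_zero_le (x : S2) : |(x : E3) 0| ≤ 1 := by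
  have h := S2_sum_sq x
  rw [← sq_le_one_iff_abs_le_one]
  nlinarith [sq_nonneg ((x : E3) 1), sq_nonneg ((x : E3) 2)]

theorem one_sub_mul_pos {τ u : ℝ} (hτ0 : 0 ≤ τ) (hτ1 : τ < 1) (hu : |u| ≤ 1) : 0 < 1 - τ * u := by
  nlinarith [(abs_le.1 hu).2, (abs_le.1 hu).1]

theorem continuous_profile_hat {d : ℕ} (hd : 1 ≤ d) {τ : ℝ} (hτ0 : 0 ≤ τ) (hτ1 : τ < 1) :
    Continuous fun ζ : S2 => profile τ ((hat (powMap d) ζ : E3) 0) := by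
  have h := continuous_hat_powMap hd
  unfold profile
  exact Continuous.div (by fun_prop) (by fun_prop) fun ζ =>
    (one_sub_mul_pos hτ0 hτ1 (abs_zero_le _)).ne'

/-- The mean of `profile τ` of the first coordinate of the image under the power map, for the
harmonic measure whose center lies on the first axis, over the point `S` of the hyperboloid. -/
noncomputable def axisMean (d : ℕ) (S τ : ℝ) : ℝ :=
  ∫ ζ : S2, profile τ ((hat (powMap d) ζ : E3) 0) ∂eta (ballPoint (S • e1)) (norm_ballPoint_lt _)

/-- The contribution of one circle of latitude, including the Jacobian of the substitution
`heightParam`. The factor `√(S ^ 2 + cosh x ^ 2)` cancels, so that `S` enters only through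
`heightMean`. -/
theorem integral_axis {d : ℕ} (hd : 1 ≤ d) {S τ : ℝ} (hS : 0 ≤ S) (hτ0 : 0 ≤ τ) (hτ1 : τ < 1)
    (x : ℝ) :
    Real.cosh x / √(S ^ 2 + Real.cosh x ^ 2) * ∫ θ in -Real.pi..Real.pi,
      profile τ ((hat (powMap d) (cyl (heightParam S x, θ)) : E3) 0) *
        (1 / (4 * Real.pi * (Real.cosh (heightParam S x) *
          pairing (S • e1) (cyl (heightParam S x, θ))) ^ 2)) =
      1 / 2 * (heightMean d τ S x / Real.cosh x ^ 2) := by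
  have hc := Real.cosh_pos x
  have hpi := Real.pi_pos
  have hm : 0 < √(S ^ 2 + Real.cosh x ^ 2) := by positivity
  have key := integral_latitude hd hτ0 hτ1 (Real.one_le_cosh (d * heightParam S x)) hS hc
  have h1 : ∀ θ : ℝ, profile τ ((hat (powMap d) (cyl (heightParam S x, θ)) : E3) 0) *
        (1 / (4 * Real.pi * (Real.cosh (heightParam S x) *
          pairing (S • e1) (cyl (heightParam S x, θ))) ^ 2)) =
      1 / (4 * Real.pi) * (profile τ (Real.cos (d * θ) / Real.cosh (d * heightParam S x)) *
        ((√(S ^ 2 + Real.cosh x ^ 2) - S * Real.cos θ) ^ 2)⁻¹) := by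
    intro θ
    rw [hat_powMap_cyl, cyl_zero, cosh_mul_pairing_e1 S (heightParam S x, θ),
      sqrt_mul_cosh_heightParam]
    simp only [one_div, mul_inv]
    ring
  simp_rw [h1]
  rw [intervalIntegral.integral_const_mul, key, heightMean]
  field_simp
  norm_num

theorem axisMean_eq {d : ℕ} (hd : 1 ≤ d) {S τ : ℝ} (hS : 0 ≤ S) (hτ0 : 0 ≤ τ) (hτ1 : τ < 1) :
    axisMean d S τ = ∫ x, 1 / 2 * (heightMean d τ S x / Real.cosh x ^ 2) := by
  rw [axisMean, integral_eta_eq (integrable_of_continuous_sphere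
    (continuous_profile_hat hd hτ0 hτ1)), integral_comp_heightParam S]
  exact integral_congr_ae (ae_of_all _ (integral_axis hd hS hτ0 hτ1))

theorem integrable_heightMean {d : ℕ} (hd : 1 ≤ d) {S τ : ℝ} (hS : 0 ≤ S) (hτ0 : 0 ≤ τ)
    (hτ1 : τ < 1) : Integrable fun x => 1 / 2 * (heightMean d τ S x / Real.cosh x ^ 2) :=
  (Integrable.comp_heightParam S (integrable_integral_cyl (integrable_of_continuous_sphere
    (continuous_profile_hat hd hτ0 hτ1)))).congr (ae_of_all _ (integral_axis hd hS hτ0 hτ1))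

theorem axisMean_strictMono {d : ℕ} (hd : 1 ≤ d) {τ : ℝ} (hτ0 : 0 ≤ τ) (hτ1 : τ < 1) {S S' : ℝ}
    (hS : 0 ≤ S) (hSS : S < S') : axisMean d S τ < axisMean d S' τ := by
  have hlt : ∀ x, 1 / 2 * (heightMean d τ S x / Real.cosh x ^ 2) <
      1 / 2 * (heightMean d τ S' x / Real.cosh x ^ 2) := by
    intro x
    have := heightMean_strictMono hd hτ0 hτ1 hS hSS x
    have := Real.cosh_pos x
    gcongr
  have hi := integrable_heightMean hd hS hτ0 hτ1
  have hi' := integrable_heightMean hd (hS.trans hSS.le) hτ0 hτ1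
  rw [axisMean_eq hd hS hτ0 hτ1, axisMean_eq hd (hS.trans hSS.le) hτ0 hτ1, ← sub_pos,
    ← integral_sub hi' hi, integral_pos_iff_support_of_nonneg (fun x => (sub_pos.2 (hlt x)).le)
      (hi'.sub hi)]
  have : (Function.support fun x => 1 / 2 * (heightMean d τ S' x / Real.cosh x ^ 2) -
      1 / 2 * (heightMean d τ S x / Real.cosh x ^ 2)) = univ := by
    ext x; simpa using (sub_pos.2 (hlt x)).ne'
  rw [this]
  simp

/-! ### The radial function -/

theorem abs_profile_le {τ u : ℝ} (hτ0 : 0 ≤ τ) (hτ1 : τ ≤ 1) (hu : |u| ≤ 1) :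
    |profile τ u| ≤ 1 := by
  obtain ⟨h1, h2⟩ := abs_le.1 hu
  have h : 0 ≤ 1 - τ * u := by nlinarith
  rw [profile, abs_div, abs_of_nonneg h]
  refine div_le_one_of_le₀ (abs_le.2 ⟨?_, ?_⟩) h <;> nlinarith

theorem profile_strictAnti {τ τ' u : ℝ} (hτ0 : 0 ≤ τ) (hττ : τ < τ') (hτ1 : τ' < 1) (hu : |u| < 1) :
    profile τ' u < profile τ u := by
  have h1 := one_sub_mul_pos hτ0 (hττ.trans hτ1) hu.le
  have h2 := one_sub_mul_pos (hτ0.trans hττ.le) hτ1 hu.le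
  obtain ⟨h3, h4⟩ := abs_lt.1 hu
  rw [profile, profile, div_lt_div_iff₀ h2 h1]
  nlinarith [mul_pos (sub_pos.2 hττ) (mul_pos (by linarith : 0 < 1 + u) (by linarith : 0 < 1 - u))]

theorem abs_zero_lt_of_two_ne (x : S2) (hx : (x : E3) 2 ≠ 0) : |(x : E3) 0| < 1 := by
  have h := S2_sum_sq x
  have h2 : 0 < (x : E3) 2 ^ 2 := by positivity
  rw [← sq_lt_one_iff_abs_lt_one]
  nlinarith [sq_nonneg ((x : E3) 1)]

/-- The images of the points `± e1`, where the profile degenerates as `τ` tends to `1`, are not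
charged. -/
theorem ae_hat_powMap_abs_lt {d : ℕ} (hd : 1 ≤ d) (P : E3) :
    ∀ᵐ ζ ∂eta (ballPoint P) (norm_ballPoint_lt P), |(hat (powMap d) ζ : E3) 0| < 1 := by
  have h := pushEta_two_eq hd P 0
  have hm : MeasurableSet {x : S2 | (x : E3) 2 = 0} :=
    (isClosed_eq (by fun_prop) continuous_const).measurableSet
  rw [pushEta, Measure.map_apply (continuous_hat_powMap hd).measurable hm] at h
  refine measure_mono_null (fun ζ hζ => ?_) h
  by_contra h2
  exact hζ (abs_zero_lt_of_two_ne _ h2)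

theorem measurable_profile_hat {d : ℕ} (hd : 1 ≤ d) (τ : ℝ) :
    Measurable fun ζ : S2 => profile τ ((hat (powMap d) ζ : E3) 0) := by
  have h : Measurable fun ζ : S2 => (hat (powMap d) ζ : E3) 0 := by
    have := continuous_hat_powMap hd
    exact (by fun_prop : Continuous fun ζ : S2 => (hat (powMap d) ζ : E3) 0).measurable
  exact (h.sub_const τ).div ((h.const_mul τ).const_sub 1)

theorem axisMean_strictAnti {d : ℕ} (hd : 1 ≤ d) (S : ℝ) {τ τ' : ℝ} (hτ0 : 0 ≤ τ) (hττ : τ < τ')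
    (hτ1 : τ' < 1) : axisMean d S τ' < axisMean d S τ := by
  have hlt := (ae_hat_powMap_abs_lt hd (S • e1)).mono fun ζ hζ =>
    profile_strictAnti hτ0 hττ hτ1 hζ
  have hi := integrable_of_continuous_sphere (μ := eta (ballPoint (S • e1)) (norm_ballPoint_lt _))
    (continuous_profile_hat hd hτ0 (hττ.trans hτ1))
  have hi' := integrable_of_continuous_sphere (μ := eta (ballPoint (S • e1)) (norm_ballPoint_lt _))
    (continuous_profile_hat hd (hτ0.trans hττ.le) hτ1)
  rw [axisMean, axisMean, ← sub_pos, ← integral_sub hi hi', integral_pos_iff_support_of_nonneg_ae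
    (hlt.mono fun ζ hζ => (sub_pos.2 hζ).le) (hi.sub hi')]
  have : (Function.support fun ζ : S2 => profile τ ((hat (powMap d) ζ : E3) 0) -
      profile τ' ((hat (powMap d) ζ : E3) 0)) =ᵐ[eta (ballPoint (S • e1)) (norm_ballPoint_lt _)]
      univ := Filter.eventuallyEq_univ.2 (hlt.mono fun ζ hζ => (sub_pos.2 hζ).ne')
  rw [measure_congr this, measure_univ]
  exact one_pos

theorem axisMean_zero_zero {d : ℕ} (hd : 1 ≤ d) : axisMean d 0 0 = 0 := by
  rw [axisMean_eq hd le_rfl le_rfl one_pos]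
  have h0 : (0 : ℝ) ^ d = 0 := zero_pow (by omega)
  have : ∀ x, heightMean d 0 0 x = 0 := by
    intro x
    simp [heightMean, latitudeMean, profileConst, kernelRadius, sqPoissonMean, h0]
  simp [this]

theorem continuousOn_axisMean {d : ℕ} (hd : 1 ≤ d) (S : ℝ) :
    ContinuousOn (axisMean d S) (Icc 0 1) := by
  refine continuousOn_of_dominated (bound := fun _ => 1)
    (fun τ _ => (measurable_profile_hat hd τ).aestronglyMeasurable)
    (fun τ hτ => ae_of_all _ fun ζ => abs_profile_le hτ.1 hτ.2 (abs_zero_le _))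
    (integrable_const 1) ((ae_hat_powMap_abs_lt hd (S • e1)).mono fun ζ hζ => ?_)
  unfold profile
  refine ContinuousOn.div (by fun_prop) (by fun_prop) fun τ hτ => ?_
  obtain ⟨h1, h2⟩ := abs_lt.1 hζ
  have : 0 < 1 - τ * (hat (powMap d) ζ : E3) 0 := by
    rcases le_total 0 ((hat (powMap d) ζ : E3) 0) with h | h
    · nlinarith [hτ.1, hτ.2]
    · nlinarith [hτ.1, hτ.2]
  exact this.ne'

theorem axisMean_one {d : ℕ} (hd : 1 ≤ d) (S : ℝ) : axisMean d S 1 = -1 := by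
  have : ∀ᵐ ζ ∂eta (ballPoint (S • e1)) (norm_ballPoint_lt _),
      profile 1 ((hat (powMap d) ζ : E3) 0) = -1 := by
    filter_upwards [ae_hat_powMap_abs_lt hd (S • e1)] with ζ hζ
    have := (abs_lt.1 hζ).2
    rw [profile, one_mul, div_eq_iff (by linarith)]
    ring
  rw [axisMean, integral_congr_ae this]
  simp

/-- Every center on the axis has an image: the mean changes sign between `τ = 0` and the limit value
`-1` at `τ = 1`. -/
theorem exists_axisMean_eq_zero_right {d : ℕ} (hd : 1 ≤ d) {S : ℝ} (hS : 0 ≤ S) :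
    ∃ τ ∈ Ico (0 : ℝ) 1, axisMean d S τ = 0 := by
  have h0 : 0 ≤ axisMean d S 0 := by
    rcases hS.eq_or_lt with rfl | hS
    · exact (axisMean_zero_zero hd).ge
    · exact (axisMean_zero_zero hd).ge.trans
        (axisMean_strictMono hd le_rfl one_pos le_rfl hS).le
  obtain ⟨τ, hτ, h⟩ := intermediate_value_Icc' zero_le_one (continuousOn_axisMean hd S)
    (show (0 : ℝ) ∈ Icc _ _ from ⟨by rw [axisMean_one hd]; norm_num, h0⟩)
  refine ⟨τ, ⟨hτ.1, lt_of_le_of_ne hτ.2 ?_⟩, h⟩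
  rintro rfl
  rw [axisMean_one hd] at h
  norm_num at h

theorem eta_zero : eta (ballPoint 0) (norm_ballPoint_lt 0) = eta0 := by
  have : poissonSq 0 = 1 := by
    ext ζ; simp [poissonSq, pairing, lift]
  rw [eta_ballPoint, this, withDensity_one]

theorem ae_eta0_zero_ne : ∀ᵐ ζ : S2 ∂eta0, (ζ : E3) 0 ≠ -1 := by
  have h := eta_two_eq 0 0
  rw [eta_zero] at h
  refine measure_mono_null (fun ζ hζ => ?_) h
  by_contra h2
  have h3 : (ζ : E3) 0 = -1 := not_not.1 hζ
  have h4 := abs_zero_lt_of_two_ne ζ h2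
  rw [h3] at h4
  norm_num at h4

/-- At the boundary the Möbius transformation degenerates to a constant, off the antipode. -/
theorem moebius_e1 (ζ : S2) (hζ : (ζ : E3) 0 ≠ -1) : moebius e1 ζ = e1 := by
  have h : 2 + 2 * (ζ : E3) 0 ≠ 0 := fun h => hζ (by linarith)
  rw [moebius, norm_e1, inner_e1, mem_sphere_zero_iff_norm.1 ζ.2]
  norm_num
  rw [smul_smul, inv_mul_cancel₀ h, one_smul]

theorem norm_moebius_smul_e1 {r : ℝ} (hr : r ∈ Icc (0 : ℝ) 1) (ζ : S2) (hζ : (ζ : E3) 0 ≠ -1) :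
    ‖moebius (r • e1) ζ‖ = 1 := by
  rcases hr.2.eq_or_lt with rfl | h
  · rw [one_smul, moebius_e1 ζ hζ, norm_e1]
  · refine norm_moebius_eq_one _ _ ?_ (mem_sphere_zero_iff_norm.1 ζ.2)
    rw [norm_smul, norm_e1, mul_one, Real.norm_of_nonneg hr.1]
    exact h

theorem continuousOn_moebius_smul_e1 (ζ : S2) (hζ : (ζ : E3) 0 ≠ -1) :
    ContinuousOn (fun r : ℝ => moebius (r • e1) ζ) (Icc 0 1) := by
  have hin : Continuous fun r : ℝ => inner ℝ (r • e1) (ζ : E3) := by fun_prop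
  have hden : Continuous fun r : ℝ =>
      1 + ‖r • e1‖ ^ 2 * ‖(ζ : E3)‖ ^ 2 + 2 * inner ℝ (r • e1) (ζ : E3) := by fun_prop
  have hnum : Continuous fun r : ℝ => (1 - ‖r • e1‖ ^ 2) • (ζ : E3) +
      (1 + ‖(ζ : E3)‖ ^ 2 + 2 * inner ℝ (r • e1) (ζ : E3)) • r • e1 := by fun_prop
  refine ContinuousOn.smul (hden.continuousOn.inv₀ fun r hr => ?_) hnum.continuousOn
  have h1 := (abs_le.1 (abs_zero_le ζ)).1
  have h2 : 0 < 1 + (ζ : E3) 0 := lt_of_le_of_ne (by linarith) fun h => hζ (by linarith)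
  rw [norm_smul, norm_e1, mem_sphere_zero_iff_norm.1 ζ.2, real_inner_smul_left, inner_e1,
    Real.norm_of_nonneg hr.1]
  have h3 : 0 < (1 - r) ^ 2 + 2 * r * (1 + (ζ : E3) 0) := by
    rcases hr.1.eq_or_lt with rfl | h
    · norm_num
    · positivity
  nlinarith

/-- The mean `axisMean` as a function of the Euclidean coordinate of the center on the axis. This
expression also makes sense at the boundary point. -/
noncomputable def axisMeanBall (d : ℕ) (τ r : ℝ) : ℝ :=
  ∫ ζ : S2, profile τ (powFun d (moebius (r • e1) ζ) 0) ∂eta0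

theorem continuousOn_axisMeanBall {d : ℕ} (hd : 1 ≤ d) {τ : ℝ} (hτ0 : 0 ≤ τ) (hτ1 : τ < 1) :
    ContinuousOn (axisMeanBall d τ) (Icc 0 1) := by
  have hF : ∀ r ∈ Icc (0 : ℝ) 1, ∀ ζ : S2, ∀ hζ : (ζ : E3) 0 ≠ -1, ∀ hr : ‖moebius (r • e1) ζ‖ = 1,
      profile τ (powFun d (moebius (r • e1) ζ) 0) =
        profile τ
          ((hat (powMap d) ⟨moebius (r • e1) ζ, mem_sphere_zero_iff_norm.2 hr⟩ : E3) 0) := by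
    intro r _ ζ _ hr
    rw [hat_powMap_eq_powFun hd]
  refine continuousOn_of_dominated (bound := fun _ => 1) (fun r hr => ?_) (fun r hr => ?_)
    (integrable_const 1) ?_
  · have h1 : Measurable fun ζ : S2 => moebius (r • e1) ζ := by unfold moebius; fun_prop
    have h2 : Measurable fun x : E3 => powFun d x 0 := by
      have hz : Measurable fun x : E3 => (⟨x 0, x 1⟩ : ℂ) :=
        Complex.measurableEquivRealProd.symm.measurable.comp
          ((by fun_prop : Measurable fun x : E3 => x 0).prodMk (by fun_prop))
      have : (fun x : E3 => powFun d x 0) = fun x : E3 => ((1 + x 2) ^ d + (1 - x 2) ^ d)⁻¹ *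
          (2 * ((⟨x 0, x 1⟩ : ℂ) ^ d).re) := by
        ext x; simp [powFun]
      rw [this]
      have h3 : Measurable fun x : E3 => ((⟨x 0, x 1⟩ : ℂ) ^ d).re :=
        Complex.measurable_re.comp (hz.pow_const d)
      fun_prop
    have h3 : Measurable (profile τ) := by unfold profile; fun_prop
    exact (h3.comp (h2.comp h1)).aestronglyMeasurable
  · filter_upwards [ae_eta0_zero_ne] with ζ hζ
    rw [hF r hr ζ hζ (norm_moebius_smul_e1 hr ζ hζ)]
    exact abs_profile_le hτ0 hτ1.le (abs_zero_le _)
  · filter_upwards [ae_eta0_zero_ne] with ζ hζ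
    rw [continuousOn_iff_continuous_domRestrict]
    have h1 := continuousOn_iff_continuous_domRestrict.1 (continuousOn_moebius_smul_e1 ζ hζ)
    have h2 : Continuous fun r : Icc (0 : ℝ) 1 =>
        (⟨moebius ((r : ℝ) • e1) ζ,
          mem_sphere_zero_iff_norm.2 (norm_moebius_smul_e1 r.2 ζ hζ)⟩ : S2) :=
      h1.subtype_mk _
    refine ((continuous_profile_hat hd hτ0 hτ1).comp h2).congr fun r => ?_
    exact (hF r r.2 ζ hζ (norm_moebius_smul_e1 r.2 ζ hζ)).symm

theorem axisMeanBall_one {d : ℕ} {τ : ℝ} (hτ1 : τ < 1) :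
    axisMeanBall d τ 1 = 1 := by
  have : ∀ᵐ ζ : S2 ∂eta0, profile τ (powFun d (moebius ((1 : ℝ) • e1) ζ) 0) = 1 := by
    filter_upwards [ae_eta0_zero_ne] with ζ hζ
    have h1 : powFun d e1 0 = 1 := by
      have h2 : (⟨1, 0⟩ : ℂ) = 1 := rfl
      simp [powFun, e1, h2]
      norm_num
    rw [one_smul, moebius_e1 ζ hζ, h1, profile, mul_one, div_self (by linarith)]
  rw [axisMeanBall, integral_congr_ae this]
  simp

theorem hypPoint_smul_e1 (r : ℝ) : hypPoint (r • e1) = (2 * r / (1 - r ^ 2)) • e1 := by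
  rw [hypPoint, norm_smul, norm_e1, mul_one, Real.norm_eq_abs, sq_abs, smul_smul]
  congr 1
  ring

theorem axisMeanBall_eq {d : ℕ} (hd : 1 ≤ d) {τ r : ℝ} (hr : r ∈ Ico (0 : ℝ) 1) :
    axisMeanBall d τ r = axisMean d (2 * r / (1 - r ^ 2)) τ := by
  have hn : ‖r • e1‖ < 1 := by
    rw [norm_smul, norm_e1, mul_one, Real.norm_of_nonneg hr.1]; exact hr.2
  have hb : ballPoint ((2 * r / (1 - r ^ 2)) • e1) = r • e1 := by
    rw [← hypPoint_smul_e1, ballPoint_hypPoint hn]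
  have hcongr : ∀ (w : E3) (hw : ‖w‖ < 1), w = r • e1 → eta w hw = eta (r • e1) hn := by
    rintro w hw rfl; rfl
  rw [axisMean, hcongr _ _ hb, eta,
    integral_map (continuous_moebiusSphere _ _).measurable.aemeasurable
      (measurable_profile_hat hd τ).aestronglyMeasurable, axisMeanBall]
  refine integral_congr_ae (ae_of_all _ fun ζ => ?_)
  simp only [hat_powMap_eq_powFun hd]
  rfl

/-- Every point of the axis is an image: the mean changes sign between the center `0` and the limit
value `1` at the boundary point `e1`. -/
theorem exists_axisMean_eq_zero_left {d : ℕ} (hd : 1 ≤ d) {τ : ℝ} (hτ : τ ∈ Ico (0 : ℝ) 1) :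
    ∃ S, 0 ≤ S ∧ axisMean d S τ = 0 := by
  have h0 : axisMeanBall d τ 0 ≤ 0 := by
    rw [axisMeanBall_eq hd ⟨le_rfl, one_pos⟩]
    norm_num
    rcases hτ.1.eq_or_lt with rfl | h
    · exact (axisMean_zero_zero hd).le
    · exact (axisMean_strictAnti hd 0 le_rfl h hτ.2).le.trans (axisMean_zero_zero hd).le
  obtain ⟨r, hr, h⟩ := intermediate_value_Icc zero_le_one (continuousOn_axisMeanBall hd hτ.1 hτ.2)
    (show (0 : ℝ) ∈ Icc _ _ from ⟨h0, by rw [axisMeanBall_one hτ.2]; norm_num⟩)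
  have hr1 : r < 1 := lt_of_le_of_ne hr.2 (by
    rintro rfl
    rw [axisMeanBall_one hτ.2] at h
    norm_num at h)
  refine ⟨2 * r / (1 - r ^ 2), ?_, by rw [← axisMeanBall_eq hd ⟨hr.1, hr1⟩]; exact h⟩
  have : 0 < 1 - r ^ 2 := by nlinarith [hr.1]
  have := hr.1
  positivity

/-- The function `sinh r ↦ tanh r` on the half-line. -/
theorem div_sqrt_strictMonoOn : StrictMonoOn (fun S : ℝ => S / √(1 + S ^ 2)) (Ici 0) := by
  intro S hS S' hS' h
  have hS0 : 0 ≤ S := hS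
  have hS0' : 0 ≤ S' := hS'
  simp only
  rw [div_lt_div_iff₀ (by positivity) (by positivity)]
  refine (sq_lt_sq₀ (by positivity) (by positivity)).1 ?_
  rw [mul_pow, mul_pow, Real.sq_sqrt (by positivity), Real.sq_sqrt (by positivity)]
  nlinarith

theorem div_sqrt_mem {S : ℝ} (hS : 0 ≤ S) : S / √(1 + S ^ 2) ∈ Ico (0 : ℝ) 1 := by
  refine ⟨by positivity, ?_⟩
  rw [div_lt_one (by positivity)]
  exact Real.lt_sqrt_of_sq_lt (by linarith)

theorem exists_div_sqrt_eq {τ : ℝ} (hτ : τ ∈ Ico (0 : ℝ) 1) :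
    ∃ S, 0 ≤ S ∧ S / √(1 + S ^ 2) = τ := by
  have h : 0 < 1 - τ ^ 2 := by nlinarith [hτ.1, hτ.2]
  have hτ0 := hτ.1
  refine ⟨τ / √(1 - τ ^ 2), by positivity, ?_⟩
  have : 1 + (τ / √(1 - τ ^ 2)) ^ 2 = (1 / √(1 - τ ^ 2)) ^ 2 := by
    rw [div_pow, div_pow, Real.sq_sqrt h.le]; field_simp; ring
  rw [this, Real.sqrt_sq (by positivity)]
  field_simp

/-- The radial function of the extension on the equatorial disc, in the coordinate `sinh` of the
hyperbolic distance to the origin. -/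
theorem exists_radial {d : ℕ} (hd : 1 ≤ d) : ∃ σ : ℝ → ℝ, StrictMonoOn σ (Ici 0) ∧
    BijOn σ (Ici 0) (Ici 0) ∧ ∀ S, 0 ≤ S → axisMean d S (σ S / √(1 + σ S ^ 2)) = 0 := by
  have hex : ∀ S : ℝ, ∃ S', 0 ≤ S → 0 ≤ S' ∧ axisMean d S (S' / √(1 + S' ^ 2)) = 0 := by
    intro S
    by_cases hS : 0 ≤ S
    · obtain ⟨τ, hτ, h⟩ := exists_axisMean_eq_zero_right hd hS
      obtain ⟨S', hS', rfl⟩ := exists_div_sqrt_eq hτ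
      exact ⟨S', fun _ => ⟨hS', h⟩⟩
    · exact ⟨0, fun h => absurd h hS⟩
  choose σ hσ using hex
  have hmono : StrictMonoOn σ (Ici 0) := by
    intro S hS S' hS' h
    have h1 := hσ S hS
    have h2 := hσ S' hS'
    by_contra hle
    have h3 := div_sqrt_strictMonoOn.monotoneOn h2.1 h1.1 (not_lt.1 hle)
    have h4 := axisMean_strictMono hd (div_sqrt_mem h1.1).1 (div_sqrt_mem h1.1).2 hS h
    rcases h3.eq_or_lt with h5 | h5
    · rw [← h5] at h4; rw [h2.2, h5, h1.2] at h4; exact lt_irrefl _ h4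
    · have h6 := axisMean_strictAnti hd S' (div_sqrt_mem h2.1).1 h5 (div_sqrt_mem h1.1).2
      linarith [h1.2, h2.2]
  refine ⟨σ, hmono, ⟨fun S hS => (hσ S hS).1, hmono.injOn, fun S' hS' => ?_⟩,
    fun S hS => (hσ S hS).2⟩
  obtain ⟨S, hS, h⟩ := exists_axisMean_eq_zero_left hd (div_sqrt_mem hS')
  refine ⟨S, hS, ?_⟩
  have h1 := hσ S hS
  rcases lt_trichotomy (σ S) S' with h2 | h2 | h2
  · have := axisMean_strictAnti hd S (div_sqrt_mem h1.1).1 (div_sqrt_strictMonoOn h1.1 hS' h2)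
      (div_sqrt_mem hS').2
    linarith [h1.2]
  · exact h2
  · have := axisMean_strictAnti hd S (div_sqrt_mem hS').1 (div_sqrt_strictMonoOn hS' h1.1 h2)
      (div_sqrt_mem h1.1).2
    linarith [h1.2]

/-! ### Symmetries -/

/-- The space part of the point of the hyperboloid that lies over `ξ` in the geodesic disc at
hyperbolic height `-L`. For fixed `L` these points form the slice of the hyperboloid by a
time-like linear hyperplane, hence a totally geodesic surface. -/
noncomputable def discHyp (L : ℝ) (ξ : ℂ) : E3 := !₂[ξ.re, ξ.im, -(√(1 + ‖ξ‖ ^ 2) * Real.sinh L)]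

theorem lift_discHyp (L : ℝ) (ξ : ℂ) : lift (discHyp L ξ) = √(1 + ‖ξ‖ ^ 2) * Real.cosh L := by
  have hc := Real.cosh_pos L
  rw [lift, Real.sqrt_eq_iff_mul_self_eq_of_pos (by positivity), EuclideanSpace.norm_sq_eq]
  have hz : ‖ξ‖ ^ 2 = ξ.re ^ 2 + ξ.im ^ 2 := by
    rw [← Complex.normSq_eq_norm_sq, Complex.normSq_apply]; ring
  have hs := Real.sq_sqrt (show 0 ≤ 1 + ‖ξ‖ ^ 2 by positivity)
  simp only [Fin.sum_univ_three, discHyp, Matrix.cons_val, Real.norm_eq_abs, sq_abs]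
  linear_combination (Real.cosh L ^ 2 - Real.sinh L ^ 2) * hs +
    (1 + ‖ξ‖ ^ 2) * Real.cosh_sq L + hz

theorem norm_polar (S θ : ℝ) : ‖(S : ℂ) * Complex.exp (θ * Complex.I)‖ ^ 2 = S ^ 2 := by
  rw [norm_mul, Complex.norm_exp_ofReal_mul_I, mul_one, Complex.norm_real, Real.norm_eq_abs, sq_abs]

theorem polar_re (S θ : ℝ) : ((S : ℂ) * Complex.exp (θ * Complex.I)).re = S * Real.cos θ := by
  rw [Complex.re_ofReal_mul, Complex.exp_ofReal_mul_I_re]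

theorem polar_im (S θ : ℝ) : ((S : ℂ) * Complex.exp (θ * Complex.I)).im = S * Real.sin θ := by
  rw [Complex.im_ofReal_mul, Complex.exp_ofReal_mul_I_im]

theorem inner_discHyp (L : ℝ) (ξ : ℂ) (x : E3) :
    inner ℝ (discHyp L ξ) x = ξ.re * x 0 + ξ.im * x 1 - √(1 + ‖ξ‖ ^ 2) * Real.sinh L * x 2 := by
  simp only [PiLp.inner_apply, Fin.sum_univ_three, discHyp, Matrix.cons_val, RCLike.inner_apply,
    conj_trivial]
  ring

theorem cosh_mul_pairing_discHyp (L S θ : ℝ) (p : ℝ × ℝ) :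
    Real.cosh p.1 * pairing (discHyp L (S * Complex.exp (θ * Complex.I))) (cyl p) =
      √(1 + S ^ 2) * Real.cosh (p.1 - L) - S * Real.cos (p.2 - θ) := by
  have hc := (Real.cosh_pos p.1).ne'
  rw [pairing, lift_discHyp, inner_discHyp, norm_polar, polar_re, polar_im, cyl_zero, cyl_one,
    cyl_two, Real.tanh_eq_sinh_div_cosh, Real.cosh_sub, Real.cos_sub]
  field_simp
  ring

theorem cyl_add_two_pi (v θ : ℝ) (n : ℕ) : cyl (v, θ + n * (2 * Real.pi)) = cyl (v, θ) := by
  simp only [cyl, Real.cos_add_nat_mul_two_pi, Real.sin_add_nat_mul_two_pi]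

theorem integral_pushEta {d : ℕ} (hd : 1 ≤ d) (P : E3) {F : S2 → ℝ} (hF : Continuous F) :
    ∫ ζ, F ζ ∂pushEta d P = ∫ v : ℝ, ∫ θ in -Real.pi..Real.pi, F (cyl (d * v, d * θ)) *
      (1 / (4 * Real.pi * (Real.cosh v * pairing P (cyl (v, θ))) ^ 2)) := by
  rw [pushEta, integral_map (continuous_hat_powMap hd).measurable.aemeasurable
    hF.aestronglyMeasurable]
  refine (integral_eta_eq
    (integrable_of_continuous_sphere (hF.comp (continuous_hat_powMap hd)))).trans ?_
  simp only [Function.comp, hat_powMap_cyl]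

/-- Rotations about the third axis and translations along it act on the harmonic measures, and the
power map intertwines them with rotations and translations. -/
theorem integral_pushEta_polar {d : ℕ} (hd : 1 ≤ d) (L S θ₀ : ℝ) {F G : S2 → ℝ}
    (hF : Continuous F) (hG : Continuous G)
    (h : ∀ x y, F (cyl (x + d * L, y + d * θ₀)) = G (cyl (x, y))) :
    ∫ ζ, F ζ ∂pushEta d (discHyp L (S * Complex.exp (θ₀ * Complex.I))) =
      ∫ ζ, G ζ ∂pushEta d (S • e1) := by
  rw [integral_pushEta hd _ hF, integral_pushEta hd _ hG, ← integral_add_right_eq_self _ L]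
  refine integral_congr_ae (ae_of_all _ fun v => ?_)
  simp only
  have e : ∀ θ, Real.cosh (v + L) * pairing (discHyp L (S * Complex.exp (θ₀ * Complex.I)))
      (cyl (v + L, θ)) = √(1 + S ^ 2) * Real.cosh v - S * Real.cos (θ - θ₀) := by
    intro θ
    rw [cosh_mul_pairing_discHyp L S θ₀ (v + L, θ)]
    simp only [add_sub_cancel_right]
  have e' : ∀ θ, Real.cosh v * pairing (S • e1) (cyl (v, θ)) =
      √(1 + S ^ 2) * Real.cosh v - S * Real.cos θ := fun θ => cosh_mul_pairing_e1 S (v, θ)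
  simp_rw [e, e']
  have hper : Function.Periodic (fun θ => F (cyl (d * (v + L), d * θ)) *
      (1 / (4 * Real.pi * (√(1 + S ^ 2) * Real.cosh v - S * Real.cos (θ - θ₀)) ^ 2)))
      (2 * Real.pi) := by
    intro θ
    simp only
    rw [mul_add (d : ℝ) θ, cyl_add_two_pi, show θ + 2 * Real.pi - θ₀ = θ - θ₀ + 2 * Real.pi by ring,
      Real.cos_add_two_pi]
  have h2 := hper.intervalIntegral_add_eq (-Real.pi) (-Real.pi + θ₀)
  rw [show -Real.pi + 2 * Real.pi = Real.pi by ring,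
    show -Real.pi + θ₀ + 2 * Real.pi = Real.pi + θ₀ by ring,
    ← intervalIntegral.integral_comp_add_right] at h2
  rw [h2]
  refine intervalIntegral.integral_congr fun θ _ => ?_
  simp only [add_sub_cancel_right]
  rw [mul_add, mul_add, h]

theorem integral_pushEta_polar_comb {d : ℕ} (hd : 1 ≤ d) (L S θ₀ : ℝ) {F f g : S2 → ℝ}
    (hF : Continuous F) (hf : Continuous f) (hg : Continuous g) (a b : ℝ)
    (h : ∀ x y, F (cyl (x + d * L, y + d * θ₀)) = a * f (cyl (x, y)) + b * g (cyl (x, y))) :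
    ∫ ζ, F ζ ∂pushEta d (discHyp L (S * Complex.exp (θ₀ * Complex.I))) =
      a * ∫ ζ, f ζ ∂pushEta d (S • e1) + b * ∫ ζ, g ζ ∂pushEta d (S • e1) := by
  have := isProbabilityMeasure_pushEta hd (S • e1)
  rw [integral_pushEta_polar hd L S θ₀ (G := fun ζ => a * f ζ + b * g ζ) hF (by fun_prop) h,
    integral_add ((integrable_of_continuous_sphere hf).const_mul a)
      ((integrable_of_continuous_sphere hg).const_mul b), integral_const_mul, integral_const_mul]

/-- Centers on the first axis are fixed by the reflection in the plane `x₃ = 0`. -/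
theorem integral_axis_eq_zero_of_odd_fst {d : ℕ} (hd : 1 ≤ d) (S : ℝ) {F : S2 → ℝ}
    (hF : Continuous F) (h : ∀ x y, F (cyl (-x, y)) = -F (cyl (x, y))) :
    ∫ ζ, F ζ ∂pushEta d (S • e1) = 0 := by
  rw [integral_pushEta hd _ hF]
  have e' : ∀ v θ, Real.cosh v * pairing (S • e1) (cyl (v, θ)) =
      √(1 + S ^ 2) * Real.cosh v - S * Real.cos θ := fun v θ => cosh_mul_pairing_e1 S (v, θ)
  simp_rw [e']
  rw [← neg_eq_self, ← integral_neg, ← integral_neg_eq_self]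
  refine integral_congr_ae (ae_of_all _ fun v => ?_)
  simp only [Real.cosh_neg, mul_neg, h, neg_mul, intervalIntegral.integral_neg, neg_neg]

/-- Centers on the first axis are fixed by the reflection in the plane `x₂ = 0`. -/
theorem integral_axis_eq_zero_of_odd_snd {d : ℕ} (hd : 1 ≤ d) (S : ℝ) {F : S2 → ℝ}
    (hF : Continuous F) (h : ∀ x y, F (cyl (x, -y)) = -F (cyl (x, y))) :
    ∫ ζ, F ζ ∂pushEta d (S • e1) = 0 := by
  rw [integral_pushEta hd _ hF]
  have e' : ∀ v θ, Real.cosh v * pairing (S • e1) (cyl (v, θ)) =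
      √(1 + S ^ 2) * Real.cosh v - S * Real.cos θ := fun v θ => cosh_mul_pairing_e1 S (v, θ)
  simp_rw [e']
  refine integral_eq_zero_of_ae (ae_of_all _ fun v => ?_)
  simp only [Pi.zero_apply]
  have h1 := intervalIntegral.integral_comp_neg (a := -Real.pi) (b := Real.pi) fun θ =>
    F (cyl (d * v, d * θ)) * (1 / (4 * Real.pi * (√(1 + S ^ 2) * Real.cosh v - S * Real.cos θ) ^ 2))
  rw [neg_neg] at h1
  rw [← neg_eq_self, ← intervalIntegral.integral_neg, ← h1]
  refine intervalIntegral.integral_congr fun θ _ => ?_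
  simp only [mul_neg, h, Real.cos_neg, neg_mul]

theorem pairing_inv_cyl (P : E3) (p : ℝ × ℝ) :
    (pairing P (cyl p))⁻¹ = Real.cosh p.1 / (Real.cosh p.1 * pairing P (cyl p)) := by
  have := (Real.cosh_pos p.1).ne'
  have := (pairing_pos P (cyl p)).ne'
  field_simp

theorem pairing_inv_mul_two (P : E3) (p : ℝ × ℝ) :
    (pairing P (cyl p))⁻¹ * (cyl p : E3) 2 =
      -Real.sinh p.1 / (Real.cosh p.1 * pairing P (cyl p)) := by
  have := (Real.cosh_pos p.1).ne'
  have := (pairing_pos P (cyl p)).ne'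
  rw [cyl_two, Real.tanh_eq_sinh_div_cosh]
  field_simp

theorem pairing_inv_mul_zero (P : E3) (p : ℝ × ℝ) :
    (pairing P (cyl p))⁻¹ * (cyl p : E3) 0 =
      Real.cos p.2 / (Real.cosh p.1 * pairing P (cyl p)) := by
  have := (Real.cosh_pos p.1).ne'
  have := (pairing_pos P (cyl p)).ne'
  rw [cyl_zero]
  field_simp

theorem pairing_inv_mul_one (P : E3) (p : ℝ × ℝ) :
    (pairing P (cyl p))⁻¹ * (cyl p : E3) 1 =
      Real.sin p.2 / (Real.cosh p.1 * pairing P (cyl p)) := by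
  have := (Real.cosh_pos p.1).ne'
  have := (pairing_pos P (cyl p)).ne'
  rw [cyl_one]
  field_simp

theorem continuous_pairing_inv_mul (P : E3) (i : Fin 3) :
    Continuous fun ζ : S2 => (pairing P ζ)⁻¹ * (ζ : E3) i :=
  (continuous_pairing_inv P).mul (by fun_prop)

theorem isMoment_of_coords {μ : Measure S2} [IsProbabilityMeasure μ] {P : E3}
    (h : ∫ ζ : S2, (pairing P ζ)⁻¹ ∂μ = lift P)
    (hi : ∀ i, ∫ ζ : S2, (pairing P ζ)⁻¹ * (ζ : E3) i ∂μ = P i) : IsMoment μ P := by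
  refine ⟨?_, h⟩
  have h2 : Integrable (fun ζ : S2 => (pairing P ζ)⁻¹ • (ζ : E3)) μ :=
    integrable_of_continuous_sphere ((continuous_pairing_inv P).smul continuous_subtype_val)
  ext i
  have := (EuclideanSpace.proj (𝕜 := ℝ) i : E3 →L[ℝ] ℝ).integral_comp_comm h2
  exact this.symm.trans (hi i)

/-- The moments on the first axis: the components in the second and third directions vanish by
symmetry, and the remaining ones are determined by the vanishing of `axisMean`. -/
theorem axis_moments {d : ℕ} (hd : 1 ≤ d) {S S' : ℝ}
    (h : axisMean d S (S' / √(1 + S' ^ 2)) = 0) :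
    (∫ ζ : S2, (pairing (S' • e1) ζ)⁻¹ ∂pushEta d (S • e1) = √(1 + S' ^ 2)) ∧
    (∫ ζ : S2, (pairing (S' • e1) ζ)⁻¹ * (ζ : E3) 0 ∂pushEta d (S • e1) = S') ∧
    (∫ ζ : S2, (pairing (S' • e1) ζ)⁻¹ * (ζ : E3) 1 ∂pushEta d (S • e1) = 0) ∧
    (∫ ζ : S2, (pairing (S' • e1) ζ)⁻¹ * (ζ : E3) 2 ∂pushEta d (S • e1) = 0) := by
  have := isProbabilityMeasure_pushEta hd (S • e1)
  have hc := continuous_pairing_inv (S' • e1)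
  have hci := continuous_pairing_inv_mul (S' • e1)
  have hA : 0 < √(1 + S' ^ 2) := by positivity
  have hA2 : √(1 + S' ^ 2) ^ 2 = 1 + S' ^ 2 := Real.sq_sqrt (by positivity)
  have key := lift_mul_sub_inner (μ := pushEta d (S • e1)) (S' • e1)
  have hint : Integrable (fun ζ : S2 => (pairing (S' • e1) ζ)⁻¹ • (ζ : E3)) (pushEta d (S • e1)) :=
    integrable_of_continuous_sphere (hc.smul continuous_subtype_val)
  have hcoord : inner ℝ (S' • e1)
      (∫ ζ : S2, (pairing (S' • e1) ζ)⁻¹ • (ζ : E3) ∂pushEta d (S • e1)) =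
      S' * ∫ ζ : S2, (pairing (S' • e1) ζ)⁻¹ * (ζ : E3) 0 ∂pushEta d (S • e1) := by
    rw [real_inner_smul_left, ← integral_inner hint]
    simp only [inner_e1, PiLp.smul_apply, smul_eq_mul]
  rw [hcoord, lift_smul_e1] at key
  have hprof : ∀ u : ℝ, profile (S' / √(1 + S' ^ 2)) u =
      (√(1 + S' ^ 2) * u - S') / (√(1 + S' ^ 2) - S' * u) := by
    intro u
    rw [profile, ← mul_div_mul_left _ _ hA.ne']
    congr 1 <;> field_simp
  have hzero : √(1 + S' ^ 2) * ∫ ζ : S2, (pairing (S' • e1) ζ)⁻¹ * (ζ : E3) 0 ∂pushEta d (S • e1) =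
      S' * ∫ ζ : S2, (pairing (S' • e1) ζ)⁻¹ ∂pushEta d (S • e1) := by
    rw [← sub_eq_zero, ← integral_const_mul, ← integral_const_mul,
      ← integral_sub ((integrable_of_continuous_sphere (hci 0)).const_mul _)
      ((integrable_of_continuous_sphere hc).const_mul _), ← h, axisMean, pushEta]
    refine (integral_map (continuous_hat_powMap hd).measurable.aemeasurable
      (((hci 0).const_mul _).sub (hc.const_mul _)).aestronglyMeasurable).trans ?_
    refine integral_congr_ae (ae_of_all _ fun ζ => ?_)
    simp only [hprof, Pi.sub_apply, pairing, lift_smul_e1, real_inner_smul_left, inner_e1]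
    ring
  set a := ∫ ζ : S2, (pairing (S' • e1) ζ)⁻¹ ∂pushEta d (S • e1)
  set b := ∫ ζ : S2, (pairing (S' • e1) ζ)⁻¹ * (ζ : E3) 0 ∂pushEta d (S • e1)
  have ha : a = √(1 + S' ^ 2) := by
    linear_combination √(1 + S' ^ 2) * key + S' * hzero - a * hA2
  refine ⟨ha, ?_, integral_axis_eq_zero_of_odd_snd hd S (hci 1) fun x y => ?_,
    integral_axis_eq_zero_of_odd_fst hd S (hci 2) fun x y => ?_⟩
  · rw [ha] at hzero
    exact mul_left_cancel₀ hA.ne' (hzero.trans (mul_comm _ _))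
  · rw [pairing_inv_mul_one, pairing_inv_mul_one, cosh_mul_pairing_e1, cosh_mul_pairing_e1]
    simp only [Real.sin_neg, Real.cos_neg, neg_div]
  · rw [pairing_inv_mul_two, pairing_inv_mul_two, cosh_mul_pairing_e1, cosh_mul_pairing_e1]
    simp only [Real.sinh_neg, Real.cosh_neg, neg_div, neg_neg]

/-- The moment equation is equivariant under rotations about the third axis and translations along
it, which act on the moments by the corresponding Lorentz transformations. -/
theorem isMoment_polar {d : ℕ} (hd : 1 ≤ d) {S S' : ℝ}
    (h : axisMean d S (S' / √(1 + S' ^ 2)) = 0) (L θ : ℝ) :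
    IsMoment (pushEta d (discHyp L (S * Complex.exp (θ * Complex.I))))
      (discHyp (d * L) (S' * Complex.exp ((d * θ : ℝ) * Complex.I))) := by
  have := isProbabilityMeasure_pushEta hd (discHyp L (S * Complex.exp (θ * Complex.I)))
  have := isProbabilityMeasure_pushEta hd (S • e1)
  obtain ⟨h0, h1, h2, h3⟩ := axis_moments hd h
  set Q := discHyp (d * L) (S' * Complex.exp ((d * θ : ℝ) * Complex.I)) with hQ
  have hden : ∀ x y : ℝ, Real.cosh (x + d * L) * pairing Q (cyl (x + d * L, y + d * θ)) =
      Real.cosh x * pairing (S' • e1) (cyl (x, y)) := by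
    intro x y
    rw [hQ, cosh_mul_pairing_discHyp _ _ _ (x + d * L, y + d * θ), cosh_mul_pairing_e1 _ (x, y)]
    simp only [add_sub_cancel_right]
  have hc := continuous_pairing_inv (S' • e1)
  have hci := continuous_pairing_inv_mul (S' • e1)
  have hQc := continuous_pairing_inv Q
  have hQci := continuous_pairing_inv_mul Q
  refine isMoment_of_coords ?_ fun i => ?_
  · rw [integral_pushEta_polar_comb hd L S θ hQc hc (hci 2) (Real.cosh (d * L)) (-Real.sinh (d * L))
      fun x y => ?_]
    · rw [h0, h3, hQ, lift_discHyp, norm_polar]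
      ring
    · rw [pairing_inv_mul_two, pairing_inv_cyl, pairing_inv_cyl, hden, Real.cosh_add]
      ring
  · fin_cases i
    · simp only [Fin.zero_eta]
      rw [integral_pushEta_polar_comb hd L S θ (hQci 0) (hci 0) (hci 1) (Real.cos (d * θ))
        (-Real.sin (d * θ)) fun x y => ?_]
      · rw [h1, h2]
        change _ = (S' * Complex.exp ((d * θ : ℝ) * Complex.I)).re
        rw [polar_re]
        ring
      · rw [pairing_inv_mul_zero, hden, pairing_inv_mul_zero, pairing_inv_mul_one, Real.cos_add]
        ring
    · simp only [Fin.mk_one]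
      rw [integral_pushEta_polar_comb hd L S θ (hQci 1) (hci 0) (hci 1) (Real.sin (d * θ))
        (Real.cos (d * θ)) fun x y => ?_]
      · rw [h1, h2]
        change _ = (S' * Complex.exp ((d * θ : ℝ) * Complex.I)).im
        rw [polar_im]
        ring
      · rw [pairing_inv_mul_one, hden, pairing_inv_mul_zero, pairing_inv_mul_one, Real.sin_add]
        ring
    · simp only [Fin.reduceFinMk]
      rw [integral_pushEta_polar_comb hd L S θ (hQci 2) (hci 2) hc (Real.cosh (d * L))
        (-Real.sinh (d * L)) fun x y => ?_]
      · rw [h0, h3]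
        change _ = -(√(1 + ‖(S' * Complex.exp ((d * θ : ℝ) * Complex.I))‖ ^ 2) * Real.sinh (d * L))
        rw [norm_polar]
        ring
      · rw [pairing_inv_mul_two, hden, pairing_inv_mul_two, pairing_inv_cyl, Real.sinh_add]
        ring

/-- The parametrization of the geodesic disc at height `-L` by the complex plane. -/
noncomputable def discPoint (L : ℝ) (ξ : ℂ) : E3 := ballPoint (discHyp L ξ)

theorem douadyEarle_discPoint {d : ℕ} (hd : 1 ≤ d) {S S' : ℝ}
    (h : axisMean d S (S' / √(1 + S' ^ 2)) = 0) (L θ : ℝ) :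
    douadyEarle (hat (powMap d)) (discPoint L (S * Complex.exp (θ * Complex.I))) =
      discPoint (d * L) (S' * Complex.exp ((d * θ : ℝ) * Complex.I)) := by
  have := isProbabilityMeasure_pushEta hd (discHyp L (S * Complex.exp (θ * Complex.I)))
  have := nullSingletonClass_pushEta hd (discHyp L (S * Complex.exp (θ * Complex.I)))
  rw [douadyEarle, discPoint, dif_pos (norm_ballPoint_lt _)]
  exact (isMoment_polar hd h L θ).barycenter_eq

/-! ### The geodesic discs -/

theorem hat_homothety_image_unitCircle {t : ℝ} (ht : 0 < t) :
    hat (homothety t) '' unitCircle = {y : S2 | (y : E3) 2 = -Real.tanh (Real.log t)} := by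
  ext y
  constructor
  · rintro ⟨x, hx, rfl⟩
    have hx2 : (x : E3) 2 = 0 := hx
    rcases sphere_cases x with rfl | rfl | ⟨p, rfl⟩
    · simp [southPole, e3] at hx2
    · simp [northPole, e3] at hx2
    · rw [cyl_two, neg_eq_zero, Real.tanh_eq_sinh_div_cosh, div_eq_zero_iff,
        or_iff_left (Real.cosh_pos _).ne', Real.sinh_eq_zero] at hx2
      rw [mem_ofPred_eq, hat_homothety_cyl ht, cyl_two, hx2, zero_add]
  · intro hy
    have hy2 : (y : E3) 2 = -Real.tanh (Real.log t) := hy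
    have h1 := Real.abs_tanh_lt_one (Real.log t)
    rcases sphere_cases y with rfl | rfl | ⟨p, rfl⟩
    · rw [show (southPole : E3) 2 = -1 by simp [southPole, e3]] at hy2
      rw [← neg_injective hy2] at h1
      norm_num at h1
    · rw [show (northPole : E3) 2 = 1 by simp [northPole, e3]] at hy2
      rw [← neg_eq_iff_eq_neg.2 hy2] at h1
      norm_num at h1
    · rw [cyl_two, neg_inj, Real.tanh_injective.eq_iff] at hy2
      refine ⟨cyl (0, p.2), by simp [unitCircle], ?_⟩
      rw [hat_homothety_cyl ht, zero_add, ← hy2]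

theorem inner_eq_coords (n x : E3) : inner ℝ n x = n 0 * x 0 + n 1 * x 1 + n 2 * x 2 := by
  simp only [PiLp.inner_apply, Fin.sum_univ_three, RCLike.inner_apply, conj_trivial]
  ring

/-- The plane that cuts out a circle of latitude is unique, so that the equation of the geodesic
disc does not depend on the choice of the normal vector. -/
theorem mem_discD_iff {t : ℝ} (ht : 0 < t) (x : E3) :
    x ∈ discD t ↔ ‖x‖ < 1 ∧ 2 * x 2 = -Real.tanh (Real.log t) * (1 + ‖x‖ ^ 2) := by
  rw [discD, geodesicDisc, hat_homothety_image_unitCircle ht]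
  set v := Real.log t
  refine and_congr_right fun _ => ⟨?_, fun h => ?_⟩
  · rintro ⟨n, c, hn, -, hC, hx⟩
    have hcirc : ∀ θ, inner ℝ n (cyl (v, θ) : E3) = c := fun θ => by
      have : cyl (v, θ) ∈ {y : S2 | (y : E3) 2 = -Real.tanh v} := rfl
      rw [hC] at this
      exact this
    have hc := Real.cosh_pos v
    have h0 := hcirc 0
    have h1 := hcirc Real.pi
    have h2 := hcirc (Real.pi / 2)
    simp only [inner_eq_coords, cyl_zero, cyl_one, cyl_two, Real.cos_zero, Real.sin_zero,
      Real.cos_pi, Real.sin_pi, Real.cos_pi_div_two, Real.sin_pi_div_two] at h0 h1 h2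
    have hn0 : n 0 = 0 := by
      have : n 0 * (1 / Real.cosh v) = 0 := by linear_combination (h0 - h1) / 2
      exact (mul_eq_zero.1 this).resolve_right (by positivity)
    have hn1 : n 1 = 0 := by
      have : n 1 * (1 / Real.cosh v) = 0 := by linear_combination h2 - (h0 + h1) / 2
      exact (mul_eq_zero.1 this).resolve_right (by positivity)
    have hn2 : n 2 ≠ 0 := by
      intro hn2
      have : n = 0 := by ext i; fin_cases i <;> assumption
      rw [this, norm_zero] at hn
      exact zero_ne_one hn
    rw [inner_eq_coords, hn0, hn1] at hx
    refine mul_left_cancel₀ hn2 ?_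
    linear_combination hx - (h0 + h1) / 2 * (1 + ‖x‖ ^ 2)
  · refine ⟨e3, -Real.tanh v, norm_e3, by rw [abs_neg]; exact Real.abs_tanh_lt_one v, ?_, ?_⟩
    · simp [e3, EuclideanSpace.inner_single_left]
    · rw [← h]
      simp [e3, EuclideanSpace.inner_single_left]

theorem one_add_norm_sq_ballPoint (P : E3) : 1 + ‖ballPoint P‖ ^ 2 = 2 * lift P / (1 + lift P) := by
  have := lift_pos P
  rw [norm_sq_ballPoint]
  field_simp
  ring

/-- The slice of the hyperboloid by the hyperplane `p₃ = -tanh L p₀` is a graph over the plane of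
the first two coordinates. -/
theorem eq_discHyp {L : ℝ} {P : E3} (h : P 2 = -Real.tanh L * lift P) :
    P = discHyp L ⟨P 0, P 1⟩ := by
  have hc := Real.cosh_pos L
  have h1 := lift_sq P
  have hn : ‖P‖ ^ 2 = P 0 ^ 2 + P 1 ^ 2 + P 2 ^ 2 := by
    rw [EuclideanSpace.norm_sq_eq]; simp [Fin.sum_univ_three]
  have hz : ‖(⟨P 0, P 1⟩ : ℂ)‖ ^ 2 = P 0 ^ 2 + P 1 ^ 2 := by
    rw [← Complex.normSq_eq_norm_sq, Complex.normSq_apply]; ring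
  have hs := Real.sq_sqrt (show 0 ≤ 1 + ‖(⟨P 0, P 1⟩ : ℂ)‖ ^ 2 by positivity)
  set s := √(1 + ‖(⟨P 0, P 1⟩ : ℂ)‖ ^ 2) with hsdef
  rw [Real.tanh_eq_sinh_div_cosh] at h
  have h' : P 2 * Real.cosh L = -Real.sinh L * lift P := by rw [h]; field_simp
  have h2 : lift P = s * Real.cosh L := by
    refine (sq_eq_sq₀ (lift_pos P).le (by positivity)).1 ?_
    have hcs := Real.cosh_sq L
    have : (lift P ^ 2 - (s * Real.cosh L) ^ 2) = 0 := by
      have e : Real.cosh L ^ 2 * lift P ^ 2 = Real.cosh L ^ 2 * s ^ 2 +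
          Real.sinh L ^ 2 * lift P ^ 2 := by
        rw [hs, hz, h1, hn]
        have h3 : P 2 ^ 2 * Real.cosh L ^ 2 = Real.sinh L ^ 2 * (1 + ‖P‖ ^ 2) := by
          rw [← h1, ← mul_pow, h']; ring
        rw [hn] at h3
        linear_combination h3
      linear_combination e - lift P ^ 2 * hcs
    linarith
  have h3 : P 2 = -(s * Real.sinh L) := by
    rw [h2] at h'
    refine mul_right_cancel₀ hc.ne' ?_
    linear_combination h'
  ext i
  fin_cases i
  · rfl
  · rfl
  · exact h3

theorem discHyp_two (L : ℝ) (ξ : ℂ) : discHyp L ξ 2 = -Real.tanh L * lift (discHyp L ξ) := by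
  have hc := Real.cosh_pos L
  rw [lift_discHyp, Real.tanh_eq_sinh_div_cosh]
  change -(√(1 + ‖ξ‖ ^ 2) * Real.sinh L) = _
  field_simp

theorem ballPoint_mem_discD_iff {t : ℝ} (ht : 0 < t) (P : E3) :
    ballPoint P ∈ discD t ↔ P 2 = -Real.tanh (Real.log t) * lift P := by
  have hl := lift_pos P
  rw [mem_discD_iff ht, and_iff_right (norm_ballPoint_lt P), one_add_norm_sq_ballPoint, ballPoint,
    PiLp.smul_apply, smul_eq_mul]
  constructor
  · intro h
    field_simp at h
    linarith
  · intro h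
    rw [h]
    field_simp

theorem continuous_discHyp (L : ℝ) : Continuous (discHyp L) := by
  refine (PiLp.continuous_toLp 2 _).comp (continuous_pi fun i => ?_)
  fin_cases i
  · exact Complex.continuous_re
  · exact Complex.continuous_im
  · simp only [Fin.reduceFinMk, Matrix.cons_val]
    fun_prop

/-- The parametrization of the geodesic disc by the complex plane, as a homeomorphism. -/
noncomputable def discHomeomorph {t : ℝ} (ht : 0 < t) : ℂ ≃ₜ discD t where
  toFun ξ := ⟨discPoint (Real.log t) ξ, (ballPoint_mem_discD_iff ht _).2 (discHyp_two _ ξ)⟩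
  invFun x := ⟨hypPoint x 0, hypPoint x 1⟩
  left_inv ξ := by
    simp only [discPoint, hypPoint_ballPoint]
    rfl
  right_inv x := by
    have hx := ((mem_discD_iff ht _).1 x.2).1
    have h := x.2
    rw [← ballPoint_hypPoint hx, ballPoint_mem_discD_iff ht] at h
    refine Subtype.ext ?_
    simp only [discPoint]
    rw [← eq_discHyp h, ballPoint_hypPoint hx]
  continuous_toFun := (continuous_ballPoint.comp (continuous_discHyp _)).subtype_mk _
  continuous_invFun := by
    have hc : Continuous fun x : discD t => hypPoint x := by
      have hd : Continuous fun x : discD t => 1 - ‖(x : E3)‖ ^ 2 := by fun_prop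
      refine (continuous_const.div hd fun x => ?_).smul continuous_subtype_val
      have hx := ((mem_discD_iff ht _).1 x.2).1
      have : 0 < 1 - ‖(x : E3)‖ ^ 2 := by nlinarith [norm_nonneg (x : E3)]
      exact this.ne'
    have : (fun x : discD t => (⟨hypPoint x 0, hypPoint x 1⟩ : ℂ)) =
        fun x : discD t => ((hypPoint x 0 : ℝ) : ℂ) + ((hypPoint x 1 : ℝ) : ℂ) * Complex.I := by
      ext1 x; apply Complex.ext <;> simp
    have hi : ∀ i, Continuous fun x : discD t => hypPoint x i := fun i =>
      (by fun_prop : Continuous fun y : E3 => y i).comp hc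
    rw [this]
    exact (Complex.continuous_ofReal.comp (hi 0)).add
      ((Complex.continuous_ofReal.comp (hi 1)).mul continuous_const)

theorem coe_discHomeomorph {t : ℝ} (ht : 0 < t) (ξ : ℂ) :
    (discHomeomorph ht ξ : E3) = discPoint (Real.log t) ξ := rfl

/-! ### Ramified coverings -/

theorem IsRamifiedCovering.comp_homeomorph {X X' Y Y' : Type*} [TopologicalSpace X]
    [TopologicalSpace X'] [TopologicalSpace Y] [TopologicalSpace Y'] {p : X → Y} {d : ℕ}
    (hp : IsRamifiedCovering p d) (e : X' ≃ₜ X) (f : Y ≃ₜ Y') :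
    IsRamifiedCovering (f ∘ p ∘ e) d := by
  refine ⟨f.continuous.comp (hp.1.comp e.continuous), fun y => ?_⟩
  obtain ⟨ψ, m, k, φ, hy, hy0, hψ, hφ, hdisj, hpre, hk, hsum, hmap⟩ := hp.2 (f.symm y)
  refine ⟨f.symm.transOpenPartialHomeomorph ψ, m, k, fun i => e.transOpenPartialHomeomorph (φ i),
    hy, hy0, hψ, hφ, fun i j hij => (hdisj hij).preimage e, ?_, hk, hsum, fun i x hx => ?_⟩
  · ext x
    have := Set.ext_iff.1 hpre (e x)
    simpa using this
  · simpa using hmap i (e x) hx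

theorem surjective_pow {d : ℕ} (hd : 1 ≤ d) : Function.Surjective fun z : ℂ => z ^ d := fun y =>
  IsAlgClosed.exists_pow_nat_eq y hd

theorem card_preimage_pow {d : ℕ} (hd : 1 ≤ d) {y : ℂ} (hy : y ≠ 0) :
    Nonempty (((fun z : ℂ => z ^ d) ⁻¹' {y}) ≃ Fin d) := by
  have hζ := Complex.isPrimitiveRoot_exp d (by omega)
  have hcard : (Polynomial.nthRoots d y).toFinset.card = d := by
    rw [Multiset.toFinset_card_of_nodup (hζ.nthRoots_nodup hy), hζ.card_nthRoots,
      if_pos (surjective_pow hd y)]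
  have hset : ((fun z : ℂ => z ^ d) ⁻¹' {y}) = ((Polynomial.nthRoots d y).toFinset : Set ℂ) := by
    ext z
    simp [Polynomial.mem_nthRoots (by omega : 0 < d)]
  rw [hset]
  exact ⟨Finset.equivFinOfCardEq hcard⟩

/-- The affine chart that maps the disc with center `y` and radius `ε` to the unit disc. -/
noncomputable def affineChart (y : ℂ) {ε : ℝ} (hε : 0 < ε) : OpenPartialHomeomorph ℂ ℂ where
  toFun z := (z - y) / ε
  invFun w := y + ε * w
  source := (fun z => (z - y) / (ε : ℂ)) ⁻¹' ball 0 1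
  target := ball 0 1
  map_source' _ hz := hz
  map_target' w hw := by
    have : (ε : ℂ) ≠ 0 := by exact_mod_cast hε.ne'
    simpa [this] using hw
  left_inv' z _ := by
    have : (ε : ℂ) ≠ 0 := by exact_mod_cast hε.ne'
    rw [mul_div_cancel₀ _ this, add_sub_cancel]
  right_inv' w _ := by
    have : (ε : ℂ) ≠ 0 := by exact_mod_cast hε.ne'
    rw [add_sub_cancel_left, mul_div_cancel_left₀ _ this]
  open_source := isOpen_ball.preimage (by fun_prop)
  open_target := isOpen_ball
  continuousOn_toFun := by
    have : Continuous fun z => (z - y) / (ε : ℂ) := by fun_prop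
    exact this.continuousOn
  continuousOn_invFun := by
    have : Continuous fun w => y + (ε : ℂ) * w := by fun_prop
    exact this.continuousOn

/-- The sheet with index `i` over a disc inside an evenly covered set, with the chart given by the
map itself. -/
noncomputable def sheetChart {p : ℂ → ℂ} (hp : Continuous p) {m : ℕ} {U : Set ℂ} (hU : IsOpen U)
    (H : p ⁻¹' U ≃ₜ U × Fin m) (hH : ∀ x, ((H x).1 : ℂ) = p x) {y : ℂ} {ε : ℝ} (hε : 0 < ε)
    (hball : ∀ w ∈ ball (0 : ℂ) 1, y + ε * w ∈ U) (i : Fin m) : OpenPartialHomeomorph ℂ ℂ := by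
  classical
  exact
  { toFun x := (p x - y) / ε
    invFun w := if hw : w ∈ ball (0 : ℂ) 1 then H.symm (⟨y + ε * w, hball w hw⟩, i) else 0
    source := Subtype.val '' {x : p ⁻¹' U | (H x).2 = i ∧ (p x - y) / ε ∈ ball (0 : ℂ) 1}
    target := ball 0 1
    map_source' := by
      rintro _ ⟨x, ⟨-, hx⟩, rfl⟩
      exact hx
    map_target' := by
      intro w hw
      rw [dif_pos hw]
      refine ⟨_, ⟨by simp, ?_⟩, rfl⟩
      rw [← hH]
      have : (ε : ℂ) ≠ 0 := by exact_mod_cast hε.ne'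
      simpa [this] using hw
    left_inv' := by
      rintro _ ⟨x, ⟨hi, hx⟩, rfl⟩
      rw [dif_pos hx]
      have : (ε : ℂ) ≠ 0 := by exact_mod_cast hε.ne'
      congr 1
      rw [Homeomorph.symm_apply_eq]
      refine Prod.ext (Subtype.ext ?_) hi.symm
      rw [hH]
      simp only
      field_simp
      ring
    right_inv' := by
      intro w hw
      have : (ε : ℂ) ≠ 0 := by exact_mod_cast hε.ne'
      rw [dif_pos hw, ← hH]
      simp [this]
    open_source := by
      refine (hU.preimage hp).isOpenMap_subtype_val _ ?_
      have h1 : Continuous fun x : p ⁻¹' U => (H x).2 := continuous_snd.comp H.continuous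
      have h2 : Continuous fun x : p ⁻¹' U => (p x - y) / (ε : ℂ) := by fun_prop
      exact (isOpen_discrete {i} |>.preimage h1).inter (isOpen_ball.preimage h2)
    open_target := isOpen_ball
    continuousOn_toFun := by
      have : Continuous fun x => (p x - y) / (ε : ℂ) := by fun_prop
      exact this.continuousOn
    continuousOn_invFun := by
      rw [continuousOn_iff_continuous_domRestrict]
      have h1 : Continuous fun w : ball (0 : ℂ) 1 =>
          ((H.symm (⟨y + ε * w, hball w w.2⟩, i) : p ⁻¹' U) : ℂ) := by
        refine continuous_subtype_val.comp (H.symm.continuous.comp ?_)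
        exact Continuous.prodMk (Continuous.subtype_mk (by fun_prop) _) continuous_const
      refine h1.congr fun w => ?_
      change _ = dite _ _ _
      rw [dif_pos w.2] }

/-- Over a nonzero point the power map has `d` unramified sheets, over zero it has one sheet with
ramification index `d`. -/
theorem isRamifiedCovering_pow {d : ℕ} (hd : 1 ≤ d) :
    IsRamifiedCovering (fun z : ℂ => z ^ d) d := by
  have hcont : Continuous fun z : ℂ => z ^ d := by fun_prop
  refine ⟨hcont, fun y => ?_⟩
  rcases eq_or_ne y 0 with rfl | hy
  · refine ⟨.ofSet (ball 0 1) isOpen_ball, 1, fun _ => d, fun _ => .ofSet (ball 0 1) isOpen_ball,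
      by simp, rfl, rfl, fun _ => rfl, fun i j hij => absurd (Subsingleton.elim i j) hij, ?_,
      fun _ => hd, by simp, fun _ _ _ => rfl⟩
    ext z
    simp [pow_lt_one_iff_of_nonneg (norm_nonneg z) (by omega : d ≠ 0)]
  · have hcov := isCoveringMapOn_npow (𝕜 := ℂ) d (by exact_mod_cast (by omega : d ≠ 0)) y hy
    obtain ⟨e⟩ := card_preimage_pow hd hy
    have hdisc := hcov.1
    obtain ⟨-, U, hyU, hU, -, H, hH⟩ := hcov.of_fiber_homeomorph (Homeomorph.ofDiscrete e)
    obtain ⟨ε, hε, hεU⟩ := Metric.isOpen_iff.1 hU y hyU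
    have hε' : (ε : ℂ) ≠ 0 := by exact_mod_cast hε.ne'
    have hball : ∀ w ∈ ball (0 : ℂ) 1, y + ε * w ∈ U := by
      intro w hw
      refine hεU ?_
      rw [mem_ball_zero_iff] at hw
      rw [mem_ball_iff_norm, add_sub_cancel_left, norm_mul, Complex.norm_real,
        Real.norm_of_nonneg hε.le]
      nlinarith
    refine ⟨affineChart y hε, d, fun _ => 1, sheetChart hcont hU H hH hε hball, ?_, ?_, rfl,
      fun _ => rfl, fun i j hij => ?_, ?_, fun _ => le_rfl, by simp, fun i x _ => (pow_one _).symm⟩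
    · change (y - y) / (ε : ℂ) ∈ ball (0 : ℂ) 1
      simp
    · change (y - y) / (ε : ℂ) = 0
      simp
    · refine Set.disjoint_left.2 ?_
      rintro _ ⟨x, ⟨hx, -⟩, rfl⟩ ⟨x', ⟨hx', -⟩, h⟩
      rw [Subtype.ext h] at hx'
      exact hij (hx.symm.trans hx')
    · ext x
      rw [mem_iUnion]
      constructor
      · intro hx
        have hxU : x ^ d ∈ U := by
          have := hball _ hx
          rwa [mul_div_cancel₀ _ hε', add_sub_cancel] at this
        exact ⟨(H ⟨x, hxU⟩).2, ⟨x, hxU⟩, ⟨rfl, hx⟩, rfl⟩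
      · rintro ⟨i, x, ⟨-, hx⟩, rfl⟩
        exact hx

/-- The map of the plane that preserves the arguments and changes the absolute values by an
increasing bijection of the half-line. -/
noncomputable def radialMap (e : NNReal ≃o NNReal) (ξ : ℂ) : ℂ := ((e ‖ξ‖₊ : ℝ) / ‖ξ‖ : ℝ) * ξ

theorem radialMap_zero (e : NNReal ≃o NNReal) : radialMap e 0 = 0 := by simp [radialMap]

theorem norm_radialMap (e : NNReal ≃o NNReal) (ξ : ℂ) : ‖radialMap e ξ‖ = e ‖ξ‖₊ := by
  rcases eq_or_ne ξ 0 with rfl | h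
  · have : e 0 = 0 := e.map_bot
    simp [radialMap_zero, this]
  · have h' := norm_ne_zero_iff.2 h
    rw [radialMap, norm_mul, Complex.norm_real, Real.norm_of_nonneg (by positivity),
      div_mul_cancel₀ _ h']

theorem radialMap_radialMap_symm (e : NNReal ≃o NNReal) (ξ : ℂ) :
    radialMap e.symm (radialMap e ξ) = ξ := by
  rcases eq_or_ne ξ 0 with rfl | h
  · simp [radialMap_zero]
  · have h' := norm_ne_zero_iff.2 h
    have h0 : e ‖ξ‖₊ ≠ 0 := by
      intro h1
      rw [← show e 0 = 0 from e.map_bot, e.injective.eq_iff, nnnorm_eq_zero] at h1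
      exact h h1
    have h1 : (e ‖ξ‖₊ : ℝ) ≠ 0 := by exact_mod_cast h0
    have hn : ‖radialMap e ξ‖₊ = e ‖ξ‖₊ := NNReal.eq (norm_radialMap e ξ)
    rw [radialMap, hn, norm_radialMap, OrderIso.symm_apply_apply, radialMap, ← mul_assoc,
      ← Complex.ofReal_mul, coe_nnnorm, div_mul_div_comm, mul_comm ‖ξ‖, div_self (by positivity)]
    simp

theorem continuous_radialMap (e : NNReal ≃o NNReal) : Continuous (radialMap e) := by
  have hnorm : Continuous fun ξ : ℂ => (e ‖ξ‖₊ : ℝ) :=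
    NNReal.continuous_coe.comp (e.continuous.comp continuous_nnnorm)
  rw [continuous_iff_continuousAt]
  intro ξ
  rcases eq_or_ne ξ 0 with rfl | h
  · rw [ContinuousAt, radialMap_zero, tendsto_zero_iff_norm_tendsto_zero]
    simp_rw [norm_radialMap]
    have := hnorm.tendsto 0
    rwa [nnnorm_zero, show e 0 = 0 from e.map_bot, NNReal.coe_zero] at this
  · have h' := norm_ne_zero_iff.2 h
    unfold radialMap
    exact (Complex.continuous_ofReal.continuousAt.comp
      (hnorm.continuousAt.div continuous_norm.continuousAt h')).mul continuousAt_id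

/-- The map `radialMap` as a homeomorphism. -/
noncomputable def radialHomeomorph (e : NNReal ≃o NNReal) : ℂ ≃ₜ ℂ where
  toFun := radialMap e
  invFun := radialMap e.symm
  left_inv := radialMap_radialMap_symm e
  right_inv := radialMap_radialMap_symm e.symm
  continuous_toFun := continuous_radialMap e
  continuous_invFun := continuous_radialMap e.symm

theorem radialHomeomorph_eq (e : NNReal ≃o NNReal) (ξ : ℂ) :
    radialHomeomorph e ξ = (e ‖ξ‖₊ : ℝ) * Complex.exp (ξ.arg * Complex.I) := by
  rcases eq_or_ne ξ 0 with rfl | h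
  · have : e 0 = 0 := e.map_bot
    refine (radialMap_zero e).trans ?_
    simp [this]
  · have h' : (‖ξ‖ : ℂ) ≠ 0 := by exact_mod_cast norm_ne_zero_iff.2 h
    change radialMap e ξ = _
    rw [radialMap]
    nth_rw 3 [← Complex.norm_mul_exp_arg_mul_I ξ]
    push_cast
    field_simp

theorem exists_orderIso_of_bijOn {σ : ℝ → ℝ} (hmono : StrictMonoOn σ (Ici 0))
    (hbij : BijOn σ (Ici 0) (Ici 0)) : ∃ e : NNReal ≃o NNReal, ∀ S : NNReal, (e S : ℝ) = σ S := by
  let f : NNReal → NNReal := fun S => ⟨σ S, hbij.mapsTo S.2⟩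
  have hf : StrictMono f := fun S S' h => hmono S.2 S'.2 h
  have hs : Function.Surjective f := fun S => by
    obtain ⟨x, hx, h⟩ := hbij.surjOn S.2
    exact ⟨⟨x, hx⟩, NNReal.eq h⟩
  exact ⟨hf.orderIsoOfSurjective f hs, fun S => rfl⟩

/-- The map `S exp (iθ) ↦ σ S exp (i d θ)` is a radial homeomorphism, with radial function the
`d`-th root of `σ`, followed by the power map. -/
theorem exists_radialHomeomorph_pow {d : ℕ} (hd : 1 ≤ d) {σ : ℝ → ℝ}
    (hmono : StrictMonoOn σ (Ici 0)) (hbij : BijOn σ (Ici 0) (Ici 0)) :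
    ∃ e : ℂ ≃ₜ ℂ, ∀ ξ, e ξ ^ d = σ ‖ξ‖ * Complex.exp ((d * ξ.arg : ℝ) * Complex.I) := by
  obtain ⟨e, he⟩ := exists_orderIso_of_bijOn hmono hbij
  have hd' : (0 : ℝ) < (d : ℝ)⁻¹ := by positivity
  refine ⟨radialHomeomorph (e.trans (NNReal.orderIsoRpow _ hd')), fun ξ => ?_⟩
  rw [radialHomeomorph_eq, mul_pow, ← Complex.exp_nat_mul, ← Complex.ofReal_pow]
  congr 2
  · rw [← NNReal.coe_pow]
    have : (e.trans (NNReal.orderIsoRpow _ hd')) ‖ξ‖₊ = e ‖ξ‖₊ ^ ((d : ℝ)⁻¹) := rfl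
    rw [this, NNReal.rpow_inv_natCast_pow _ (by omega), he, coe_nnnorm]
  · push_cast
    ring

/-! ### The extension on the geodesic discs and on the axis -/

theorem douadyEarle_discHomeomorph {d : ℕ} (hd : 1 ≤ d) {σ : ℝ → ℝ}
    (hσ : ∀ S, 0 ≤ S → axisMean d S (σ S / √(1 + σ S ^ 2)) = 0) (L : ℝ) (ξ : ℂ) :
    douadyEarle (hat (powMap d)) (discPoint L ξ) =
      discPoint (d * L) (σ ‖ξ‖ * Complex.exp ((d * ξ.arg : ℝ) * Complex.I)) := by
  conv_lhs => rw [← Complex.norm_mul_exp_arg_mul_I ξ]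
  exact douadyEarle_discPoint hd (hσ _ (norm_nonneg ξ)) L ξ.arg

/-- The increasing diffeomorphism of the interval `[0, 1)` that corresponds to the power with
exponent `α` under the homography `s ↦ (1 + s) / (1 - s)` onto `[1, ∞)`. -/
noncomputable def axisPow (α s : ℝ) : ℝ :=
  (((1 + s) / (1 - s)) ^ α - 1) / (((1 + s) / (1 - s)) ^ α + 1)

theorem one_le_homography {s : ℝ} (hs : s ∈ Ico (0 : ℝ) 1) : 1 ≤ (1 + s) / (1 - s) := by
  rw [le_div_iff₀ (by linarith [hs.2])]
  linarith [hs.1]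

theorem homography_inv {q : ℝ} (hq : 0 < q) :
    (1 + (q - 1) / (q + 1)) / (1 - (q - 1) / (q + 1)) = q := by
  have h1 : 1 + (q - 1) / (q + 1) = 2 * q / (q + 1) := by field_simp; ring
  have h2 : 1 - (q - 1) / (q + 1) = 2 / (q + 1) := by field_simp; ring
  rw [h1, h2]
  field_simp

theorem inv_homography {s : ℝ} (hs : s < 1) :
    ((1 + s) / (1 - s) - 1) / ((1 + s) / (1 - s) + 1) = s := by
  have h : 0 < 1 - s := by linarith
  have h1 : (1 + s) / (1 - s) - 1 = 2 * s / (1 - s) := by field_simp; ring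
  have h2 : (1 + s) / (1 - s) + 1 = 2 / (1 - s) := by field_simp; ring
  rw [h1, h2]
  field_simp

theorem axisPow_mem {α : ℝ} (hα : 0 ≤ α) {s : ℝ} (hs : s ∈ Ico (0 : ℝ) 1) :
    axisPow α s ∈ Ico (0 : ℝ) 1 := by
  have h := Real.one_le_rpow (one_le_homography hs) hα
  rw [axisPow]
  refine ⟨div_nonneg (by linarith) (by linarith), ?_⟩
  rw [div_lt_one (by linarith)]
  linarith

theorem axisPow_axisPow {α β : ℝ} (hαβ : α * β = 1) {s : ℝ}
    (hs : s ∈ Ico (0 : ℝ) 1) : axisPow β (axisPow α s) = s := by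
  have h := one_pos.trans_le (one_le_homography hs)
  rw [axisPow.eq_def β, axisPow, homography_inv (Real.rpow_pos_of_pos h α), ← Real.rpow_mul h.le,
    hαβ, Real.rpow_one, inv_homography hs.2]

theorem axisPow_strictMonoOn {α : ℝ} (hα : 0 < α) : StrictMonoOn (axisPow α) (Ico 0 1) := by
  intro s hs s' hs' h
  have h1 := one_le_homography hs
  have h2 : (1 + s) / (1 - s) < (1 + s') / (1 - s') := by
    rw [div_lt_div_iff₀ (by linarith [hs.2]) (by linarith [hs'.2])]
    nlinarith
  have h3 := Real.rpow_lt_rpow (by linarith) h2 hα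
  have h4 := Real.one_le_rpow h1 hα.le
  rw [axisPow, axisPow, div_lt_div_iff₀ (by linarith) (by linarith)]
  nlinarith

theorem contDiffOn_axisPow (α : ℝ) : ContDiffOn ℝ ∞ (axisPow α) (Ico 0 1) := by
  have h1 : ContDiffOn ℝ ∞ (fun s : ℝ => (1 + s) / (1 - s)) (Ico 0 1) :=
    (contDiff_const.add contDiff_id).contDiffOn.div (contDiff_const.sub contDiff_id).contDiffOn
      fun s hs => (sub_pos.2 hs.2).ne'
  have h2 : ContDiffOn ℝ ∞ (fun s : ℝ => ((1 + s) / (1 - s)) ^ α) (Ico 0 1) :=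
    h1.rpow_const_of_ne fun s hs => (one_pos.trans_le (one_le_homography hs)).ne'
  exact (h2.sub contDiffOn_const).div (h2.add contDiffOn_const) fun s hs =>
    (add_pos (Real.rpow_pos_of_pos (one_pos.trans_le (one_le_homography hs)) α) one_pos).ne'

theorem isIncreasingDiffeo_axisPow {α : ℝ} (hα : 0 < α) :
    IsIncreasingDiffeo (axisPow α) (Ico 0 1) (Ico 0 1) := by
  have hsurj : SurjOn (axisPow α) (Ico 0 1) (Ico 0 1) := fun s hs =>
    ⟨axisPow α⁻¹ s, axisPow_mem (inv_nonneg.2 hα.le) hs,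
      axisPow_axisPow (inv_mul_cancel₀ hα.ne') hs⟩
  have hmono := axisPow_strictMonoOn hα
  refine ⟨⟨fun s hs => axisPow_mem hα.le hs, hmono.injOn, hsurj⟩, hmono, contDiffOn_axisPow α,
    (contDiffOn_axisPow α⁻¹).congr fun s hs => hmono.injOn (Function.invFunOn_mem (hsurj hs))
      (axisPow_mem (inv_nonneg.2 hα.le) hs) ?_⟩
  rw [Function.invFunOn_eq (hsurj hs), axisPow_axisPow (inv_mul_cancel₀ hα.ne') hs]

theorem discPoint_zero {q : ℝ} (hq : 0 < q) :
    discPoint (-Real.log q) 0 = ((q - 1) / (q + 1)) • e3 := by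
  have h1 : discHyp (-Real.log q) 0 = Real.sinh (Real.log q) • e3 := by
    ext i
    fin_cases i <;> simp [discHyp, e3]
  have h2 : lift (discHyp (-Real.log q) 0) = Real.cosh (Real.log q) := by
    rw [lift_discHyp]; simp
  rw [discPoint, ballPoint, h2, h1, smul_smul, Real.cosh_log hq, Real.sinh_log hq]
  congr 1
  field_simp
  ring

/-- A point of the third axis is the center of a geodesic disc; in the coordinate
`q = (1 + s) / (1 - s)` the height of that disc is `log q`, which the extension multiplies
by `d`. -/
theorem douadyEarle_axis {d : ℕ} (hd : 1 ≤ d) (h0 : axisMean d 0 0 = 0) {s : ℝ}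
    (hs : s ∈ Ico (0 : ℝ) 1) :
    douadyEarle (hat (powMap d)) (s • e3) = axisPow d s • e3 := by
  have hq := one_pos.trans_le (one_le_homography hs)
  have h := douadyEarle_discPoint (S := 0) (S' := 0) hd (by simpa using h0)
    (-Real.log ((1 + s) / (1 - s))) 0
  simp only [Complex.ofReal_zero, zero_mul] at h
  rw [discPoint_zero hq, inv_homography hs.2, mul_neg, ← Real.log_pow,
    discPoint_zero (pow_pos hq d)] at h
  rw [h, axisPow, Real.rpow_natCast]

theorem mainTheorem7 (d : ℕ) (hd : 1 ≤ d) :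
    (∀ t : ℝ, 0 < t →
      ∃ h : Set.MapsTo (douadyEarle (hat (powMap d))) (discD t) (discD (t ^ d)),
        Function.Surjective (h.restrict (douadyEarle (hat (powMap d))) (discD t) (discD (t ^ d))) ∧
        IsRamifiedCovering
          (h.restrict (douadyEarle (hat (powMap d))) (discD t) (discD (t ^ d))) d) ∧
    (∃ τ : ℝ → ℝ, IsIncreasingDiffeo τ (Set.Ico 0 1) (Set.Ico 0 1) ∧
      ∀ s ∈ Set.Ico (0 : ℝ) 1, douadyEarle (hat (powMap d)) (s • e3) = τ s • e3) := by
  refine ⟨fun t ht => ?_, axisPow d, isIncreasingDiffeo_axisPow (by positivity), fun s hs =>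
    douadyEarle_axis hd (axisMean_zero_zero hd) hs⟩
  obtain ⟨σ, hmono, hbij, hσ⟩ := exists_radial hd
  obtain ⟨e, he⟩ := exists_radialHomeomorph_pow hd hmono hbij
  have htd : 0 < t ^ d := pow_pos ht d
  have key : ∀ x : discD t, douadyEarle (hat (powMap d)) x =
      discHomeomorph htd (e ((discHomeomorph ht).symm x) ^ d) := by
    intro x
    obtain ⟨ξ, rfl⟩ := (discHomeomorph ht).surjective x
    rw [Homeomorph.symm_apply_apply, coe_discHomeomorph, coe_discHomeomorph, he, Real.log_pow,
      douadyEarle_discHomeomorph hd hσ]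
  have hmaps : MapsTo (douadyEarle (hat (powMap d))) (discD t) (discD (t ^ d)) := fun x hx => by
    rw [key ⟨x, hx⟩]
    exact Subtype.coe_prop _
  have heq : hmaps.restrict (douadyEarle (hat (powMap d))) (discD t) (discD (t ^ d)) =
      discHomeomorph htd ∘ (fun z : ℂ => z ^ d) ∘ ((discHomeomorph ht).symm.trans e) :=
    funext fun x => Subtype.ext (key x)
  refine ⟨hmaps, ?_, ?_⟩
  · rw [heq]
    exact (discHomeomorph htd).surjective.comp
      ((surjective_pow hd).comp ((discHomeomorph ht).symm.trans e).surjective)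
  · rw [heq]
    exact (isRamifiedCovering_pow hd).comp_homeomorph _ _
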